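/- **Theorem 1.4.** Let $(X,d,\mu)$ be a space of homogeneous type: $d$ is a quasi-metric on $X$ (symmetric, $d(x,y)=0$ iff $x=y$, and $d(x,y)\le A_0[d(x,z)+d(z,y)]$ for some constant $A_0\ge 1$), and $\mu$ is a nonzero Borel measure (for the topology in which $\Omega$ is open iff it contains a ball $B(x,\tau)$, $\tau>0$, around each of its points $x$) for which the balls $B(x,r)=\{y: d(x,y)<r\}$ are $\mu$-measurable and $\mu(B(x,2r))\le C_\mu\,\mu(B(x,r))<\infty$ for all $x\in X$, $r>0$. Assume $\mu(X)=\infty$ and $\mu(\{x\})=0$ for every $x\in X$. Below, $B$ and $B'$ denote balls of positive radius, $f_B=\mu(B)^{-1}\int_B f\,d\mu$, and "locally integrable" means integrable over every ball. Let $0<\gamma<1$, $1<p<1/\gamma$, $\frac1q=\frac1p-\gamma$, $\frac1p+\frac1{p'}=1$, and let $\kappa\in(0,1)$ be such that also $\kappa q/p\in(0,1)$. Let $\omega\in A_{p,q}(X)$, i.e. $\omega$ is a nonnegative locally integrable function, not a.e. zero, with $$\sup_B\Big(\frac1{\mu(B)}\int_B\omega^q\,d\mu\Big)^{1/q}\Big(\frac1{\mu(B)}\int_B\omega^{-p'}\,d\mu\Big)^{1/p'}<\infty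 .$$ For weights $u,v$, $1<s<\infty$ and $0<\lambda<1$ put $$\|f\|_{L^{s,\lambda}_{(u,v)}}=\sup_B\Big(\frac1{v(B)^{\lambda}}\int_B|f|^s\,u\,d\mu\Big)^{1/s},\qquad v(B)=\int_B v\,d\mu,$$ let $L^{s,\lambda}_{(u,v)}(X)$ be the set of $f\in L^s_{\rm loc}(X,v)$ for which this norm is finite, and write $L^{s,\lambda}_{u}=L^{s,\lambda}_{(u,u)}$. For a ball $B_0$ let $$M_\gamma f(x)=\sup_{B\ni x}\frac1{\mu(B)^{1-\gamma}}\int_B|f|\,d\mu,\qquad M_{\gamma,B_0}f(x)=\sup_{x\in B\subset B_0}\frac1{\mu(B)^{1-\gamma}}\int_B|f|\,d\mu,$$ and $[M_\gamma,b]f(x)=b(x)M_\gamma f(x)-M_\gamma(bf)(x)$. Let $b$ be a real-valued, locally integrable function on $X$. Then the following are equivalent: (i) $b\in BMO(X)$, i.e. $\sup_B\frac1{\mu(B)}\int_B|b-b_B|\,d\mu<\infty$, and $b^-=\max(-b,0)\in L^\infty(X)$; (ii) $[M_\gamma,b]$ is bounded from $L^{p,\kappa}_{(\omega^p,\omega^q)}(X)$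 to $L^{q,\kappa q/p}_{\omega^q}(X)$, i.e. there is a constant $C<\infty$ with $\|[M_\gamma,b]f\|_{L^{q,\kappa q/p}_{\omega^q}}\le C\,\|f\|_{L^{p,\kappa}_{(\omega^p,\omega^q)}}$ for all $f\in L^{p,\kappa}_{(\omega^p,\omega^q)}(X)$; (iii) there is a constant $C<\infty$ such that $$\sup_{B}\frac{\big\|\big(b-\mu(B)^{-\gamma}M_{\gamma,B}(b)\big)\chi_B\big\|_{L^{q,\kappa q/p}_{\omega^q}}}{\|\chi_B\|_{L^{q,\kappa q/p}_{\omega^q}}}<C .$$ -/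

import Mathlib

open MeasureTheory
open scoped ENNReal NNReal

/-- `d` is a quasi-metric on `X`: nonnegative, symmetric, separating points, and satisfying the
triangle inequality up to a constant `A₀ ≥ 1`. -/
structure IsQuasiMetric {X : Type*} (d : X → X → ℝ) : Prop where
  nonneg : ∀ x y, 0 ≤ d x y
  symm : ∀ x y, d x y = d y x
  eq_zero_iff : ∀ x y, d x y = 0 ↔ x = y
  quasi_triangle : ∃ A₀ : ℝ, 1 ≤ A₀ ∧ ∀ x y z, d x y ≤ A₀ * (d x z + d z y)

/-- The quasi-metric ball `B(x,r) = {y : d(x,y) < r}`. -/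
def qBall {X : Type*} (d : X → X → ℝ) (x : X) (r : ℝ) : Set X := {y | d x y < r}

/-- The family of all quasi-metric balls (of positive radius), as subsets of `X`. -/
def balls {X : Type*} (d : X → X → ℝ) : Set (Set X) :=
  {B | ∃ (x : X) (r : ℝ), 0 < r ∧ B = qBall d x r}

/-- The topology induced by `d`: `Ω` is open iff it contains a ball around each of its points. -/
@[reducible] def quasiTopology {X : Type*} (d : X → X → ℝ) : TopologicalSpace X where
  IsOpen Ω := ∀ x ∈ Ω, ∃ τ : ℝ, 0 < τ ∧ qBall d x τ ⊆ Ω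
  isOpen_univ := fun _ _ => ⟨1, one_pos, Set.subset_univ _⟩
  isOpen_inter := by
    intro s t hs ht x hx
    obtain ⟨a, ha, has⟩ := hs x hx.1
    obtain ⟨b, hb, hbt⟩ := ht x hx.2
    refine ⟨min a b, lt_min ha hb, fun y hy => ⟨has ?_, hbt ?_⟩⟩
    · exact lt_of_lt_of_le hy (min_le_left a b)
    · exact lt_of_lt_of_le hy (min_le_right a b)
  isOpen_sUnion := by
    intro S hS x hx
    obtain ⟨t, htS, hxt⟩ := hx
    obtain ⟨τ, hτ, hsub⟩ := hS t htS x hxt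
    exact ⟨τ, hτ, hsub.trans (Set.subset_sUnion_of_mem htS)⟩

/-- `(X,d,μ)` is a space of homogeneous type in the sense of Coifman and Weiss: `d` is a
quasi-metric, and `μ` is a nonzero Borel measure (for the topology of `d`) for which the balls are
`μ`-measurable and `μ(B(x,2r)) ≤ C μ(B(x,r)) < ∞` for all `x` and `r > 0`. -/
structure IsHomogeneousType {X : Type*} [mX : MeasurableSpace X] (d : X → X → ℝ)
    (μ : Measure X) : Prop where
  quasiMetric : IsQuasiMetric d
  borel : mX = @borel X (quasiTopology d)
  ball_measurable : ∀ B ∈ balls d, NullMeasurableSet B μ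
  ne_zero : μ ≠ 0
  doubling : ∃ C : ℝ≥0, ∀ (x : X) (r : ℝ), 0 < r →
    μ (qBall d x (2 * r)) ≤ C * μ (qBall d x r) ∧ C * μ (qBall d x r) < ∞

section

variable {X : Type*} [MeasurableSpace X]

/-- `f ∈ L¹_loc(X)`: `f` is integrable over every ball. -/
def LocIntegrable (d : X → X → ℝ) (μ : Measure X) (f : X → ℝ) : Prop :=
  ∀ B ∈ balls d, IntegrableOn f B μ

/-- A weight: a nonnegative locally integrable function that does not vanish almost everywhere. -/
structure IsWeight (d : X → X → ℝ) (μ : Measure X) (ω : X → ℝ) : Prop where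
  nonneg : ∀ x, 0 ≤ ω x
  locIntegrable : LocIntegrable d μ ω
  ne_zero : ¬ ∀ᵐ x ∂μ, ω x = 0

/-- The power `ω^s` of a weight as a function with values in `[0,∞]`; thus `0^s = ∞` when
`s < 0`. -/
noncomputable def wpow (ω : X → ℝ) (s : ℝ) : X → ℝ≥0∞ := fun x => ENNReal.ofReal (ω x) ^ s

/-- The average `μ(B)⁻¹ ∫_B g dμ` of a function with values in `[0,∞]`. -/
noncomputable def eAverage (μ : Measure X) (B : Set X) (g : X → ℝ≥0∞) : ℝ≥0∞ :=
  (∫⁻ y in B, g y ∂μ) / μ B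

/-- The `A_{p,q}` constant of `ω`, where `p' = p / (p - 1)`. -/
noncomputable def apqConst (d : X → X → ℝ) (μ : Measure X) (p q : ℝ) (ω : X → ℝ) : ℝ≥0∞ :=
  ⨆ B ∈ balls d, eAverage μ B (wpow ω q) ^ (1 / q) *
    eAverage μ B (wpow ω (-(p / (p - 1)))) ^ (1 / (p / (p - 1)))

/-- `ω ∈ A_{p,q}(X)`. -/
def MemApq (d : X → X → ℝ) (μ : Measure X) (p q : ℝ) (ω : X → ℝ) : Prop :=
  IsWeight d μ ω ∧ apqConst d μ p q ω < ∞

/-- `b ∈ BMO(X)`. -/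
def MemBMO (d : X → X → ℝ) (μ : Measure X) (b : X → ℝ) : Prop :=
  LocIntegrable d μ b ∧
    (⨆ B ∈ balls d, eAverage μ B (fun x => ‖b x - ⨍ y in B, b y ∂μ‖ₑ)) < ∞

/-- The Morrey norm
`sup_B ( v(B)^{-κ} ∫_B g^p u dμ )^{1/p}` of a function `g` with values in `[0,∞]` (the modulus of
the function whose norm is taken), for the weights `u` and `v`, where `v(B) = ∫_B v dμ`. -/
noncomputable def morreyNorm (d : X → X → ℝ) (μ : Measure X) (p κ : ℝ) (u v : X → ℝ≥0∞)
    (g : X → ℝ≥0∞) : ℝ≥0∞ :=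
  ⨆ B ∈ balls d, ((∫⁻ y in B, g y ^ p * u y ∂μ) / (∫⁻ y in B, v y ∂μ) ^ κ) ^ (1 / p)

/-- `f ∈ L^{p,κ}_{u,v}(X)`: `f ∈ L^p_loc(X,v)` and the Morrey norm of `f` is finite. -/
def MemMorrey {𝕜 : Type*} [RCLike 𝕜] (d : X → X → ℝ) (μ : Measure X) (p κ : ℝ)
    (u v : X → ℝ≥0∞) (f : X → 𝕜) : Prop :=
  AEStronglyMeasurable f μ ∧
    (∀ B ∈ balls d, ∫⁻ y in B, ‖f y‖ₑ ^ p * v y ∂μ < ∞) ∧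
    morreyNorm d μ p κ u v (fun x => ‖f x‖ₑ) < ∞

/-- The fractional maximal function
`M_γ f(x) = sup_{B ∋ x} μ(B)^{-(1-γ)} ∫_B |f| dμ`, with values in `[0,∞]`. -/
noncomputable def fracMax {𝕜 : Type*} [RCLike 𝕜] (d : X → X → ℝ) (μ : Measure X) (γ : ℝ)
    (f : X → 𝕜) (x : X) : ℝ≥0∞ :=
  ⨆ B ∈ {B ∈ balls d | x ∈ B}, (∫⁻ y in B, ‖f y‖ₑ ∂μ) / μ B ^ (1 - γ)

/-- The fractional maximal function `M_{γ,B₀} f` relative to `B₀`: only the balls `B` with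
`x ∈ B ⊆ B₀` are used. -/
noncomputable def fracMaxRel {𝕜 : Type*} [RCLike 𝕜] (d : X → X → ℝ) (μ : Measure X) (γ : ℝ)
    (B₀ : Set X) (f : X → 𝕜) (x : X) : ℝ≥0∞ :=
  ⨆ B ∈ {B ∈ balls d | x ∈ B ∧ B ⊆ B₀}, (∫⁻ y in B, ‖f y‖ₑ ∂μ) / μ B ^ (1 - γ)

/-- The commutator `[M_γ,b]f(x) = b(x) M_γ f(x) - M_γ(bf)(x)`. It is computed in the extended
reals, where `∞ - ∞ = -∞` and `0 * ∞ = 0`, so its modulus is infinite where the difference is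
`∞ - ∞`. -/
noncomputable def fracMaxCommutator {𝕜 : Type*} [RCLike 𝕜] (d : X → X → ℝ) (μ : Measure X)
    (γ : ℝ) (b : X → ℝ) (f : X → 𝕜) (x : X) : EReal :=
  (b x : EReal) * (fracMax d μ γ f x : EReal) - (fracMax d μ γ (fun y => (b y : 𝕜) * f y) x : EReal)

/-- The modulus of `(b - μ(B)^{-γ} M_{γ,B}(b)) χ_B`, with values in `[0,∞]`. -/
noncomputable def localOscillation (d : X → X → ℝ) (μ : Measure X) (γ : ℝ) (b : X → ℝ)
    (B : Set X) : X → ℝ≥0∞ :=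
  B.indicator fun x =>
    ((b x : EReal) - ((μ B ^ (-γ) * fracMaxRel d μ γ B b x : ℝ≥0∞) : EReal)).abs

end

/-! A power of the quasi-metric is comparable with a metric (`exists_metricSpace_of_isQuasiMetric`).
Each quasi-metric ball then lies between two concentric metric balls with radii in ratio two, and
conversely, and μ is doubling for the metric. The real analysis is done with metric balls; returning
to quasi-metric balls costs only constants.

The weight enters through the pair v = ω^q, σ = ω^(-p'), with a = 1/q and b = 1/p': v^a σ^b = 1
almost everywhere and v(B)^a σ(B)^b ≤ A μ(B)^(a+b), where a + b = 1 - γ (`IsDualPair`). The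
condition is symmetric in v and σ. It makes both weights doubling and gives both a reverse Hölder
inequality.

(i) implies (ii) and (iii). Where b ≥ -β, the function |[M_γ,b]f|(x) is at most sup_{B∋x} μ(B)^(γ-1)
∫_B |b(y)-b(x)||f(y)| dy plus 2β M_γ f(x). Since |b(y)-b(x)| + 1 is at most a constant times
e^(ε(b(x)-b(y))) + e^(-ε(b(x)-b(y))), both terms are dominated by the conjugated operators e^(±εb)
M_γ(e^(∓εb) f) (`averageSup_add_averageSup_le`). By the John–Nirenberg and reverse Hölder
inequalities, v e^(tb/a) and σ e^(-tb/b₀), with b₀ = 1/p', again form a dual pair for small |t|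
(`IsDualPair.exists_perturbation`), so bounding a conjugated operator is bounding M_γ itself for
perturbed weights. In the Morrey norm on a ball B (`IsDualPair.exists_morrey_bound`), the part of f
in 2B is handled by the weighted L^p to L^q bound for M_γ (`IsDualPair.lintegral_ballMax_le`). Only
averages over larger concentric balls remain. These are a supremum, not a sum, so it suffices that
v_t(B_r)/v_t(B_R) ≤ K (v(B_r)/v(B_R))^l with l = κq/p, which follows by interpolating between two
dual pairs (`IsDualPair.exists_ratio_le`). For (iii) the same estimate is applied to f = χ_B.

(ii) or (iii) implies (i). On B one has M_γ χ_B = μ(B)^γ and M_γ(bχ_B) ≥ μ(B)^γ |b|_B, and likewise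
M_{γ,B}(b) ≥ μ(B)^γ |b|_B. Hence the positive part of |b|_B - b is controlled on B in either case,
and Hölder's inequality with the dual pair bounds its plain mean over B
(`memBMO_and_memLp_of_morreyNorm_le`). That one quantity controls the oscillation of b, because
|b|_B ≥ b_B, and also the mean of b⁻, because |b| - b = 2b⁻ (`oscillation_le_of_average_abs_sub`).
Lebesgue differentiation then bounds b⁻. -/

namespace DoublingSpace

open Metric Set Filter TopologicalSpace
open scoped Topology

/-- A measure on a metric space that is positive and finite on balls and satisfies the global
doubling condition with constant `C`. -/
structure IsDoubling {X : Type*} [MetricSpace X] [MeasurableSpace X] (ν : Measure X) (C : ℝ≥0) :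
    Prop where
  pos : ∀ x r, 0 < r → 0 < ν (ball x r)
  lt_top : ∀ x r, ν (ball x r) < ∞
  doubling : ∀ x r, 0 < r → ν (ball x (2 * r)) ≤ C * ν (ball x r)

/-! ### Doubling measures on a metric space. -/

section Basic

variable {X : Type*} [MetricSpace X] [MeasurableSpace X] {ν : Measure X} {C : ℝ≥0}

lemma IsDoubling.ball_two_pow (h : IsDoubling ν C) (x : X) {r : ℝ} (hr : 0 < r) (n : ℕ) :
    ν (ball x (2 ^ n * r)) ≤ (C : ℝ≥0∞) ^ n * ν (ball x r) := by
  induction n with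
  | zero => simp
  | succ n ih =>
    calc ν (ball x (2 ^ (n + 1) * r)) = ν (ball x (2 * (2 ^ n * r))) := by
          congr 2; ring
      _ ≤ C * ν (ball x (2 ^ n * r)) := h.doubling _ _ (by positivity)
      _ ≤ C * ((C : ℝ≥0∞) ^ n * ν (ball x r)) := by gcongr
      _ = _ := by rw [pow_succ]; ring

lemma IsDoubling.ball_le (h : IsDoubling ν C) {x y : X} {r R : ℝ} (hr : 0 < r) (n : ℕ)
    (hR : R + dist y x ≤ 2 ^ n * r) : ν (ball y R) ≤ (C : ℝ≥0∞) ^ n * ν (ball x r) :=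
  (measure_mono (ball_subset_ball' hR)).trans (h.ball_two_pow x hr n)

lemma IsDoubling.ne_zero (h : IsDoubling ν C) {x : X} {r : ℝ} (hr : 0 < r) : ν (ball x r) ≠ 0 :=
  (h.pos x r hr).ne'

lemma IsDoubling.ne_top (h : IsDoubling ν C) {x : X} {r : ℝ} : ν (ball x r) ≠ ∞ :=
  (h.lt_top x r).ne

lemma IsDoubling.one_le (h : IsDoubling ν C) (x : X) : 1 ≤ (C : ℝ≥0∞) := by
  have h1 := h.doubling x 1 one_pos
  have h2 : ν (ball x 1) ≤ ν (ball x (2 * 1)) := measure_mono (ball_subset_ball (by norm_num))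
  by_contra hC
  push Not at hC
  have : C * ν (ball x 1) < 1 * ν (ball x 1) :=
    ENNReal.mul_lt_mul_left (h.ne_zero one_pos) h.ne_top hC
  rw [one_mul] at this
  exact absurd (h2.trans h1) (not_le.2 this)

lemma IsDoubling.sigmaFinite (h : IsDoubling ν C) : SigmaFinite ν := by
  rcases isEmpty_or_nonempty X with hX | ⟨⟨x⟩⟩
  · have : ν = 0 := Measure.eq_zero_of_isEmpty ν
    rw [this]; infer_instance
  · refine ⟨⟨⟨fun n : ℕ => ball x n, fun n => trivial, fun n => h.lt_top _ _, ?_⟩⟩⟩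
    exact iUnion_ball_nat x

lemma IsDoubling.isLocallyFiniteMeasure (h : IsDoubling ν C) : IsLocallyFiniteMeasure ν :=
  ⟨fun x => ⟨ball x 1, ball_mem_nhds x one_pos, h.lt_top _ _⟩⟩

/-- A maximal disjoint family of balls of radius ε/4 is countable, since each ball has positive mass
and the measure is σ-finite. The fourfold enlargements cover, so the centres are ε-dense. -/
lemma IsDoubling.secondCountable [OpensMeasurableSpace X] (h : IsDoubling ν C) :
    SecondCountableTopology X := by
  have := h.sigmaFinite
  refine Metric.secondCountable_of_almost_dense_set fun ε hε => ?_
  obtain ⟨u, -, hdisj, hcov⟩ := Vitali.exists_disjoint_subfamily_covering_enlargement_ball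
    (univ : Set X) id (fun _ => ε / 4) (ε / 4) (fun _ _ => le_rfl) 4 (by norm_num)
  refine ⟨u, ?_, fun x => ?_⟩
  · have := Measure.countable_meas_pos_of_disjoint_iUnion (μ := ν)
      (As := fun a : u => ball (a : X) (ε / 4)) (fun _ => measurableSet_ball)
      ((pairwise_subtype_iff_pairwise_set u _).2 hdisj)
    have h2 : {i : u | 0 < ν (ball (i : X) (ε / 4))} = univ :=
      eq_univ_of_forall fun i => h.pos _ _ (by positivity)
    rw [h2] at this
    exact countable_coe_iff.1 (countable_univ_iff.1 this)
  · obtain ⟨b, hb, hsub⟩ := hcov x (mem_univ x)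
    refine ⟨b, hb, ?_⟩
    have := hsub (mem_ball_self (by positivity))
    rw [mem_ball] at this
    simp only [id] at this
    linarith

lemma IsDoubling.isUnifLocDoublingMeasure (h : IsDoubling ν C) : IsUnifLocDoublingMeasure ν := by
  refine ⟨⟨C ^ 2, ?_⟩⟩
  filter_upwards [self_mem_nhdsWithin] with ε (hε : 0 < ε) x
  calc ν (closedBall x (2 * ε)) ≤ ν (ball x (2 ^ 2 * ε)) :=
        measure_mono (closedBall_subset_ball (by linarith))
    _ ≤ (C : ℝ≥0∞) ^ 2 * ν (ball x ε) := h.ball_two_pow x hε 2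
    _ ≤ _ := by
        rw [ENNReal.coe_pow]
        gcongr
        exact ball_subset_closedBall

end Basic

/-! ### Lebesgue differentiation along balls. -/

section Lebesgue

variable {X : Type*} [MetricSpace X] [MeasurableSpace X] [BorelSpace X]
  {ν : Measure X} {C : ℝ≥0} {g : X → ℝ≥0∞}

/-- Differentiation along the Vitali family produces closed balls. Enlarging a closed ball of radius
δ to the open ball of radius 2δ costs one doubling constant, which is the factor C in front of t. -/
lemma IsDoubling.ae_exists_ball_of_lintegral_ne_top (h : IsDoubling ν C) (hg : AEMeasurable g ν)
    (hfin : ∫⁻ x, g x ∂ν ≠ ∞) :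
    ∀ᵐ x ∂ν, ∀ t : ℝ≥0∞, C * t < g x → ∀ R > (0 : ℝ), ∃ δ, 0 < δ ∧ δ < R ∧
      t * ν (ball x δ) < ∫⁻ y in ball x δ, g y ∂ν := by
  have := h.secondCountable
  have := h.isUnifLocDoublingMeasure
  have := h.isLocallyFiniteMeasure
  filter_upwards [(IsUnifLocDoublingMeasure.vitaliFamily ν 1).ae_tendsto_lintegral_div hg hfin]
    with x hx t ht R hR
  have hlim := hx.comp (IsUnifLocDoublingMeasure.tendsto_closedBall_filterAt ν (K := 1)
    (l := 𝓝[>] (0 : ℝ)) (fun _ => x) id tendsto_id (by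
      filter_upwards [self_mem_nhdsWithin] with δ (hδ : 0 < δ)
      simpa using hδ.le))
  have h1 : ∀ᶠ δ in 𝓝[>] (0 : ℝ), δ < R / 2 :=
    (eventually_lt_nhds (by positivity)).filter_mono nhdsWithin_le_nhds
  obtain ⟨δ, hδ1, hδ2, hδ0⟩ := ((hlim.eventually (lt_mem_nhds ht)).and
    (h1.and self_mem_nhdsWithin)).exists
  simp only [Function.comp, id] at hδ1
  replace hδ0 : 0 < δ := hδ0
  refine ⟨2 * δ, by positivity, by linarith, ?_⟩
  have hlt := ENNReal.mul_lt_of_lt_div hδ1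
  calc t * ν (ball x (2 * δ)) ≤ t * (C * ν (ball x δ)) := by gcongr; exact h.doubling _ _ hδ0
    _ = C * t * ν (ball x δ) := by ring
    _ ≤ C * t * ν (closedBall x δ) := by gcongr; exact ball_subset_closedBall
    _ < ∫⁻ y in closedBall x δ, g y ∂ν := hlt
    _ ≤ _ := lintegral_mono_set (closedBall_subset_ball (by linarith))

/-- A form of the Lebesgue differentiation theorem: almost everywhere, the value of `g` is at most
`C` times the limit superior of its averages over small balls. -/
lemma IsDoubling.ae_exists_ball (h : IsDoubling ν C) (hg : AEMeasurable g ν)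
    (hfin : ∀ x r, ∫⁻ y in ball x r, g y ∂ν ≠ ∞) :
    ∀ᵐ x ∂ν, ∀ t : ℝ≥0∞, C * t < g x → ∀ R > (0 : ℝ), ∃ δ, 0 < δ ∧ δ < R ∧
      t * ν (ball x δ) < ∫⁻ y in ball x δ, g y ∂ν := by
  rcases isEmpty_or_nonempty X with hX | ⟨⟨x₀⟩⟩
  · exact ae_of_all _ fun x => hX.elim x
  have key : ∀ n : ℕ, ∀ᵐ x ∂ν, ∀ t : ℝ≥0∞, C * t < (ball x₀ n).indicator g x → ∀ R > (0 : ℝ),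
      ∃ δ, 0 < δ ∧ δ < R ∧
        t * ν (ball x δ) < ∫⁻ y in ball x δ, (ball x₀ n).indicator g y ∂ν := fun n =>
    h.ae_exists_ball_of_lintegral_ne_top (hg.indicator measurableSet_ball)
      (by rw [lintegral_indicator measurableSet_ball]; exact hfin _ _)
  filter_upwards [ae_all_iff.2 key] with x hx t ht R hR
  obtain ⟨n, hn⟩ := exists_nat_gt (dist x x₀)
  obtain ⟨δ, h0, h1, h2⟩ := hx n t (by rwa [indicator_of_mem (mem_ball.2 hn)]) R hR
  refine ⟨δ, h0, h1, h2.trans_le ?_⟩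
  exact lintegral_mono fun y => indicator_le_self _ _ _

end Lebesgue

/-! ### Calderón–Zygmund stopping balls. -/

section Stopping

variable {X : Type*} [MetricSpace X] [MeasurableSpace X] [BorelSpace X]
  {ν : Measure X} {C : ℝ≥0} {g : X → ℝ≥0∞}

/-- The Calderón–Zygmund stopping balls of `g` at height `t` in the ball `ball x₀ r`. -/
lemma IsDoubling.exists_stopping_balls (h : IsDoubling ν C) (hg : AEMeasurable g ν)
    (hfin : ∀ x r, ∫⁻ y in ball x r, g y ∂ν ≠ ∞) {x₀ : X} {r : ℝ} (hr : 0 < r) {t : ℝ≥0∞}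
    (ht : C ^ 3 * ∫⁻ y in ball x₀ (2 * r), g y ∂ν ≤ t * ν (ball x₀ r)) :
    ∃ u : Set (X × ℝ), u.Countable ∧ u.PairwiseDisjoint (fun p => ball p.1 p.2) ∧
      (∀ p ∈ u, 0 < p.2 ∧ ball p.1 p.2 ⊆ ball x₀ (2 * r) ∧
        t * ν (ball p.1 p.2) < ∫⁻ y in ball p.1 p.2, g y ∂ν ∧
        ∫⁻ y in ball p.1 (4 * p.2), g y ∂ν ≤ t * ν (ball p.1 (4 * p.2))) ∧
      ∀ᵐ x ∂ν, x ∈ ball x₀ r → C * t < g x → x ∈ ⋃ p ∈ u, ball p.1 (4 * p.2) := by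
  have := h.secondCountable
  have hC0 : (C : ℝ≥0∞) ^ 3 ≠ 0 :=
    pow_ne_zero _ (zero_lt_one.trans_le (h.one_le x₀)).ne'
  have hCt : (C : ℝ≥0∞) ^ 3 ≠ ∞ := ENNReal.pow_ne_top ENNReal.coe_ne_top
  let T : Set (X × ℝ) := {p | p.1 ∈ ball x₀ r ∧ 0 < p.2 ∧ p.2 ≤ r ∧
    t * ν (ball p.1 p.2) < ∫⁻ y in ball p.1 p.2, g y ∂ν ∧
    ∫⁻ y in ball p.1 (4 * p.2), g y ∂ν ≤ t * ν (ball p.1 (4 * p.2))}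
  obtain ⟨u, huT, hdisj, hcov⟩ := Vitali.exists_disjoint_subfamily_covering_enlargement_ball
    T Prod.fst Prod.snd r (fun p hp => hp.2.2.1) 4 (by norm_num)
  refine ⟨u, ?_, hdisj, fun p hp => ?_, ?_⟩
  · exact hdisj.countable_of_isOpen (fun _ _ => isOpen_ball)
      fun p hp => nonempty_ball.2 (huT hp).2.1
  · obtain ⟨h1, h2, h3, h4, h5⟩ := huT hp
    refine ⟨h2, ball_subset_ball' ?_, h4, h5⟩
    rw [mem_ball] at h1
    linarith
  · filter_upwards [h.ae_exists_ball hg hfin] with x hx hxB hgx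
    obtain ⟨δ₀, hδ0, hδr, hδ⟩ := hx t hgx r hr
    let S : Set ℝ := {δ | 0 < δ ∧ δ ≤ r ∧ t * ν (ball x δ) < ∫⁻ y in ball x δ, g y ∂ν}
    have hS0 : δ₀ ∈ S := ⟨hδ0, hδr.le, hδ⟩
    have hSb : BddAbove S := ⟨r, fun δ hδ => hδ.2.1⟩
    -- The stopping radius is any element of S above half the supremum: its fourfold multiple
    -- exceeds the supremum, so the ball four times larger has mean at most t unless its radius is
    -- above r.
    have hsup : 0 < sSup S := hδ0.trans_le (le_csSup hSb hS0)
    obtain ⟨δ, hδS, hδ2⟩ := exists_lt_of_lt_csSup ⟨δ₀, hS0⟩ (show sSup S / 2 < sSup S by linarith)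
    -- A ball with centre in `ball x₀ r` and radius between r/4 and r has measure at least C⁻³ that
    -- of `ball x₀ r` and lies in the double ball, so `ht` forbids a mean above t there. Thus 4δ
    -- stays in the admissible range of radii.
    have hS4 : δ ≤ r / 4 := by
      by_contra hlt
      push Not at hlt
      refine absurd hδS.2.2 (not_lt.2 ?_)
      have hsub : ball x δ ⊆ ball x₀ (2 * r) := ball_subset_ball' (by
        rw [mem_ball] at hxB; linarith [hδS.2.1])
      have hm : ν (ball x₀ r) ≤ (C : ℝ≥0∞) ^ 3 * ν (ball x δ) := h.ball_le hδS.1 3 (by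
        rw [mem_ball, dist_comm] at hxB; linarith)
      rw [← ENNReal.mul_le_mul_iff_right hC0 hCt]
      calc _ ≤ C ^ 3 * ∫⁻ y in ball x₀ (2 * r), g y ∂ν := by gcongr
        _ ≤ t * ν (ball x₀ r) := ht
        _ ≤ t * ((C : ℝ≥0∞) ^ 3 * ν (ball x δ)) := by gcongr
        _ = _ := by ring
    have hpT : (x, δ) ∈ T := by
      refine ⟨hxB, hδS.1, hδS.2.1, hδS.2.2, ?_⟩
      by_contra hlt
      push Not at hlt
      have : 4 * δ ≤ sSup S := le_csSup hSb ⟨by linarith [hδS.1], by linarith, hlt⟩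
      linarith [hδS.1]
    obtain ⟨p, hpu, hp⟩ := hcov _ hpT
    exact mem_biUnion hpu (hp (mem_ball_self hδS.1))

/-- Integrals over the part of a ball where `g` is large are controlled by a sum over the stopping
balls. -/
lemma IsDoubling.exists_stopping_sum (h : IsDoubling ν C) (hg : AEMeasurable g ν)
    (hfin : ∀ x r, ∫⁻ y in ball x r, g y ∂ν ≠ ∞) {x₀ : X} {r : ℝ} (hr : 0 < r) {t : ℝ≥0∞}
    (ht : C ^ 3 * ∫⁻ y in ball x₀ (2 * r), g y ∂ν ≤ t * ν (ball x₀ r)) :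
    ∃ u : Set (X × ℝ), u.Countable ∧ u.PairwiseDisjoint (fun p => ball p.1 p.2) ∧
      (∀ p ∈ u, 0 < p.2 ∧ ball p.1 p.2 ⊆ ball x₀ (2 * r) ∧
        t * ν (ball p.1 p.2) < ∫⁻ y in ball p.1 p.2, g y ∂ν ∧
        ∫⁻ y in ball p.1 (4 * p.2), g y ∂ν ≤ t * ν (ball p.1 (4 * p.2))) ∧
      t * ∑' p : u, ν (ball p.1.1 (4 * p.1.2)) ≤ C ^ 2 * ∫⁻ y in ball x₀ (2 * r), g y ∂ν ∧
      ∀ F : X → ℝ≥0∞, ∫⁻ y in ball x₀ r ∩ {y | C * t < g y}, F y ∂ν ≤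
        ∑' p : u, ∫⁻ y in ball p.1.1 (4 * p.1.2), F y ∂ν := by
  obtain ⟨u, hu, hdisj, hprop, hcov⟩ := h.exists_stopping_balls hg hfin hr ht
  have : Countable u := hu
  refine ⟨u, hu, hdisj, hprop, ?_, fun F => ?_⟩
  · calc t * ∑' p : u, ν (ball p.1.1 (4 * p.1.2))
        ≤ t * ∑' p : u, (C : ℝ≥0∞) ^ 2 * ν (ball p.1.1 p.1.2) := by
          gcongr with p
          have := h.ball_two_pow p.1.1 (hprop p p.2).1 2
          norm_num at this ⊢
          exact this
      _ = C ^ 2 * ∑' p : u, t * ν (ball p.1.1 p.1.2) := by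
          rw [ENNReal.tsum_mul_left, ENNReal.tsum_mul_left]; ring
      _ ≤ C ^ 2 * ∑' p : u, ∫⁻ y in ball p.1.1 p.1.2, g y ∂ν := by
          gcongr with p
          exact (hprop p p.2).2.2.1.le
      _ = C ^ 2 * ∫⁻ y in ⋃ p : u, ball p.1.1 p.1.2, g y ∂ν := by
          rw [lintegral_iUnion (fun _ => measurableSet_ball)
            ((pairwise_subtype_iff_pairwise_set u _).2 hdisj)]
      _ ≤ _ := by
          gcongr
          exact iUnion_subset fun p => (hprop p p.2).2.1
  · calc ∫⁻ y in ball x₀ r ∩ {y | C * t < g y}, F y ∂ν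
        ≤ ∫⁻ y in ⋃ p : u, ball p.1.1 (4 * p.1.2), F y ∂ν := by
          refine lintegral_mono_set' ?_
          filter_upwards [hcov] with x hx hxm
          have := hx hxm.1 hxm.2
          rw [biUnion_eq_iUnion] at this
          exact this
      _ ≤ _ := lintegral_iUnion_le _ _

end Stopping

/-! ### Layer cake formulas. -/

section LayerCake

lemma lintegral_Ioo_rpow {s : ℝ} (hs : 0 < s) {A : ℝ} (hA : 0 ≤ A) :
    ∫⁻ τ in Ioo 0 A, ENNReal.ofReal (s * τ ^ (s - 1)) = ENNReal.ofReal A ^ s := by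
  have hint : IntervalIntegrable (fun τ : ℝ => s * τ ^ (s - 1)) volume 0 A :=
    (intervalIntegral.intervalIntegrable_rpow' (by linarith)).const_mul s
  rw [intervalIntegrable_iff_integrableOn_Ioo_of_le hA] at hint
  rw [← ofReal_integral_eq_lintegral_ofReal hint, ← integral_Ioc_eq_integral_Ioo,
    ← intervalIntegral.integral_of_le hA, intervalIntegral.integral_const_mul,
    integral_rpow (Or.inl (by linarith)), ENNReal.ofReal_rpow_of_nonneg hA hs.le]
  · congr 1
    rw [sub_add_cancel, Real.zero_rpow hs.ne', sub_zero]
    field_simp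
  · filter_upwards [self_mem_ae_restrict measurableSet_Ioo] with τ hτ
    have := hτ.1
    exact mul_nonneg hs.le (Real.rpow_nonneg this.le _)

lemma ennreal_rpow_eq_lintegral {s : ℝ} (hs : 0 < s) (a : ℝ≥0∞) :
    a ^ s = ∫⁻ τ in Ioi (0 : ℝ), ENNReal.ofReal (s * τ ^ (s - 1)) *
      {τ : ℝ | ENNReal.ofReal τ < a}.indicator 1 τ := by
  have key : ∀ A : ℝ, 0 ≤ A → ENNReal.ofReal A ^ s =
      ∫⁻ τ in Ioi (0 : ℝ), ENNReal.ofReal (s * τ ^ (s - 1)) *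
      {τ : ℝ | ENNReal.ofReal τ < ENNReal.ofReal A}.indicator 1 τ := by
    intro A hA
    rw [← lintegral_Ioo_rpow hs hA, ← Ioi_inter_Iio, inter_comm, ← Measure.restrict_restrict
      measurableSet_Iio, ← lintegral_indicator measurableSet_Iio]
    refine setLIntegral_congr_fun measurableSet_Ioi fun τ (hτ : 0 < τ) => ?_
    by_cases h : τ < A
    · have : ENNReal.ofReal τ < ENNReal.ofReal A :=
        (ENNReal.ofReal_lt_ofReal_iff (hτ.trans h)).2 h
      simp [indicator, h, this]
    · have : ¬ ENNReal.ofReal τ < ENNReal.ofReal A :=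
        not_lt.2 (ENNReal.ofReal_le_ofReal (not_lt.1 h))
      simp [indicator, h, this]
  rcases eq_or_ne a ∞ with rfl | ha
  · rw [ENNReal.top_rpow_of_pos hs]
    symm
    -- At a = ∞ the integral dominates the one for a = r^(1/s), whose value is r, for every finite
    -- r.
    refine ENNReal.eq_top_of_forall_nnreal_le fun r => ?_
    have h1 := key ((r : ℝ) ^ (1 / s)) (by positivity)
    rw [ENNReal.ofReal_rpow_of_nonneg (by positivity) hs.le, ← Real.rpow_mul (by positivity),
      one_div_mul_cancel hs.ne', Real.rpow_one, ENNReal.ofReal_coe_nnreal] at h1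
    rw [h1]
    refine lintegral_mono fun τ => ?_
    gcongr
    exact le_top
  · have := key a.toReal ENNReal.toReal_nonneg
    rwa [ENNReal.ofReal_toReal ha] at this

variable {X : Type*} [MeasurableSpace X]

/-- A weighted layer cake formula for functions with values in `[0,∞]`. -/
lemma lintegral_mul_rpow_eq_lintegral_level (ν : Measure X) [SFinite ν] {G H : X → ℝ≥0∞}
    (hG : Measurable G) (hH : AEMeasurable H ν) {s : ℝ} (hs : 0 < s) :
    ∫⁻ x, H x * G x ^ s ∂ν = ∫⁻ τ in Ioi (0 : ℝ), ENNReal.ofReal (s * τ ^ (s - 1)) *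
      ∫⁻ x in {x | ENNReal.ofReal τ < G x}, H x ∂ν := by
  wlog hHm : Measurable H generalizing H
  · have h1 : ∫⁻ x, H x * G x ^ s ∂ν = ∫⁻ x, hH.mk H x * G x ^ s ∂ν :=
      lintegral_congr_ae (by filter_upwards [hH.ae_eq_mk] with x hx; rw [hx])
    rw [h1, this hH.measurable_mk.aemeasurable hH.measurable_mk]
    refine lintegral_congr fun τ => ?_
    congr 1
    exact lintegral_congr_ae (ae_restrict_of_ae hH.ae_eq_mk.symm)
  have hset : MeasurableSet {p : X × ℝ | ENNReal.ofReal p.2 < G p.1} :=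
    measurableSet_lt (ENNReal.measurable_ofReal.comp measurable_snd) (hG.comp measurable_fst)
  have hm : Measurable (fun p : X × ℝ => H p.1 * (ENNReal.ofReal (s * p.2 ^ (s - 1)) *
      {p : X × ℝ | ENNReal.ofReal p.2 < G p.1}.indicator 1 p)) := by
    refine (hHm.comp measurable_fst).mul (Measurable.mul ?_ (measurable_one.indicator hset))
    exact ENNReal.measurable_ofReal.comp ((measurable_snd.pow_const _).const_mul _)
  calc ∫⁻ x, H x * G x ^ s ∂ν
      = ∫⁻ x, (∫⁻ τ in Ioi (0 : ℝ), H x * (ENNReal.ofReal (s * τ ^ (s - 1)) *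
          {p : X × ℝ | ENNReal.ofReal p.2 < G p.1}.indicator 1 (x, τ))) ∂ν := by
        refine lintegral_congr fun x => ?_
        rw [ennreal_rpow_eq_lintegral hs, ← lintegral_const_mul]
        · rfl
        · refine Measurable.mul (ENNReal.measurable_ofReal.comp
            ((measurable_id.pow_const _).const_mul _)) (measurable_one.indicator ?_)
          exact measurableSet_lt ENNReal.measurable_ofReal measurable_const
    _ = ∫⁻ τ in Ioi (0 : ℝ), (∫⁻ x, H x * (ENNReal.ofReal (s * τ ^ (s - 1)) *
          {p : X × ℝ | ENNReal.ofReal p.2 < G p.1}.indicator 1 (x, τ)) ∂ν) :=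
        lintegral_lintegral_swap hm.aemeasurable
    _ = _ := by
        refine lintegral_congr fun τ => ?_
        rw [← lintegral_indicator (measurableSet_lt measurable_const hG), ← lintegral_const_mul]
        · refine lintegral_congr fun x => ?_
          by_cases hx : ENNReal.ofReal τ < G x
          · simp [indicator, hx, mul_comm]
          · simp [indicator, hx]
        · exact hHm.indicator (measurableSet_lt measurable_const hG)

end LayerCake

/-! ### Weak and strong type bounds for the uncentred maximal function. -/

section Maximal

variable {X : Type*} [MetricSpace X] [MeasurableSpace X]

/-- The uncentred maximal function `sup_{B ∋ x} ν(B)^{-e} ∫_B F dν` over metric balls. -/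
noncomputable def ballMax (ν : Measure X) (e : ℝ) (F : X → ℝ≥0∞) (x : X) : ℝ≥0∞ :=
  ⨆ (p : X × ℝ) (_ : x ∈ ball p.1 p.2), (∫⁻ y in ball p.1 p.2, F y ∂ν) / ν (ball p.1 p.2) ^ e

lemma le_ballMax (ν : Measure X) (e : ℝ) (F : X → ℝ≥0∞) {x c : X} {r : ℝ} (hx : x ∈ ball c r) :
    (∫⁻ y in ball c r, F y ∂ν) / ν (ball c r) ^ e ≤ ballMax ν e F x :=
  le_iSup₂ (f := fun (p : X × ℝ) (_ : x ∈ ball p.1 p.2) =>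
    (∫⁻ y in ball p.1 p.2, F y ∂ν) / ν (ball p.1 p.2) ^ e) (c, r) hx

lemma ballMax_le (ν : Measure X) (e : ℝ) (F : X → ℝ≥0∞) {x : X} {t : ℝ≥0∞}
    (h : ∀ c r, x ∈ ball c r → (∫⁻ y in ball c r, F y ∂ν) / ν (ball c r) ^ e ≤ t) :
    ballMax ν e F x ≤ t :=
  iSup₂_le fun p hp => h p.1 p.2 hp

lemma lt_ballMax_iff (ν : Measure X) (e : ℝ) (F : X → ℝ≥0∞) {x : X} {t : ℝ≥0∞} :
    t < ballMax ν e F x ↔ ∃ p : X × ℝ, x ∈ ball p.1 p.2 ∧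
      t < (∫⁻ y in ball p.1 p.2, F y ∂ν) / ν (ball p.1 p.2) ^ e := by
  simp [ballMax, lt_iSup_iff]

lemma measurable_ballMax [OpensMeasurableSpace X] (ν : Measure X) (e : ℝ) (F : X → ℝ≥0∞) :
    Measurable (ballMax ν e F) := by
  refine measurable_of_Ioi fun t => IsOpen.measurableSet ?_
  have : ballMax ν e F ⁻¹' Ioi t = ⋃ (p : X × ℝ) (_ : t < (∫⁻ y in ball p.1 p.2, F y ∂ν) /
      ν (ball p.1 p.2) ^ e), ball p.1 p.2 := by
    ext x
    rw [mem_preimage, mem_Ioi, lt_ballMax_iff]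
    simp only [mem_iUnion, exists_prop, and_comm]
  rw [this]
  exact isOpen_iUnion fun p => isOpen_iUnion fun _ => isOpen_ball

lemma ballMax_mono (ν : Measure X) (e : ℝ) {F G : X → ℝ≥0∞} (h : F ≤ᵐ[ν] G) (x : X) :
    ballMax ν e F x ≤ ballMax ν e G x := by
  refine ballMax_le _ _ _ fun c r hx => le_trans ?_ (le_ballMax ν e G hx)
  gcongr 1
  exact lintegral_mono_ae (ae_restrict_of_ae h)

lemma ballMax_congr (ν : Measure X) (e : ℝ) {F G : X → ℝ≥0∞} (h : F =ᵐ[ν] G) :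
    ballMax ν e F = ballMax ν e G :=
  funext fun x => le_antisymm (ballMax_mono ν e h.le x) (ballMax_mono ν e h.symm.le x)

variable [BorelSpace X] {ν : Measure X} {C : ℝ≥0}

/-- The weak type `(1,1)` estimate for the maximal function. -/
lemma IsDoubling.weak_type (h : IsDoubling ν C) (g : X → ℝ≥0∞) (t : ℝ≥0∞) :
    t * ν {x | t < ballMax ν 1 g x} ≤ C ^ 2 * ∫⁻ x, g x ∂ν := by
  have := h.secondCountable
  -- The Vitali covering lemma needs bounded radii. The bound n is removed at the end by monotone
  -- convergence of the sets E n.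
  let T : ℕ → Set (X × ℝ) := fun n => {p | 0 < p.2 ∧ p.2 ≤ n ∧
    t * ν (ball p.1 p.2) < ∫⁻ y in ball p.1 p.2, g y ∂ν}
  let E : ℕ → Set X := fun n => ⋃ p ∈ T n, ball p.1 p.2
  have hE : {x | t < ballMax ν 1 g x} ⊆ ⋃ n, E n := by
    intro x hx
    obtain ⟨p, hp, hlt⟩ := (lt_ballMax_iff _ _ _).1 hx
    obtain ⟨n, hn⟩ := exists_nat_ge p.2
    rw [ENNReal.rpow_one] at hlt
    exact mem_iUnion.2 ⟨n, mem_biUnion (show p ∈ T n from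
      ⟨pos_of_mem_ball hp, hn, ENNReal.mul_lt_of_lt_div hlt⟩) hp⟩
  have hmono : Monotone E := fun m n hmn => biUnion_subset_biUnion_left fun p hp =>
    ⟨hp.1, hp.2.1.trans (by exact_mod_cast hmn), hp.2.2⟩
  have hn : ∀ n, t * ν (E n) ≤ C ^ 2 * ∫⁻ x, g x ∂ν := by
    intro n
    obtain ⟨u, huT, hdisj, hcov⟩ := Vitali.exists_disjoint_subfamily_covering_enlargement_ball
      (T n) Prod.fst Prod.snd n (fun p hp => hp.2.1) 4 (by norm_num)
    have hu : u.Countable := hdisj.countable_of_isOpen (fun _ _ => isOpen_ball)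
      fun p hp => nonempty_ball.2 (huT hp).1
    have : Countable u := hu
    calc t * ν (E n) ≤ t * ν (⋃ p : u, ball p.1.1 (4 * p.1.2)) := by
          gcongr
          refine iUnion₂_subset fun p hp => ?_
          obtain ⟨q, hq, hpq⟩ := hcov p hp
          exact hpq.trans (subset_iUnion (fun p : u => ball p.1.1 (4 * p.1.2)) ⟨q, hq⟩)
      _ ≤ t * ∑' p : u, ν (ball p.1.1 (4 * p.1.2)) := by gcongr; exact measure_iUnion_le _
      _ ≤ t * ∑' p : u, (C : ℝ≥0∞) ^ 2 * ν (ball p.1.1 p.1.2) := by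
          gcongr with p
          have := h.ball_two_pow p.1.1 (huT p.2).1 2
          norm_num at this ⊢
          exact this
      _ = C ^ 2 * ∑' p : u, t * ν (ball p.1.1 p.1.2) := by
          rw [ENNReal.tsum_mul_left, ENNReal.tsum_mul_left]; ring
      _ ≤ C ^ 2 * ∑' p : u, ∫⁻ y in ball p.1.1 p.1.2, g y ∂ν := by
          gcongr with p
          exact (huT p.2).2.2.le
      _ = C ^ 2 * ∫⁻ y in ⋃ p : u, ball p.1.1 p.1.2, g y ∂ν := by
          rw [lintegral_iUnion (fun _ => measurableSet_ball)
            ((pairwise_subtype_iff_pairwise_set u _).2 hdisj)]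
      _ ≤ _ := by
          gcongr
          exact Measure.restrict_le_self
  calc t * ν {x | t < ballMax ν 1 g x} ≤ t * ν (⋃ n, E n) := by gcongr
    _ = ⨆ n, t * ν (E n) := by rw [hmono.measure_iUnion, ENNReal.mul_iSup]
    _ ≤ _ := iSup_le hn

/-- The part of g not exceeding t contributes at most t to any mean. A mean above 2t therefore
forces the part of g above t to have mean above t, and the weak type bound applies to that part. -/
lemma IsDoubling.weak_type_truncated (h : IsDoubling ν C) {g : X → ℝ≥0∞} (hg : Measurable g)
    (t : ℝ≥0∞) :
    t * ν {x | t < ballMax ν 1 g x / 2} ≤ C ^ 2 * ∫⁻ x in {x | t < g x}, g x ∂ν := by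
  rw [← lintegral_indicator (measurableSet_lt measurable_const hg)]
  refine le_trans ?_ (h.weak_type _ t)
  refine mul_le_mul_right (measure_mono fun x hx => ?_) t
  have hx2 : t * 2 < ballMax ν 1 g x := ENNReal.mul_lt_of_lt_div hx
  obtain ⟨p, hp, hlt⟩ := (lt_ballMax_iff _ _ _).1 hx2
  refine lt_of_lt_of_le ?_ (le_ballMax _ _ _ hp)
  have hB := h.ne_zero (x := p.1) (pos_of_mem_ball hp)
  rw [ENNReal.rpow_one] at hlt ⊢
  have hle : (∫⁻ y in ball p.1 p.2, g y ∂ν) / ν (ball p.1 p.2) ≤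
      (∫⁻ y in ball p.1 p.2, {x | t < g x}.indicator g y ∂ν) / ν (ball p.1 p.2) + t := by
    refine ENNReal.div_le_of_le_mul ?_
    rw [add_mul, ENNReal.div_mul_cancel hB h.ne_top, ← setLIntegral_const, ← lintegral_add_right]
    · refine lintegral_mono fun y => ?_
      by_cases hy : t < g y
      · simp [indicator, hy]
      · exact (not_lt.1 hy).trans le_add_self
    · exact measurable_const
  have h3 := hlt.trans_le hle
  rw [mul_two] at h3
  exact lt_of_add_lt_add_right h3

/-- The strong type `(s,s)` estimate for the maximal function, `s > 1`. -/
lemma IsDoubling.strong_type (h : IsDoubling ν C) {s : ℝ} (hs : 1 < s) :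
    ∃ K : ℝ≥0∞, K ≠ ∞ ∧ ∀ g : X → ℝ≥0∞, AEMeasurable g ν →
      ∫⁻ x, ballMax ν 1 g x ^ s ∂ν ≤ K * ∫⁻ x, g x ^ s ∂ν := by
  have := h.sigmaFinite
  refine ⟨2 ^ s * (ENNReal.ofReal (s / (s - 1)) * C ^ 2), ?_, ?_⟩
  · refine ENNReal.mul_ne_top (ENNReal.rpow_ne_top_of_nonneg (by linarith) (by simp))
      (ENNReal.mul_ne_top ENNReal.ofReal_ne_top (ENNReal.pow_ne_top ENNReal.coe_ne_top))
  intro g hg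
  wlog hgm : Measurable g generalizing g
  · have := this _ hg.measurable_mk.aemeasurable hg.measurable_mk
    rw [← ballMax_congr ν 1 hg.ae_eq_mk] at this
    refine this.trans_eq ?_
    congr 1
    exact lintegral_congr_ae (by filter_upwards [hg.ae_eq_mk] with x hx; rw [hx])
  have hs0 : 0 < s := by linarith
  have hGm : Measurable fun x => ballMax ν 1 g x / 2 := (measurable_ballMax _ _ _).div_const _
  have step : ∫⁻ x, (ballMax ν 1 g x / 2) ^ s ∂ν ≤
      ENNReal.ofReal (s / (s - 1)) * C ^ 2 * ∫⁻ x, g x ^ s ∂ν := by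
    have e1 := lintegral_mul_rpow_eq_lintegral_level ν hGm (H := fun _ => 1)
      aemeasurable_const hs0
    have e2 := lintegral_mul_rpow_eq_lintegral_level ν hgm (H := g) hg
      (show 0 < s - 1 by linarith)
    simp only [one_mul, lintegral_one, Measure.restrict_apply_univ] at e1
    have e3 : ∀ x, g x * g x ^ (s - 1) = g x ^ s := fun x => by
      rcases eq_or_ne (g x) 0 with h0 | h0
      · rw [h0, zero_mul, ENNReal.zero_rpow_of_pos hs0]
      rcases eq_or_ne (g x) ∞ with h1 | h1
      · rw [h1, ENNReal.top_rpow_of_pos hs0, ENNReal.top_rpow_of_pos (by linarith)]; simp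
      · conv_lhs => rw [← ENNReal.rpow_one (g x), ← ENNReal.rpow_mul, one_mul,
          ← ENNReal.rpow_add _ _ h0 h1]
        congr 1; ring
    simp only [e3] at e2
    rw [e1, e2, ← lintegral_const_mul' _ _ (ENNReal.mul_ne_top ENNReal.ofReal_ne_top
      (ENNReal.pow_ne_top ENNReal.coe_ne_top))]
    refine setLIntegral_mono' measurableSet_Ioi fun τ (hτ : 0 < τ) => ?_
    have w := h.weak_type_truncated hgm (ENNReal.ofReal τ)
    -- The weak type bound supplies a factor 1/τ, which turns the kernel of the s-th moment into
    -- that of the (s-1)-st moment taken against g; the ratio of kernels is s/(s-1).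
    have hk : ENNReal.ofReal (s * τ ^ (s - 1)) = ENNReal.ofReal (s / (s - 1)) *
        ENNReal.ofReal ((s - 1) * τ ^ (s - 1 - 1)) * ENNReal.ofReal τ := by
      have h1 : 0 < s - 1 := by linarith
      rw [← ENNReal.ofReal_mul (by positivity), ← ENNReal.ofReal_mul (by positivity)]
      congr 1
      rw [Real.rpow_sub_one hτ.ne' (s - 1)]
      field_simp
    calc _ = ENNReal.ofReal (s / (s - 1)) * ENNReal.ofReal ((s - 1) * τ ^ (s - 1 - 1)) *
          (ENNReal.ofReal τ * ν {x | ENNReal.ofReal τ < ballMax ν 1 g x / 2}) := by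
          rw [hk]; ring
      _ ≤ ENNReal.ofReal (s / (s - 1)) * ENNReal.ofReal ((s - 1) * τ ^ (s - 1 - 1)) *
          (C ^ 2 * ∫⁻ x in {x | ENNReal.ofReal τ < g x}, g x ∂ν) := by gcongr
      _ = _ := by ring
  calc ∫⁻ x, ballMax ν 1 g x ^ s ∂ν = ∫⁻ x, 2 ^ s * (ballMax ν 1 g x / 2) ^ s ∂ν := by
        refine lintegral_congr fun x => ?_
        rw [← ENNReal.mul_rpow_of_nonneg _ _ hs0.le, ENNReal.mul_div_cancel (by simp) (by simp)]
    _ = 2 ^ s * ∫⁻ x, (ballMax ν 1 g x / 2) ^ s ∂ν := lintegral_const_mul _ (hGm.pow_const _)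
    _ ≤ 2 ^ s * (ENNReal.ofReal (s / (s - 1)) * C ^ 2 * ∫⁻ x, g x ^ s ∂ν) := by gcongr
    _ = _ := by ring

end Maximal

/-- Absorption: the supremum is finite by the a priori bound M, so half of it may be subtracted. M
does not appear in the conclusion, which is what later allows truncation levels to be sent to
infinity. -/
lemma le_two_mul_of_forall_bound {ι : Type*} {f : ι → ℝ≥0∞} {K M : ℝ≥0∞} (hM : M ≠ ∞)
    (h0 : ∀ i, f i ≤ M) (step : ∀ Φ : ℝ≥0∞, (∀ i, f i ≤ Φ) → ∀ i, f i ≤ K + Φ / 2) (i : ι) :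
    f i ≤ 2 * K := by
  have h1 := iSup_le (step (⨆ i, f i) (le_iSup f))
  have hfin : (⨆ i, f i) ≠ ∞ := ne_top_of_le_ne_top hM (iSup_le h0)
  nth_rewrite 1 [← ENNReal.add_halves (⨆ i, f i)] at h1
  have h2 : (⨆ i, f i) / 2 ≤ K :=
    (ENNReal.add_le_add_iff_right (ENNReal.div_ne_top hfin (by simp))).1 h1
  calc f i ≤ ⨆ i, f i := le_iSup f i
    _ = 2 * ((⨆ i, f i) / 2) := (ENNReal.mul_div_cancel (by simp) (by simp)).symm
    _ ≤ 2 * K := by gcongr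

lemma enorm_sub_mul_measure_le {X : Type*} [MeasurableSpace X] {μ : Measure X} {φ : X → ℝ}
    (hφ : AEMeasurable φ μ) {S : Set X} {a b : ℝ} :
    ‖a - b‖ₑ * μ S ≤ ∫⁻ y in S, ‖φ y - a‖ₑ ∂μ + ∫⁻ y in S, ‖φ y - b‖ₑ ∂μ := by
  rw [← setLIntegral_const, ← lintegral_add_left' (hφ.sub_const a).enorm.restrict]
  refine lintegral_mono fun y => ?_
  calc ‖a - b‖ₑ = ‖(φ y - b) - (φ y - a)‖ₑ := by congr 1; ring
    _ ≤ ‖φ y - b‖ₑ + ‖φ y - a‖ₑ := enorm_sub_le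
    _ = _ := add_comm _ _

/-! ### The John–Nirenberg inequality. -/

section JohnNirenberg

variable {X : Type*} [MetricSpace X] [MeasurableSpace X] [BorelSpace X]
  {μ : Measure X} {C : ℝ≥0} {φ : X → ℝ} {m : X → ℝ → ℝ} {K : ℝ≥0}

/-- The John–Nirenberg inequality for functions of bounded mean oscillation with respect to a
doubling measure. -/
lemma IsDoubling.john_nirenberg (h : IsDoubling μ C) (hφ : AEMeasurable φ μ)
    (hm : ∀ x r, 0 < r → ∫⁻ y in ball x r, ‖φ y - m x r‖ₑ ∂μ ≤ K * μ (ball x r)) :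
    ∃ ε : ℝ, 0 < ε ∧ ∀ x r, 0 < r →
      ∫⁻ y in ball x r, ENNReal.ofReal (Real.exp (ε * |φ y - m x r|)) ∂μ ≤ 4 * μ (ball x r) := by
  rcases isEmpty_or_nonempty X with hX | ⟨⟨x₁⟩⟩
  · exact ⟨1, one_pos, fun x => hX.elim x⟩
  have hC1 : 1 ≤ C := by exact_mod_cast h.one_le x₁
  -- K₁ bounds the oscillation over the double ball about the centre value of the ball. The height t
  -- makes the stopping construction admissible (C³K₁ ≤ t) and makes the fourfold stopping balls
  -- occupy at most a quarter of the ball (C²K₁ ≤ t/4). The exponent ε makes e^(εCt) and e^(ε(K+t))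
  -- at most 2.
  set K₁ : ℝ≥0 := (K + 2 * K * C) * C with hK₁
  set t : ℝ≥0 := 4 * C ^ 3 * (K₁ + 1) with ht
  have htpos : 0 < t := by positivity
  set ε : ℝ := Real.log 2 / (C * t + K + t) with hε
  have hεpos : 0 < ε := by
    have := Real.log_pos one_lt_two
    positivity
  have hlog : ε * (C * t + K + t) = Real.log 2 := by
    rw [hε]; field_simp
  refine ⟨ε, hεpos, ?_⟩
  have hmdist : ∀ x r, 0 < r → ‖m x (2 * r) - m x r‖ₑ ≤ 2 * K * C := by
    intro x r hr
    have h1 := enorm_sub_mul_measure_le hφ (S := ball x r) (a := m x (2 * r))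
      (b := m x r)
    have h2 : ∫⁻ y in ball x r, ‖φ y - m x (2 * r)‖ₑ ∂μ ≤ K * (C * μ (ball x r)) :=
      (lintegral_mono_set (ball_subset_ball (by linarith))).trans
        ((hm x (2 * r) (by linarith)).trans (by gcongr; exact h.doubling x r hr))
    have h3 : ‖m x (2 * r) - m x r‖ₑ * μ (ball x r) ≤ 2 * K * C * μ (ball x r) := by
      calc _ ≤ K * (C * μ (ball x r)) + K * (1 * μ (ball x r)) := by
            rw [one_mul]; exact h1.trans (add_le_add h2 (hm x r hr))
        _ ≤ K * (C * μ (ball x r)) + K * (C * μ (ball x r)) := by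
            gcongr; exact h.one_le x₁
        _ = _ := by ring
    exact (ENNReal.mul_le_mul_iff_left (h.ne_zero hr) h.ne_top).1 h3
  have hosc : ∀ x r, 0 < r → ∫⁻ y in ball x (2 * r), ‖φ y - m x r‖ₑ ∂μ ≤ K₁ * μ (ball x r) := by
    intro x r hr
    calc ∫⁻ y in ball x (2 * r), ‖φ y - m x r‖ₑ ∂μ
        ≤ ∫⁻ y in ball x (2 * r), (‖φ y - m x (2 * r)‖ₑ + ‖m x (2 * r) - m x r‖ₑ) ∂μ := by
          refine lintegral_mono fun y => ?_
          rw [show φ y - m x r = (φ y - m x (2 * r)) + (m x (2 * r) - m x r) by ring]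
          exact enorm_add_le _ _
      _ = ∫⁻ y in ball x (2 * r), ‖φ y - m x (2 * r)‖ₑ ∂μ +
            ‖m x (2 * r) - m x r‖ₑ * μ (ball x (2 * r)) := by
          rw [lintegral_add_right _ measurable_const, setLIntegral_const]
      _ ≤ K * μ (ball x (2 * r)) + 2 * K * C * μ (ball x (2 * r)) := by
          gcongr
          · exact hm x _ (by linarith)
          · exact hmdist x r hr
      _ = (K + 2 * K * C) * μ (ball x (2 * r)) := by ring
      _ ≤ (K + 2 * K * C) * (C * μ (ball x r)) := by gcongr; exact h.doubling x r hr
      _ = _ := by rw [hK₁]; push_cast; ring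
  have hosc_fin : ∀ c x r, ∫⁻ y in ball x r, ‖φ y - c‖ₑ ∂μ ≠ ∞ := by
    intro c x r
    rcases le_or_gt r 0 with hr | hr
    · simp [ball_eq_empty.2 hr]
    refine ne_top_of_le_ne_top (b := K * μ (ball x r) + ‖m x r - c‖ₑ * μ (ball x r)) ?_ ?_
    · exact ENNReal.add_ne_top.2 ⟨ENNReal.mul_ne_top ENNReal.coe_ne_top h.ne_top,
        ENNReal.mul_ne_top enorm_ne_top h.ne_top⟩
    · calc ∫⁻ y in ball x r, ‖φ y - c‖ₑ ∂μ
          ≤ ∫⁻ y in ball x r, (‖φ y - m x r‖ₑ + ‖m x r - c‖ₑ) ∂μ := by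
            refine lintegral_mono fun y => ?_
            rw [show φ y - c = (φ y - m x r) + (m x r - c) by ring]
            exact enorm_add_le _ _
        _ = ∫⁻ y in ball x r, ‖φ y - m x r‖ₑ ∂μ + ‖m x r - c‖ₑ * μ (ball x r) := by
            rw [lintegral_add_right _ measurable_const, setLIntegral_const]
        _ ≤ _ := by gcongr; exact hm x r hr
  -- With Φ a bound for the truncated exponential means over all balls, the set where the
  -- oscillation is at most Ct contributes at most 2 and the stopping balls at most 2 · Φ · 1/4.
  -- Truncation at N is there only to make the supremum finite before absorbing.
  have htrunc : ∀ N : ℕ, ∀ p : {p : X × ℝ // 0 < p.2},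
      (∫⁻ y in ball p.1.1 p.1.2,
        ENNReal.ofReal (Real.exp (ε * min |φ y - m p.1.1 p.1.2| N)) ∂μ) /
        μ (ball p.1.1 p.1.2) ≤ 2 * 2 := by
    intro N
    refine le_two_mul_of_forall_bound (M := ENNReal.ofReal (Real.exp (ε * N)))
      ENNReal.ofReal_ne_top ?_ ?_
    · rintro ⟨⟨x, r⟩, hr⟩
      refine ENNReal.div_le_of_le_mul ?_
      rw [← setLIntegral_const]
      refine lintegral_mono fun y => ENNReal.ofReal_le_ofReal (Real.exp_le_exp.2 ?_)
      gcongr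
      exact min_le_right _ _
    · rintro Φ hΦ ⟨⟨x, r⟩, hr⟩
      simp only at hr ⊢
      refine ENNReal.div_le_of_le_mul ?_
      have hg : AEMeasurable (fun y => ‖φ y - m x r‖ₑ) μ := (hφ.sub_const _).enorm
      have hcond : (C : ℝ≥0∞) ^ 3 * ∫⁻ y in ball x (2 * r), ‖φ y - m x r‖ₑ ∂μ ≤
          t * μ (ball x r) := by
        calc _ ≤ (C : ℝ≥0∞) ^ 3 * (K₁ * μ (ball x r)) := by gcongr; exact hosc x r hr
          _ = ((C ^ 3 * K₁ : ℝ≥0) : ℝ≥0∞) * μ (ball x r) := by push_cast; ring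
          _ ≤ _ := by
            gcongr
            rw [ht]
            calc C ^ 3 * K₁ ≤ C ^ 3 * (4 * (K₁ + 1)) := by
                  gcongr
                  calc K₁ ≤ 1 * (K₁ + 1) := by simp
                    _ ≤ _ := by gcongr; norm_num
              _ = _ := by ring
      obtain ⟨u, hu, hdisj, hprop, hsum, hint⟩ :=
        h.exists_stopping_sum hg (hosc_fin _) hr hcond
      set F : X → ℝ≥0∞ := fun y => ENNReal.ofReal (Real.exp (ε * min |φ y - m x r| N)) with hF
      have hS : t * ∑' p : u, μ (ball p.1.1 (4 * p.1.2)) ≤ (t / 4 : ℝ≥0) * μ (ball x r) := by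
        calc _ ≤ (C : ℝ≥0∞) ^ 2 * (K₁ * μ (ball x r)) :=
              hsum.trans (by gcongr; exact hosc x r hr)
          _ = ((C ^ 2 * K₁ : ℝ≥0) : ℝ≥0∞) * μ (ball x r) := by push_cast; ring
          _ ≤ _ := by
            gcongr
            rw [ht, show 4 * C ^ 3 * (K₁ + 1) / 4 = C ^ 3 * (K₁ + 1) by
              rw [mul_assoc, mul_comm, mul_div_assoc, div_self (by norm_num), mul_one]]
            exact mul_le_mul' (pow_le_pow_right₀ hC1 (by norm_num)) (by simp)
      have hS' : ∑' p : u, μ (ball p.1.1 (4 * p.1.2)) ≤ (1 / 4) * μ (ball x r) := by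
        rw [← ENNReal.mul_le_mul_iff_right (a := t) (by exact_mod_cast htpos.ne')
          ENNReal.coe_ne_top]
        refine hS.trans_eq ?_
        rw [ENNReal.coe_div (by norm_num), ENNReal.div_eq_inv_mul, one_div]
        push_cast
        ring
      have hlow : ∫⁻ y in ball x r ∩ {y | C * t < ‖φ y - m x r‖ₑ}ᶜ, F y ∂μ ≤
          2 * μ (ball x r) := by
        calc _ ≤ ∫⁻ y in ball x r ∩ {y | C * t < ‖φ y - m x r‖ₑ}ᶜ, 2 ∂μ := by
              refine lintegral_mono_ae ?_
              have hnm : NullMeasurableSet (ball x r ∩ {y | C * t < ‖φ y - m x r‖ₑ}ᶜ) μ :=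
                measurableSet_ball.nullMeasurableSet.inter
                  (nullMeasurableSet_lt aemeasurable_const hg).compl
              filter_upwards [ae_restrict_mem₀ hnm] with y hy
              have h1 : ‖φ y - m x r‖ₑ ≤ ((C * t : ℝ≥0) : ℝ≥0∞) := by
                have := hy.2
                simp only [mem_compl_iff, mem_ofPred_eq, not_lt] at this
                exact_mod_cast this
              have h2 : |φ y - m x r| ≤ C * t := by
                rw [enorm_le_coe] at h1
                exact_mod_cast h1
              rw [hF, ← ENNReal.ofReal_ofNat 2]
              refine ENNReal.ofReal_le_ofReal ?_
              rw [← Real.exp_log (show (0 : ℝ) < 2 by norm_num), ← hlog]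
              gcongr
              refine (min_le_left _ _).trans (h2.trans ?_)
              have : (0 : ℝ) ≤ K + t := by positivity
              linarith
          _ ≤ 2 * μ (ball x r) := by
              rw [setLIntegral_const]; gcongr; exact inter_subset_left
      have hhigh : ∫⁻ y in ball x r ∩ {y | C * t < ‖φ y - m x r‖ₑ}, F y ∂μ ≤
          Φ / 2 * μ (ball x r) := by
        calc _ ≤ ∑' p : u, ∫⁻ y in ball p.1.1 (4 * p.1.2), F y ∂μ := hint F
          _ ≤ ∑' p : u, 2 * (Φ * μ (ball p.1.1 (4 * p.1.2))) := by
              refine ENNReal.tsum_le_tsum fun p => ?_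
              have hp0 : 0 < 4 * p.1.2 := by linarith [(hprop p p.2).1]
              have hΦp := hΦ ⟨⟨p.1.1, 4 * p.1.2⟩, hp0⟩
              simp only at hΦp
              rw [ENNReal.div_le_iff (h.ne_zero hp0) h.ne_top] at hΦp
              refine le_trans ?_ (mul_le_mul_right hΦp 2)
              rw [← lintegral_const_mul' _ _ (by simp)]
              refine lintegral_mono fun y => ?_
              -- The stopping condition bounds by t the mean of |φ - m x r| over the fourfold ball.
              -- The centre value therefore moves by at most K + t, which costs a factor 2 after
              -- exponentiation.
              have hd : |m p.1.1 (4 * p.1.2) - m x r| ≤ K + t := by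
                have h1 := enorm_sub_mul_measure_le hφ
                  (S := ball p.1.1 (4 * p.1.2)) (a := m p.1.1 (4 * p.1.2)) (b := m x r)
                have h2 := h1.trans (add_le_add (hm _ _ hp0) (hprop p p.2).2.2.2)
                rw [← add_mul] at h2
                have h3 := (ENNReal.mul_le_mul_iff_left (h.ne_zero hp0) h.ne_top).1 h2
                rw [← ENNReal.coe_add, enorm_le_coe] at h3
                exact_mod_cast h3
              rw [hF, ← ENNReal.ofReal_ofNat 2, ← ENNReal.ofReal_mul (by norm_num)]
              refine ENNReal.ofReal_le_ofReal ?_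
              nth_rewrite 2 [← Real.exp_log (show (0 : ℝ) < 2 by norm_num)]
              rw [← hlog, ← Real.exp_add, Real.exp_le_exp, ← mul_add]
              gcongr
              have hCt : (0 : ℝ) ≤ C * t := by positivity
              have htri : |φ y - m x r| ≤
                  |φ y - m p.1.1 (4 * p.1.2)| + |m p.1.1 (4 * p.1.2) - m x r| :=
                abs_sub_le _ _ _
              have hKt : (0 : ℝ) ≤ K + t := by positivity
              rcases le_total |φ y - m p.1.1 (4 * p.1.2)| (N : ℝ) with hc | hc
              · rw [min_eq_left hc]
                exact (min_le_left _ _).trans (by linarith)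
              · rw [min_eq_right hc]
                exact (min_le_right _ _).trans (by linarith)
          _ = 2 * Φ * ∑' p : u, μ (ball p.1.1 (4 * p.1.2)) := by
              rw [← ENNReal.tsum_mul_left]
              exact tsum_congr fun p => by ring
          _ ≤ 2 * Φ * (1 / 4 * μ (ball x r)) := by gcongr
          _ = Φ * (2 * (1 / 4)) * μ (ball x r) := by ring
          _ = _ := by
              have h24 : (2 : ℝ≥0∞) * (1 / 4) = 2⁻¹ := by
                rw [one_div, show (4 : ℝ≥0∞) = 2 * 2 by norm_num,
                  ENNReal.mul_inv (by simp) (by simp), ← mul_assoc,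
                  ENNReal.mul_inv_cancel (by simp) (by simp), one_mul]
              rw [h24, div_eq_mul_inv]
      calc ∫⁻ y in ball x r, F y ∂μ
          ≤ ∫⁻ y in ball x r ∩ {y | C * t < ‖φ y - m x r‖ₑ}, F y ∂μ +
            ∫⁻ y in ball x r ∩ {y | C * t < ‖φ y - m x r‖ₑ}ᶜ, F y ∂μ := by
            refine le_trans ?_ (lintegral_union_le _ _ _)
            rw [inter_union_compl]
        _ ≤ Φ / 2 * μ (ball x r) + 2 * μ (ball x r) := add_le_add hhigh hlow
        _ = _ := by ring
  intro x r hr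
  have hN : ∀ N : ℕ, ∫⁻ y in ball x r, ENNReal.ofReal (Real.exp (ε * min |φ y - m x r| N)) ∂μ ≤
      4 * μ (ball x r) := by
    intro N
    have := htrunc N ⟨⟨x, r⟩, hr⟩
    simp only at this
    rw [ENNReal.div_le_iff (h.ne_zero hr) h.ne_top] at this
    refine this.trans_eq (by norm_num)
  have hlim := lintegral_tendsto_of_tendsto_of_monotone (μ := μ.restrict (ball x r))
    (f := fun (N : ℕ) y => ENNReal.ofReal (Real.exp (ε * min |φ y - m x r| N)))
    (F := fun y => ENNReal.ofReal (Real.exp (ε * |φ y - m x r|))) ?_ ?_ ?_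
  · exact le_of_tendsto' hlim hN
  · intro N
    refine AEMeasurable.restrict ?_
    have h1 : AEMeasurable (fun y => |φ y - m x r|) μ := (hφ.sub_const _).abs
    exact ENNReal.measurable_ofReal.comp_aemeasurable (Real.measurable_exp.comp_aemeasurable
      ((h1.min aemeasurable_const).const_mul ε))
  · refine ae_of_all _ fun y M N hMN => ENNReal.ofReal_le_ofReal (Real.exp_le_exp.2 ?_)
    gcongr
  · refine ae_of_all _ fun y => tendsto_const_nhds.congr' ?_
    obtain ⟨n, hn⟩ := exists_nat_ge |φ y - m x r|
    filter_upwards [eventually_ge_atTop n] with N hN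
    rw [min_eq_left (hn.trans (by exact_mod_cast hN))]

end JohnNirenberg

/-! ### The reverse Hölder inequality by a good level set argument. -/

section ReverseHolder

variable {X : Type*} [MetricSpace X] [MeasurableSpace X] [BorelSpace X]
  {μ : Measure X} {C D β : ℝ≥0} {w : X → ℝ≥0∞}

lemma ennreal_rpow_le_self {a : ℝ≥0∞} (ha : 1 ≤ a) {ε : ℝ} (h1 : ε ≤ 1) : a ^ ε ≤ a := by
  calc a ^ ε ≤ a ^ (1 : ℝ) := ENNReal.rpow_le_rpow_of_exponent_le ha h1
    _ = a := ENNReal.rpow_one a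

/-- On a stopping ball the mean of w exceeds t, so w exceeds βt on at least half of it. The mass
above level Ct, at most t times the measure of the fourfold stopping balls, is therefore paid for by
disjoint pieces of the set {w > βt}. -/
lemma IsDoubling.setLIntegral_level_le (h : IsDoubling μ C) (hw : Measurable w)
    (hfin : ∀ x r, ∫⁻ y in ball x r, w y ∂μ ≠ ∞)
    (hβ : ∀ x r, 0 < r → 2 * μ (ball x r ∩ {y | w y * μ (ball x r) ≤
      β * ∫⁻ z in ball x r, w z ∂μ}) ≤ μ (ball x r))
    {x : X} {r : ℝ} (hr : 0 < r) {t : ℝ≥0∞}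
    (ht : C ^ 3 * ∫⁻ y in ball x (2 * r), w y ∂μ ≤ t * μ (ball x r)) :
    ∫⁻ y in ball x r ∩ {y | C * t < w y}, w y ∂μ ≤
      2 * C ^ 2 * (t * μ (ball x (2 * r) ∩ {y | β * t < w y})) := by
  obtain ⟨u, hu, hdisj, hprop, -, hint⟩ := h.exists_stopping_sum hw.aemeasurable hfin hr ht
  have : Countable u := hu
  have hms : MeasurableSet {y | β * t < w y} := measurableSet_lt measurable_const hw
  have hhalf : ∀ p ∈ u, μ (ball p.1 p.2) ≤ 2 * μ (ball p.1 p.2 ∩ {y | β * t < w y}) := by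
    intro p hp
    have hB := hβ p.1 p.2 (hprop p hp).1
    have hsub : ball p.1 p.2 ∩ {y | w y ≤ β * t} ⊆ ball p.1 p.2 ∩ {y | w y * μ (ball p.1 p.2) ≤
        β * ∫⁻ z in ball p.1 p.2, w z ∂μ} := by
      refine inter_subset_inter_right _ fun y hy => ?_
      calc w y * μ (ball p.1 p.2) ≤ β * t * μ (ball p.1 p.2) := by gcongr; exact hy
        _ = β * (t * μ (ball p.1 p.2)) := by ring
        _ ≤ _ := by gcongr; exact (hprop p hp).2.2.1.le
    have hB' : 2 * μ (ball p.1 p.2 ∩ {y | w y ≤ β * t}) ≤ μ (ball p.1 p.2) :=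
      (by gcongr : _ ≤ _).trans hB
    have hsplit := measure_inter_add_sdiff (μ := μ) (ball p.1 p.2) hms
    have hd : ball p.1 p.2 \ {y | β * t < w y} = ball p.1 p.2 ∩ {y | w y ≤ β * t} := by
      ext y; simp
    rw [hd] at hsplit
    have hfin2 : μ (ball p.1 p.2) ≠ ∞ := h.ne_top
    have h2 : μ (ball p.1 p.2) + μ (ball p.1 p.2) ≤
        μ (ball p.1 p.2) + 2 * μ (ball p.1 p.2 ∩ {y | β * t < w y}) := by
      calc _ = 2 * μ (ball p.1 p.2) := (two_mul _).symm
        _ = 2 * (μ (ball p.1 p.2 ∩ {y | β * t < w y}) +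
            μ (ball p.1 p.2 ∩ {y | w y ≤ β * t})) := by rw [hsplit]
        _ = 2 * μ (ball p.1 p.2 ∩ {y | w y ≤ β * t}) +
            2 * μ (ball p.1 p.2 ∩ {y | β * t < w y}) := by ring
        _ ≤ _ := by gcongr
    exact (ENNReal.add_le_add_iff_left hfin2).1 h2
  calc ∫⁻ y in ball x r ∩ {y | C * t < w y}, w y ∂μ
      ≤ ∑' p : u, ∫⁻ y in ball p.1.1 (4 * p.1.2), w y ∂μ := hint w
    _ ≤ ∑' p : u, t * (C ^ 2 * (2 * μ (ball p.1.1 p.1.2 ∩ {y | β * t < w y}))) := by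
        refine ENNReal.tsum_le_tsum fun p => (hprop p p.2).2.2.2.trans ?_
        have h4 := h.ball_two_pow p.1.1 (hprop p p.2).1 2
        norm_num at h4
        gcongr
        refine h4.trans ?_
        gcongr
        exact hhalf p p.2
    _ = 2 * C ^ 2 * (t * ∑' p : u, μ (ball p.1.1 p.1.2 ∩ {y | β * t < w y})) := by
        rw [← ENNReal.tsum_mul_left, ← ENNReal.tsum_mul_left]
        exact tsum_congr fun p => by ring
    _ = 2 * C ^ 2 * (t * μ (⋃ p : u, ball p.1.1 p.1.2 ∩ {y | β * t < w y})) := by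
        rw [measure_iUnion]
        · exact fun p q hpq => ((pairwise_subtype_iff_pairwise_set u _).2 hdisj hpq).mono
            inter_subset_left inter_subset_left
        · exact fun p => measurableSet_ball.inter hms
    _ ≤ _ := by
        gcongr
        refine iUnion_subset fun p => inter_subset_inter_left _ (hprop p p.2).2.1

/-- The level set estimate is integrated against ετ^(ε-1) dτ. The second term bounds a (1+ε)-moment
by another one with a factor ε in front, small enough to be absorbed later. Both sides carry the
truncation N, so finiteness is available when that happens. -/
lemma IsDoubling.truncated_moment_le (h : IsDoubling μ C) (hw : Measurable w)
    (hfin : ∀ x r, ∫⁻ y in ball x r, w y ∂μ ≠ ∞) (hβ0 : 0 < β) (hβ1 : β ≤ 1)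
    (hβ : ∀ x r, 0 < r → 2 * μ (ball x r ∩ {y | w y * μ (ball x r) ≤
      β * ∫⁻ z in ball x r, w z ∂μ}) ≤ μ (ball x r))
    {ε : ℝ} (hε0 : 0 < ε) (hε1 : ε ≤ 1) (N : ℕ) {x : X} {r : ℝ} (hr : 0 < r) :
    ∫⁻ y in ball x r, w y * min (w y) N ^ ε ∂μ ≤
      C * ((C ^ 3 * ∫⁻ y in ball x (2 * r), w y ∂μ) / μ (ball x r)) ^ ε *
        ∫⁻ y in ball x r, w y ∂μ +
      ENNReal.ofReal ε * (2 * C ^ 3 * ((β : ℝ≥0∞)⁻¹) ^ 2) *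
        ∫⁻ y in ball x (2 * r), w y * min (w y) N ^ ε ∂μ := by
  have := h.sigmaFinite
  have hC1 : 1 ≤ (C : ℝ≥0∞) := h.one_le x
  have hC0 : (C : ℝ≥0∞) ≠ 0 := (zero_lt_one.trans_le hC1).ne'
  have hβt : (β : ℝ≥0∞) ≠ 0 := by exact_mod_cast hβ0.ne'
  -- From t₀ on the stopping construction applies; below it the level set integral is bounded by the
  -- full mass of the ball. The division by C in G and by β in G' matches the thresholds Ct and βt,
  -- and the cut at N makes the left side vanish once Cτ ≥ N.
  set t₀ : ℝ≥0∞ := (C ^ 3 * ∫⁻ y in ball x (2 * r), w y ∂μ) / μ (ball x r) with ht₀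
  set G : X → ℝ≥0∞ := fun y => min (w y) N / C with hG
  set G' : X → ℝ≥0∞ := fun y => min (w y / β) N with hG'
  have hGm : Measurable G := (hw.min measurable_const).div_const _
  have hG'm : Measurable G' := (hw.div_const _).min measurable_const
  have hlevel : ∀ τ : ℝ, ∫⁻ y in {y | ENNReal.ofReal τ < G y}, w y ∂(μ.restrict (ball x r)) ≤
      {τ : ℝ | ENNReal.ofReal τ < t₀}.indicator 1 τ * ∫⁻ y in ball x r, w y ∂μ +
      2 * C ^ 2 * (ENNReal.ofReal τ *
        (μ.restrict (ball x (2 * r))) {y | ENNReal.ofReal τ < G' y}) := by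
    intro τ
    by_cases hτ : ENNReal.ofReal τ < t₀
    · refine le_add_right ?_
      rw [indicator_of_mem (by exact hτ), Pi.one_apply, one_mul]
      exact lintegral_mono' Measure.restrict_le_self le_rfl
    · refine le_add_left ?_
      have hcond : (C : ℝ≥0∞) ^ 3 * ∫⁻ y in ball x (2 * r), w y ∂μ ≤
          ENNReal.ofReal τ * μ (ball x r) :=
        (ENNReal.div_le_iff (h.ne_zero hr) h.ne_top).1 (not_lt.1 hτ)
      rw [Measure.restrict_restrict (measurableSet_lt measurable_const hGm),
        Measure.restrict_apply (measurableSet_lt measurable_const hG'm)]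
      by_cases hN : C * ENNReal.ofReal τ < N
      · refine le_trans (lintegral_mono_set ?_)
          ((h.setLIntegral_level_le hw hfin hβ hr hcond).trans ?_)
        · rintro y ⟨hy, hyB⟩
          refine ⟨hyB, ?_⟩
          have hy' : ENNReal.ofReal τ * C < min (w y) N := ENNReal.mul_lt_of_lt_div hy
          rw [mul_comm] at hy'
          exact hy'.trans_le (min_le_left _ _)
        · refine mul_le_mul_right (mul_le_mul_right (measure_mono ?_) _) _
          rintro y ⟨hyB, hy⟩
          refine ⟨show ENNReal.ofReal τ < min (w y / β) N from lt_min ?_ ?_, hyB⟩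
          · rw [ENNReal.lt_div_iff_mul_lt (Or.inl hβt) (Or.inl ENNReal.coe_ne_top), mul_comm]
            exact hy
          · refine lt_of_le_of_lt ?_ hN
            calc ENNReal.ofReal τ = 1 * ENNReal.ofReal τ := (one_mul _).symm
              _ ≤ _ := by gcongr
      · have hempty : {y | ENNReal.ofReal τ < G y} = ∅ := by
          refine eq_empty_of_forall_notMem fun y hy => hN ?_
          have hy' : ENNReal.ofReal τ * C < min (w y) N := ENNReal.mul_lt_of_lt_div hy
          rw [mul_comm] at hy'
          exact hy'.trans_le (min_le_right _ _)
        rw [hempty]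
        simp
  have hcake : ∫⁻ y in ball x r, w y * G y ^ ε ∂μ ≤
      t₀ ^ ε * ∫⁻ y in ball x r, w y ∂μ + 2 * C ^ 2 * (ENNReal.ofReal ε *
        ∫⁻ y in ball x (2 * r), G' y ^ (1 + ε) ∂μ) := by
    have e2 := lintegral_mul_rpow_eq_lintegral_level (μ.restrict (ball x (2 * r))) hG'm
      (H := fun _ => 1) aemeasurable_const (show 0 < 1 + ε by linarith)
    simp only [one_mul, lintegral_one, Measure.restrict_apply_univ] at e2
    rw [lintegral_mul_rpow_eq_lintegral_level (μ.restrict (ball x r)) hGm hw.aemeasurable hε0,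
      ennreal_rpow_eq_lintegral hε0 t₀, e2, ← lintegral_const_mul' _ _ ENNReal.ofReal_ne_top,
      ← lintegral_const_mul' _ _ (ENNReal.mul_ne_top (by simp)
        (ENNReal.pow_ne_top ENNReal.coe_ne_top)),
      ← lintegral_mul_const' _ _ (hfin x r), ← lintegral_add_left]
    · refine setLIntegral_mono' measurableSet_Ioi fun τ (hτ : 0 < τ) => ?_
      refine (mul_le_mul_right (hlevel τ) _).trans ?_
      rw [mul_add, ← mul_assoc]
      gcongr 1
      have hk : ENNReal.ofReal (ε * τ ^ (ε - 1)) * ENNReal.ofReal τ ≤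
          ENNReal.ofReal ε * ENNReal.ofReal ((1 + ε) * τ ^ (1 + ε - 1)) := by
        rw [← ENNReal.ofReal_mul (by positivity), ← ENNReal.ofReal_mul hε0.le]
        refine ENNReal.ofReal_le_ofReal ?_
        rw [Real.rpow_sub_one hτ.ne', show 1 + ε - 1 = ε by ring]
        have h1 : 0 ≤ τ ^ ε := by positivity
        have h2 : ε * (τ ^ ε / τ) * τ = ε * τ ^ ε := by field_simp
        rw [h2]
        gcongr
        nlinarith
      calc ENNReal.ofReal (ε * τ ^ (ε - 1)) * (2 * C ^ 2 * (ENNReal.ofReal τ *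
            (μ.restrict (ball x (2 * r))) {y | ENNReal.ofReal τ < G' y}))
          = 2 * C ^ 2 * (ENNReal.ofReal (ε * τ ^ (ε - 1)) * ENNReal.ofReal τ *
            (μ.restrict (ball x (2 * r))) {y | ENNReal.ofReal τ < G' y}) := by ring
        _ ≤ 2 * C ^ 2 * (ENNReal.ofReal ε * ENNReal.ofReal ((1 + ε) * τ ^ (1 + ε - 1)) *
            (μ.restrict (ball x (2 * r))) {y | ENNReal.ofReal τ < G' y}) := by gcongr
        _ = _ := by ring
    · refine Measurable.mul_const (Measurable.mul (ENNReal.measurable_ofReal.comp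
        ((measurable_id.pow_const _).const_mul _)) (measurable_one.indicator ?_)) _
      exact measurableSet_lt ENNReal.measurable_ofReal measurable_const
  have hCε : (C : ℝ≥0∞) ^ ε ≤ C := ennreal_rpow_le_self hC1 hε1
  have hlow : ∫⁻ y in ball x r, w y * min (w y) N ^ ε ∂μ ≤
      C * ∫⁻ y in ball x r, w y * G y ^ ε ∂μ := by
    rw [← lintegral_const_mul' _ _ ENNReal.coe_ne_top]
    refine lintegral_mono fun y => ?_
    calc w y * min (w y) N ^ ε = w y * (C * G y) ^ ε := by
          rw [hG, ENNReal.mul_div_cancel hC0 ENNReal.coe_ne_top]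
      _ = w y * (C ^ ε * G y ^ ε) := by rw [ENNReal.mul_rpow_of_nonneg _ _ hε0.le]
      _ ≤ w y * (C * G y ^ ε) := by gcongr
      _ = _ := by ring
  have hβinv : 1 ≤ (β : ℝ≥0∞)⁻¹ := ENNReal.one_le_inv.2 (by exact_mod_cast hβ1)
  have hup : ∫⁻ y in ball x (2 * r), G' y ^ (1 + ε) ∂μ ≤
      ((β : ℝ≥0∞)⁻¹) ^ 2 * ∫⁻ y in ball x (2 * r), w y * min (w y) N ^ ε ∂μ := by
    rw [← lintegral_const_mul' _ _ (ENNReal.pow_ne_top (ENNReal.inv_ne_top.2 hβt))]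
    refine lintegral_mono fun y => ?_
    have h1 : G' y ≤ (β : ℝ≥0∞)⁻¹ * w y := by
      rw [mul_comm, ← div_eq_mul_inv]; exact min_le_left _ _
    have h2 : G' y ≤ (β : ℝ≥0∞)⁻¹ * min (w y) N := by
      rcases le_total (w y) N with hc | hc
      · rw [min_eq_left hc]; exact h1
      · rw [min_eq_right hc]
        calc G' y ≤ 1 * N := by rw [one_mul]; exact min_le_right _ _
          _ ≤ _ := by gcongr
    calc G' y ^ (1 + ε) = G' y * G' y ^ ε := by
          rw [ENNReal.rpow_add_of_nonneg _ _ zero_le_one hε0.le, ENNReal.rpow_one]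
      _ ≤ ((β : ℝ≥0∞)⁻¹ * w y) * ((β : ℝ≥0∞)⁻¹ * min (w y) N) ^ ε := by gcongr
      _ = ((β : ℝ≥0∞)⁻¹ * w y) * (((β : ℝ≥0∞)⁻¹) ^ ε * min (w y) N ^ ε) := by
          rw [ENNReal.mul_rpow_of_nonneg _ _ hε0.le]
      _ ≤ ((β : ℝ≥0∞)⁻¹ * w y) * ((β : ℝ≥0∞)⁻¹ * min (w y) N ^ ε) := by
          gcongr
          exact ennreal_rpow_le_self hβinv hε1
      _ = _ := by ring
  calc _ ≤ C * (t₀ ^ ε * ∫⁻ y in ball x r, w y ∂μ + 2 * C ^ 2 * (ENNReal.ofReal ε *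
        (((β : ℝ≥0∞)⁻¹) ^ 2 * ∫⁻ y in ball x (2 * r), w y * min (w y) N ^ ε ∂μ))) :=
        hlow.trans (by gcongr; exact hcake.trans (by gcongr))
    _ = _ := by ring

/-- The reverse Hölder inequality for measurable weights bounded away from zero, for which each
ball has a half on which the weight is at least a fixed multiple of its mean. -/
lemma IsDoubling.reverse_holder_of_pos (h : IsDoubling μ C) (hw : Measurable w) {δ : ℝ≥0}
    (hδ : 0 < δ) (hwδ : ∀ y, δ ≤ w y)
    (hfin : ∀ x r, ∫⁻ y in ball x r, w y ∂μ ≠ ∞) (hD1 : 1 ≤ D)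
    (hD : ∀ x r, 0 < r → ∫⁻ y in ball x (2 * r), w y ∂μ ≤ D * ∫⁻ y in ball x r, w y ∂μ)
    (hβ0 : 0 < β) (hβ1 : β ≤ 1)
    (hβ : ∀ x r, 0 < r → 2 * μ (ball x r ∩ {y | w y * μ (ball x r) ≤
      β * ∫⁻ z in ball x r, w z ∂μ}) ≤ μ (ball x r))
    {ε : ℝ} (hε0 : 0 < ε) (hε1 : ε ≤ 1)
    (hε : ENNReal.ofReal ε * (2 * C ^ 3 * ((β : ℝ≥0∞)⁻¹) ^ 2 * D ^ 2) ≤ 1 / 2)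
    {x : X} {r : ℝ} (hr : 0 < r) :
    (∫⁻ y in ball x r, w y ^ (1 + ε) ∂μ) * μ (ball x r) ^ ε ≤
      2 * (C ^ 4 * D) * (∫⁻ y in ball x r, w y ∂μ) ^ (1 + ε) := by
  have hC1 : 1 ≤ (C : ℝ≥0∞) := h.one_le x
  have hD1' : 1 ≤ (D : ℝ≥0∞) := by exact_mod_cast hD1
  have hδw : ∀ x r, δ * μ (ball x r) ≤ ∫⁻ y in ball x r, w y ∂μ := fun x r => by
    rw [← setLIntegral_const]; exact lintegral_mono fun y => hwδ y
  have hδ' : (δ : ℝ≥0∞) ≠ 0 := by exact_mod_cast hδ.ne'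
  have hw0 : ∀ x r, 0 < r → ∫⁻ y in ball x r, w y ∂μ ≠ 0 := fun x r hr h0 => by
    have := hδw x r
    rw [h0, nonpos_iff_eq_zero, mul_eq_zero] at this
    exact this.elim hδ' (h.ne_zero hr)
  have hpow0 : ∀ x r, 0 < r → (∫⁻ y in ball x r, w y ∂μ) ^ (1 + ε) ≠ 0 := fun x r hr =>
    (ENNReal.rpow_pos (hw0 x r hr).bot_lt (hfin x r)).ne'
  have hpowt : ∀ x r, (∫⁻ y in ball x r, w y ∂μ) ^ (1 + ε) ≠ ∞ := fun x r =>
    ENNReal.rpow_ne_top_of_nonneg (by linarith) (hfin x r)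
  have hsplit : ∀ a : ℝ≥0∞, a ^ (1 + ε) = a * a ^ ε := fun a => by
    rw [ENNReal.rpow_add_of_nonneg _ _ zero_le_one hε0.le, ENNReal.rpow_one]
  have hN : ∀ N : ℕ, (∫⁻ y in ball x r, w y * min (w y) N ^ ε ∂μ) * μ (ball x r) ^ ε ≤
      2 * (C ^ 4 * D) * (∫⁻ y in ball x r, w y ∂μ) ^ (1 + ε) := by
    intro N
    rw [← ENNReal.div_le_iff (hpow0 x r hr) (hpowt x r)]
    -- The quantity bounded uniformly over balls is the truncated reverse Hölder ratio. It is finite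
    -- a priori because min(w,N)^ε ≤ N^ε and, by w ≥ δ, μ(B) ≤ δ⁻¹ w(B). The double ball returns the
    -- same ratio with factor ε · 2C³β⁻²D² ≤ 1/2.
    refine le_two_mul_of_forall_bound (ι := {p : X × ℝ // 0 < p.2})
      (f := fun p => (∫⁻ y in ball p.1.1 p.1.2, w y * min (w y) N ^ ε ∂μ) *
        μ (ball p.1.1 p.1.2) ^ ε / (∫⁻ y in ball p.1.1 p.1.2, w y ∂μ) ^ (1 + ε))
      (M := (N : ℝ≥0∞) ^ ε * ((δ : ℝ≥0∞)⁻¹) ^ ε) ?_ ?_ ?_ ⟨⟨x, r⟩, hr⟩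
    · exact ENNReal.mul_ne_top (ENNReal.rpow_ne_top_of_nonneg hε0.le (by simp))
        (ENNReal.rpow_ne_top_of_nonneg hε0.le (ENNReal.inv_ne_top.2 hδ'))
    · rintro ⟨⟨x, r⟩, hr⟩
      simp only at hr ⊢
      refine ENNReal.div_le_of_le_mul ?_
      have h1 : ∫⁻ y in ball x r, w y * min (w y) N ^ ε ∂μ ≤
          (∫⁻ y in ball x r, w y ∂μ) * (N : ℝ≥0∞) ^ ε := by
        rw [← lintegral_mul_const _ hw]
        refine lintegral_mono fun y => ?_
        gcongr
        exact min_le_right _ _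
      have h2 : μ (ball x r) ≤ (δ : ℝ≥0∞)⁻¹ * ∫⁻ y in ball x r, w y ∂μ := by
        rw [mul_comm, ← div_eq_mul_inv, ENNReal.le_div_iff_mul_le (Or.inl hδ')
          (Or.inl ENNReal.coe_ne_top), mul_comm]
        exact hδw x r
      calc _ ≤ ((∫⁻ y in ball x r, w y ∂μ) * (N : ℝ≥0∞) ^ ε) *
            ((δ : ℝ≥0∞)⁻¹ * ∫⁻ y in ball x r, w y ∂μ) ^ ε := by gcongr
        _ = _ := by rw [ENNReal.mul_rpow_of_nonneg _ _ hε0.le, hsplit]; ring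
    · rintro Φ hΦ ⟨⟨x, r⟩, hr⟩
      simp only at hr ⊢
      refine ENNReal.div_le_of_le_mul ?_
      set W := ∫⁻ y in ball x r, w y ∂μ with hW
      have hΦ2 := hΦ ⟨⟨x, 2 * r⟩, by simpa using hr⟩
      simp only at hΦ2
      rw [ENNReal.div_le_iff (hpow0 x _ (by linarith)) (hpowt x _)] at hΦ2
      have hDr := hD x r hr
      have h1 : ((C ^ 3 * ∫⁻ y in ball x (2 * r), w y ∂μ) / μ (ball x r)) ^ ε *
          μ (ball x r) ^ ε ≤ C ^ 3 * D * W ^ ε := by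
        rw [← ENNReal.mul_rpow_of_nonneg _ _ hε0.le, ENNReal.div_mul_cancel (h.ne_zero hr) h.ne_top]
        calc _ ≤ ((C ^ 3 * D) * W) ^ ε := by rw [mul_assoc]; gcongr
          _ = (C ^ 3 * D : ℝ≥0∞) ^ ε * W ^ ε := ENNReal.mul_rpow_of_nonneg _ _ hε0.le
          _ ≤ _ := by
            gcongr
            exact ennreal_rpow_le_self (one_le_mul (one_le_pow₀ hC1) hD1') hε1
      have h2 : (∫⁻ y in ball x (2 * r), w y * min (w y) N ^ ε ∂μ) * μ (ball x r) ^ ε ≤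
          Φ * (D ^ 2 * W ^ (1 + ε)) := by
        calc _ ≤ (∫⁻ y in ball x (2 * r), w y * min (w y) N ^ ε ∂μ) *
              μ (ball x (2 * r)) ^ ε := by
              gcongr
              linarith
          _ ≤ Φ * (∫⁻ y in ball x (2 * r), w y ∂μ) ^ (1 + ε) := hΦ2
          _ ≤ Φ * (D * W) ^ (1 + ε) := by gcongr
          _ = Φ * (D ^ (1 + ε) * W ^ (1 + ε)) := by
              rw [ENNReal.mul_rpow_of_nonneg _ _ (by linarith : 0 ≤ 1 + ε)]
          _ ≤ _ := by
              gcongr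
              rw [hsplit, pow_two]
              gcongr
              exact ennreal_rpow_le_self hD1' hε1
      calc _ ≤ (C * ((C ^ 3 * ∫⁻ y in ball x (2 * r), w y ∂μ) / μ (ball x r)) ^ ε * W +
            ENNReal.ofReal ε * (2 * C ^ 3 * ((β : ℝ≥0∞)⁻¹) ^ 2) *
            ∫⁻ y in ball x (2 * r), w y * min (w y) N ^ ε ∂μ) * μ (ball x r) ^ ε := by
            gcongr
            exact h.truncated_moment_le hw hfin hβ0 hβ1 hβ hε0 hε1 N hr
        _ = C * (((C ^ 3 * ∫⁻ y in ball x (2 * r), w y ∂μ) / μ (ball x r)) ^ ε *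
              μ (ball x r) ^ ε) * W +
            ENNReal.ofReal ε * (2 * C ^ 3 * ((β : ℝ≥0∞)⁻¹) ^ 2) *
            ((∫⁻ y in ball x (2 * r), w y * min (w y) N ^ ε ∂μ) * μ (ball x r) ^ ε) := by ring
        _ ≤ C * (C ^ 3 * D * W ^ ε) * W + ENNReal.ofReal ε * (2 * C ^ 3 * ((β : ℝ≥0∞)⁻¹) ^ 2) *
            (Φ * (D ^ 2 * W ^ (1 + ε))) := by gcongr
        _ = (C ^ 4 * D + ENNReal.ofReal ε * (2 * C ^ 3 * ((β : ℝ≥0∞)⁻¹) ^ 2 * D ^ 2) * Φ) *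
            W ^ (1 + ε) := by rw [hsplit]; ring
        _ ≤ (C ^ 4 * D + 1 / 2 * Φ) * W ^ (1 + ε) := by gcongr
        _ = _ := by rw [one_div, ENNReal.div_eq_inv_mul]
  have hlim := lintegral_tendsto_of_tendsto_of_monotone (μ := μ.restrict (ball x r))
    (f := fun (N : ℕ) y => w y * min (w y) N ^ ε) (F := fun y => w y ^ (1 + ε)) ?_ ?_ ?_
  · have hμ0 : μ (ball x r) ^ ε ≠ 0 := (ENNReal.rpow_pos (h.pos x r hr) h.ne_top).ne'
    have hμt : μ (ball x r) ^ ε ≠ ∞ := ENNReal.rpow_ne_top_of_nonneg hε0.le h.ne_top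
    rw [← ENNReal.le_div_iff_mul_le (Or.inl hμ0) (Or.inl hμt)]
    refine le_of_tendsto' hlim fun N => ?_
    rw [ENNReal.le_div_iff_mul_le (Or.inl hμ0) (Or.inl hμt)]
    exact hN N
  · exact fun N => (hw.mul ((hw.min measurable_const).pow_const _)).aemeasurable
  · refine ae_of_all _ fun y M N hMN => ?_
    simp only
    gcongr
  · refine ae_of_all _ fun y => ?_
    rw [hsplit]
    refine ENNReal.Tendsto.const_mul ?_ ?_
    · refine (ENNReal.continuous_rpow_const.tendsto _).comp ?_
      have : Tendsto (fun N : ℕ => min (w y) (N : ℝ≥0∞)) atTop (𝓝 (min (w y) ∞)) :=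
        tendsto_const_nhds.min ENNReal.tendsto_nat_nhds_top
      rwa [min_eq_left le_top] at this
    · left
      exact (ENNReal.rpow_pos_of_nonneg (lt_of_lt_of_le hδ'.bot_lt (hwδ y)) hε0.le).ne'

end ReverseHolder

section ReverseHolder

variable {X : Type*} [MetricSpace X] [MeasurableSpace X] [BorelSpace X]
  {μ : Measure X} {C D β : ℝ≥0} {v : X → ℝ≥0∞}

/-- The reverse Hölder inequality for doubling weights for which each ball has a half on which the
weight is at least a fixed multiple of its mean. -/
lemma IsDoubling.reverse_holder (h : IsDoubling μ C) (hv : AEMeasurable v μ)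
    (hfin : ∀ x r, ∫⁻ y in ball x r, v y ∂μ ≠ ∞)
    (hD : ∀ x r, 0 < r → ∫⁻ y in ball x (2 * r), v y ∂μ ≤ D * ∫⁻ y in ball x r, v y ∂μ)
    (hβ0 : 0 < β) (hβ1 : β ≤ 1)
    (hβ : ∀ x r, 0 < r → 2 * μ (ball x r ∩ {y | v y * μ (ball x r) ≤
      β * ∫⁻ z in ball x r, v z ∂μ}) ≤ μ (ball x r)) :
    ∃ ε : ℝ, 0 < ε ∧ ∃ K : ℝ≥0∞, K ≠ ∞ ∧ ∀ x r, 0 < r →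
      (∫⁻ y in ball x r, v y ^ (1 + ε) ∂μ) * μ (ball x r) ^ ε ≤
        K * (∫⁻ y in ball x r, v y ∂μ) ^ (1 + ε) := by
  wlog hvm : Measurable v generalizing v
  · have hint : ∀ (x : X) (r : ℝ), ∫⁻ y in ball x r, hv.mk v y ∂μ = ∫⁻ y in ball x r, v y ∂μ :=
      fun x r => lintegral_congr_ae (ae_restrict_of_ae hv.ae_eq_mk.symm)
    obtain ⟨ε, hε, K, hK, hb⟩ := this hv.measurable_mk.aemeasurable
      (fun x r => by rw [hint]; exact hfin x r)
      (fun x r hr => by rw [hint, hint]; exact hD x r hr)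
      (fun x r hr => by
        rw [hint]
        refine le_trans (le_of_eq ?_) (hβ x r hr)
        congr 1
        refine measure_congr ?_
        filter_upwards [hv.ae_eq_mk] with y hy
        refine propext (and_congr_right fun _ => ?_)
        change hv.mk v y * _ ≤ _ ↔ v y * _ ≤ _
        rw [hy]) hv.measurable_mk
    refine ⟨ε, hε, K, hK, fun x r hr => ?_⟩
    have := hb x r hr
    rw [hint] at this
    refine le_trans (le_of_eq ?_) this
    congr 1
    refine lintegral_congr_ae (ae_restrict_of_ae ?_)
    filter_upwards [hv.ae_eq_mk] with y hy
    rw [hy]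
  -- The constant weight δ doubles with constant C, so D' serves v + δ. The exponent ε below is
  -- chosen to make εL ≤ 1/2.
  set D' : ℝ≥0 := max (max C D) 1 with hD'
  set L : ℝ≥0 := 2 * C ^ 3 * β⁻¹ ^ 2 * D' ^ 2 with hL
  set ε : ℝ := 1 / (2 * (L + 1)) with hε
  have hε0 : 0 < ε := by positivity
  have hε1 : ε ≤ 1 := by
    rw [hε, div_le_one (by positivity)]
    have : (0 : ℝ) ≤ L := L.2
    linarith
  have hεL : ENNReal.ofReal ε * (2 * C ^ 3 * ((β : ℝ≥0∞)⁻¹) ^ 2 * D' ^ 2) ≤ 1 / 2 := by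
    have h1 : (2 * C ^ 3 * ((β : ℝ≥0∞)⁻¹) ^ 2 * D' ^ 2) = ENNReal.ofReal L := by
      rw [ENNReal.ofReal_coe_nnreal, hL]
      push_cast [ENNReal.coe_inv hβ0.ne']
      ring
    rw [h1, ← ENNReal.ofReal_mul hε0.le, one_div, ← ENNReal.ofReal_ofNat 2,
      ← ENNReal.ofReal_inv_of_pos (by norm_num)]
    refine ENNReal.ofReal_le_ofReal ?_
    have : (0 : ℝ) ≤ L := L.2
    rw [hε, div_mul_eq_mul_div, one_mul, div_le_iff₀ (by positivity)]
    linarith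
  refine ⟨ε, hε0, 2 * (C ^ 4 * D') * 2 ^ (1 + ε), ?_, fun x r hr => ?_⟩
  · refine ENNReal.mul_ne_top (ENNReal.mul_ne_top (by simp) (ENNReal.mul_ne_top
      (ENNReal.pow_ne_top ENNReal.coe_ne_top) ENNReal.coe_ne_top))
      (ENNReal.rpow_ne_top_of_nonneg (by linarith) (by simp))
  rcases eq_or_ne (∫⁻ y in ball x r, v y ∂μ) 0 with h0 | h0
  · have : ∫⁻ y in ball x r, v y ^ (1 + ε) ∂μ = 0 := by
      rw [lintegral_eq_zero_iff' hvm.aemeasurable] at h0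
      rw [lintegral_eq_zero_iff' (hvm.pow_const _).aemeasurable]
      filter_upwards [h0] with y hy
      rw [hy, Pi.zero_apply, ENNReal.zero_rpow_of_pos (by linarith)]
    rw [this, zero_mul]
    exact zero_le
  set V := ∫⁻ y in ball x r, v y ∂μ with hV
  have hδt : V / μ (ball x r) ≠ ∞ := ENNReal.div_ne_top (hfin x r) (h.ne_zero hr)
  have hδ0 : V / μ (ball x r) ≠ 0 := by
    rw [Ne, ENNReal.div_eq_zero_iff, not_or]; exact ⟨h0, h.ne_top⟩
  -- Here δ is the mean of v over the ball under consideration, so adding δ merely doubles the mass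
  -- of that ball, while ε and the final constant do not depend on δ. The half-ball condition
  -- survives because β ≤ 1.
  obtain ⟨δ, hδ⟩ : ∃ δ : ℝ≥0, (δ : ℝ≥0∞) = _ := ⟨_, ENNReal.coe_toNNReal hδt⟩
  have hδpos : 0 < δ := by
    rw [← hδ] at hδ0
    exact pos_iff_ne_zero.2 (by exact_mod_cast hδ0)
  have hadd : ∀ (z : X) (s : ℝ), ∫⁻ y in ball z s, (v y + δ) ∂μ =
      ∫⁻ y in ball z s, v y ∂μ + δ * μ (ball z s) := fun z s => by
    rw [lintegral_add_right _ measurable_const, setLIntegral_const]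
  have key := h.reverse_holder_of_pos (w := fun y => v y + δ) (D := D') (β := β) (x := x)
    (hvm.add measurable_const) hδpos (fun y => le_add_self)
    (fun z s => by
      rw [hadd]
      exact ENNReal.add_ne_top.2 ⟨hfin z s, ENNReal.mul_ne_top ENNReal.coe_ne_top h.ne_top⟩)
    (le_max_right _ _)
    (fun z s hs => by
      rw [hadd, hadd, mul_add]
      refine add_le_add ((hD z s hs).trans ?_) ?_
      · gcongr
        exact (le_max_right _ _).trans (le_max_left _ _)
      · calc (δ : ℝ≥0∞) * μ (ball z (2 * s)) ≤ δ * (C * μ (ball z s)) := by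
              gcongr; exact h.doubling z s hs
          _ ≤ δ * (D' * μ (ball z s)) := by
              gcongr
              exact (le_max_left _ _).trans (le_max_left _ _)
          _ = _ := by ring) hβ0 hβ1
    (fun z s hs => by
      refine le_trans ?_ (hβ z s hs)
      gcongr 2
      refine inter_subset_inter_right _ fun y hy => ?_
      simp only [mem_ofPred_eq, hadd, mul_add, add_mul] at hy ⊢
      have h3 : (β : ℝ≥0∞) * (δ * μ (ball z s)) ≤ δ * μ (ball z s) := by
        calc _ ≤ 1 * (δ * μ (ball z s)) := by
              gcongr; exact_mod_cast hβ1
          _ = _ := one_mul _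
      exact (ENNReal.add_le_add_iff_right (ENNReal.mul_ne_top ENNReal.coe_ne_top h.ne_top)).1
        (hy.trans (add_le_add le_rfl h3))) hε0 hε1 hεL hr
  have hδV : V + δ * μ (ball x r) = 2 * V := by
    rw [hδ, ENNReal.div_mul_cancel (h.ne_zero hr) h.ne_top, two_mul]
  rw [hadd, ← hV, hδV] at key
  calc (∫⁻ y in ball x r, v y ^ (1 + ε) ∂μ) * μ (ball x r) ^ ε
      ≤ (∫⁻ y in ball x r, (v y + δ) ^ (1 + ε) ∂μ) * μ (ball x r) ^ ε := by
        gcongr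
        exact le_self_add
    _ ≤ 2 * (C ^ 4 * D') * (2 * V) ^ (1 + ε) := key
    _ = _ := by rw [ENNReal.mul_rpow_of_nonneg _ _ (by linarith : 0 ≤ 1 + ε)]; ring

end ReverseHolder

/-! ### Dual pairs of weights: doubling and reverse Hölder. -/

/-- Dual pairs of weights: `v^a σ^b = 1` almost everywhere, and the Muckenhoupt type condition
`v(B)^a σ(B)^b ≤ A μ(B)^{a+b}` holds on balls. -/
structure IsDualPair {X : Type*} [MetricSpace X] [MeasurableSpace X] (μ : Measure X) (a b : ℝ)
    (A : ℝ≥0∞) (v σ : X → ℝ≥0∞) : Prop where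
  a_pos : 0 < a
  b_pos : 0 < b
  A_ne_top : A ≠ ∞
  left_meas : AEMeasurable v μ
  right_meas : AEMeasurable σ μ
  dual : ∀ᵐ x ∂μ, v x ^ a * σ x ^ b = 1
  left_fin : ∀ x r, ∫⁻ y in ball x r, v y ∂μ ≠ ∞
  right_fin : ∀ x r, ∫⁻ y in ball x r, σ y ∂μ ≠ ∞
  le : ∀ x r, 0 < r → (∫⁻ y in ball x r, v y ∂μ) ^ a * (∫⁻ y in ball x r, σ y ∂μ) ^ b ≤
    A * μ (ball x r) ^ (a + b)

namespace IsDualPair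

variable {X : Type*} [MetricSpace X] [MeasurableSpace X]
  {μ : Measure X} {C : ℝ≥0} {a b : ℝ} {A : ℝ≥0∞} {v σ : X → ℝ≥0∞}

lemma symm (h : IsDualPair μ a b A v σ) : IsDualPair μ b a A σ v where
  a_pos := h.b_pos
  b_pos := h.a_pos
  A_ne_top := h.A_ne_top
  left_meas := h.right_meas
  right_meas := h.left_meas
  dual := by simpa only [mul_comm] using h.dual
  left_fin := h.right_fin
  right_fin := h.left_fin
  le := fun x r hr => by rw [mul_comm, add_comm]; exact h.le x r hr

lemma left_ne_zero (h : IsDualPair μ a b A v σ) : ∀ᵐ x ∂μ, v x ≠ 0 := by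
  filter_upwards [h.dual] with x hx h0
  rw [h0, ENNReal.zero_rpow_of_pos h.a_pos, zero_mul] at hx
  exact zero_ne_one hx

lemma left_ne_top (h : IsDualPair μ a b A v σ) : ∀ᵐ x ∂μ, v x ≠ ∞ := by
  filter_upwards [h.dual, h.symm.left_ne_zero] with x hx hσ h0
  rw [h0, ENNReal.top_rpow_of_pos h.a_pos, ENNReal.top_mul] at hx
  · exact ENNReal.top_ne_one hx
  · rw [Ne, ENNReal.rpow_eq_zero_iff]
    rintro (h1 | h1)
    · exact hσ h1.1
    · linarith [h1.2, h.b_pos]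

lemma right_eq (h : IsDualPair μ a b A v σ) : ∀ᵐ x ∂μ, σ x = v x ^ (-(a / b)) := by
  filter_upwards [h.dual, h.left_ne_zero, h.left_ne_top] with x hx h0 ht
  have ha := h.a_pos
  have hb := h.b_pos
  have h1 : v x ^ a ≠ 0 := (ENNReal.rpow_pos h0.bot_lt ht).ne'
  have h2 : v x ^ a ≠ ∞ := ENNReal.rpow_ne_top_of_nonneg ha.le ht
  have h3 : σ x ^ b = v x ^ (-a) := by
    rw [ENNReal.rpow_neg]
    exact ENNReal.eq_inv_of_mul_eq_one_left (by rw [mul_comm]; exact hx)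
  calc σ x = (σ x ^ b) ^ b⁻¹ := by
        rw [← ENNReal.rpow_mul, mul_inv_cancel₀ hb.ne', ENNReal.rpow_one]
    _ = v x ^ (-(a / b)) := by
        rw [h3, ← ENNReal.rpow_mul]
        congr 1
        field_simp

/-- The converse of the Muckenhoupt condition, from Hölder's inequality. -/
lemma measure_rpow_le (h : IsDualPair μ a b A v σ) (S : Set X) :
    μ S ^ (a + b) ≤ (∫⁻ y in S, v y ∂μ) ^ a * (∫⁻ y in S, σ y ∂μ) ^ b := by
  have ha := h.a_pos
  have hb := h.b_pos
  have hab : 0 < a + b := by linarith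
  have H := ENNReal.lintegral_mul_norm_pow_le (μ := μ.restrict S) h.left_meas.restrict
    h.right_meas.restrict (p := a / (a + b)) (q := b / (a + b)) (by positivity) (by positivity)
    (by field_simp)
  have h1 : ∫⁻ y in S, v y ^ (a / (a + b)) * σ y ^ (b / (a + b)) ∂μ = μ S := by
    rw [← setLIntegral_one]
    refine lintegral_congr_ae (ae_restrict_of_ae ?_)
    filter_upwards [h.dual] with y hy
    rw [div_eq_mul_inv, div_eq_mul_inv, ENNReal.rpow_mul, ENNReal.rpow_mul,
      ← ENNReal.mul_rpow_of_nonneg _ _ (by positivity), hy, ENNReal.one_rpow]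
  rw [h1] at H
  calc μ S ^ (a + b) ≤ ((∫⁻ y in S, v y ∂μ) ^ (a / (a + b)) *
        (∫⁻ y in S, σ y ∂μ) ^ (b / (a + b))) ^ (a + b) := by gcongr
    _ = _ := by
      rw [ENNReal.mul_rpow_of_nonneg _ _ hab.le, ← ENNReal.rpow_mul, ← ENNReal.rpow_mul,
        div_mul_cancel₀ _ hab.ne', div_mul_cancel₀ _ hab.ne']

lemma left_pos (h : IsDualPair μ a b A v σ) (hμ : IsDoubling μ C) {x : X} {r : ℝ} (hr : 0 < r) :
    ∫⁻ y in ball x r, v y ∂μ ≠ 0 := by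
  intro h0
  have h1 := h.measure_rpow_le (ball x r)
  rw [h0, ENNReal.zero_rpow_of_pos h.a_pos, zero_mul, nonpos_iff_eq_zero] at h1
  exact (ENNReal.rpow_pos (hμ.pos x r hr) hμ.ne_top).ne' h1

/-- The upper condition on 2B, the doubling of μ and the lower condition on B give v(2B)^a σ(2B)^b ≤
A C^(a+b) v(B)^a σ(2B)^b. The factor σ(2B)^b is positive and finite and cancels. -/
lemma exists_left_doubling (h : IsDualPair μ a b A v σ) (hμ : IsDoubling μ C) :
    ∃ D : ℝ≥0, ∀ x r, 0 < r → ∫⁻ y in ball x (2 * r), v y ∂μ ≤ D * ∫⁻ y in ball x r, v y ∂μ := by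
  have ha := h.a_pos
  have hb := h.b_pos
  have hfin : (A * C ^ (a + b)) ^ a⁻¹ ≠ ∞ := ENNReal.rpow_ne_top_of_nonneg (by positivity)
    (ENNReal.mul_ne_top h.A_ne_top (ENNReal.rpow_ne_top_of_nonneg (by positivity)
      ENNReal.coe_ne_top))
  obtain ⟨D, hD⟩ : ∃ D : ℝ≥0, (D : ℝ≥0∞) = _ := ⟨_, ENNReal.coe_toNNReal hfin⟩
  refine ⟨D, fun x r hr => ?_⟩
  have hr2 : 0 < 2 * r := by linarith
  set V2 := ∫⁻ y in ball x (2 * r), v y ∂μ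
  set S2 := ∫⁻ y in ball x (2 * r), σ y ∂μ with hS2
  set V1 := ∫⁻ y in ball x r, v y ∂μ
  have h1 : V2 ^ a * S2 ^ b ≤ (A * C ^ (a + b)) * V1 ^ a * S2 ^ b := by
    calc V2 ^ a * S2 ^ b ≤ A * μ (ball x (2 * r)) ^ (a + b) := h.le x _ hr2
      _ ≤ A * (C * μ (ball x r)) ^ (a + b) := by gcongr; exact hμ.doubling x r hr
      _ = A * C ^ (a + b) * μ (ball x r) ^ (a + b) := by
          rw [ENNReal.mul_rpow_of_nonneg _ _ (by positivity)]; ring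
      _ ≤ A * C ^ (a + b) * (V1 ^ a * S2 ^ b) := by
          gcongr
          refine (h.measure_rpow_le _).trans ?_
          gcongr
          exact lintegral_mono_set (ball_subset_ball (by linarith))
      _ = _ := by ring
  have hS0 : S2 ^ b ≠ 0 :=
    (ENNReal.rpow_pos (h.symm.left_pos hμ hr2).bot_lt (h.right_fin _ _)).ne'
  have hSt : S2 ^ b ≠ ∞ := ENNReal.rpow_ne_top_of_nonneg hb.le (h.right_fin _ _)
  have h2 := (ENNReal.mul_le_mul_iff_left hS0 hSt).1 h1
  calc V2 = (V2 ^ a) ^ a⁻¹ := by rw [← ENNReal.rpow_mul, mul_inv_cancel₀ ha.ne', ENNReal.rpow_one]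
    _ ≤ (A * C ^ (a + b) * V1 ^ a) ^ a⁻¹ := by gcongr
    _ = D * V1 := by
      rw [ENNReal.mul_rpow_of_nonneg _ _ (by positivity), ← hD, ← ENNReal.rpow_mul,
        mul_inv_cancel₀ ha.ne', ENNReal.rpow_one]

lemma exists_left_isDoubling [OpensMeasurableSpace X] (h : IsDualPair μ a b A v σ)
    (hμ : IsDoubling μ C) : ∃ D : ℝ≥0, IsDoubling (μ.withDensity v) D := by
  obtain ⟨D, hD⟩ := h.exists_left_doubling hμ
  refine ⟨D, ⟨fun x r hr => ?_, fun x r => ?_, fun x r hr => ?_⟩⟩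
  · rw [withDensity_apply _ measurableSet_ball]
    exact (h.left_pos hμ hr).bot_lt
  · rw [withDensity_apply _ measurableSet_ball]
    exact (h.left_fin x r).lt_top
  · rw [withDensity_apply _ measurableSet_ball, withDensity_apply _ measurableSet_ball]
    exact hD x r hr

/-- Let E be the part of B where v is at most β times its mean. Then v(E) ≤ β v(B) μ(E)/μ(B) and
σ(E) ≤ σ(B). Combining Hölder's inequality on E with the dual condition on B leaves μ(E)^b ≤ β^a A
μ(B)^b, so a small β forces μ(E) ≤ μ(B)/2. -/
lemma exists_half [BorelSpace X] (h : IsDualPair μ a b A v σ) (hμ : IsDoubling μ C) :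
    ∃ β : ℝ≥0, 0 < β ∧ β ≤ 1 ∧ ∀ x r, 0 < r → 2 * μ (ball x r ∩ {y | v y * μ (ball x r) ≤
      β * ∫⁻ z in ball x r, v z ∂μ}) ≤ μ (ball x r) := by
  have ha := h.a_pos
  have hb := h.b_pos
  have hfin : 2 ^ b * A + 1 ≠ ∞ := ENNReal.add_ne_top.2 ⟨ENNReal.mul_ne_top
    (ENNReal.rpow_ne_top_of_nonneg hb.le (by simp)) h.A_ne_top, ENNReal.one_ne_top⟩
  -- The choice β = T^(-1/a) with T = 2^b A + 1 gives β^a 2^b A ≤ 1; the added 1 ensures β ≤ 1.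
  obtain ⟨T, hT⟩ : ∃ T : ℝ≥0, (T : ℝ≥0∞) = _ := ⟨_, ENNReal.coe_toNNReal hfin⟩
  have hT1 : 1 ≤ T := by
    have : (1 : ℝ≥0∞) ≤ T := by rw [hT]; exact le_add_self
    exact_mod_cast this
  have hT0 : 0 < T := zero_lt_one.trans_le hT1
  set β : ℝ≥0 := (T ^ a⁻¹)⁻¹ with hβ
  have hβ0 : 0 < β := inv_pos.2 (NNReal.rpow_pos hT0)
  have hβ1 : β ≤ 1 := inv_le_one_of_one_le₀ (NNReal.one_le_rpow hT1 (by positivity))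
  have hβa : (β : ℝ≥0∞) ^ a * (2 ^ b * A) ≤ 1 := by
    have h1 : β ^ a * T = 1 := by
      rw [hβ, NNReal.inv_rpow, ← NNReal.rpow_mul, inv_mul_cancel₀ ha.ne', NNReal.rpow_one,
        inv_mul_cancel₀ hT0.ne']
    calc (β : ℝ≥0∞) ^ a * (2 ^ b * A) ≤ (β : ℝ≥0∞) ^ a * T := by
          gcongr
          rw [hT]
          exact le_self_add
      _ = ((β ^ a * T : ℝ≥0) : ℝ≥0∞) := by
          rw [ENNReal.coe_mul, ENNReal.coe_rpow_of_nonneg _ ha.le]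
      _ = 1 := by rw [h1, ENNReal.coe_one]
  refine ⟨β, hβ0, hβ1, fun x r hr => ?_⟩
  set B := ball x r
  set V := ∫⁻ z in B, v z ∂μ with hV
  set E := B ∩ {y | v y * μ B ≤ β * V} with hE
  have hV0 : V ≠ 0 := h.left_pos hμ hr
  have hVt : V ≠ ∞ := h.left_fin x r
  have hB0 : μ B ≠ 0 := hμ.ne_zero hr
  have hBt : μ B ≠ ∞ := hμ.ne_top
  have hVa0 : V ^ a ≠ 0 := (ENNReal.rpow_pos hV0.bot_lt hVt).ne'
  have hVat : V ^ a ≠ ∞ := ENNReal.rpow_ne_top_of_nonneg ha.le hVt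
  have hBa0 : μ B ^ a ≠ 0 := (ENNReal.rpow_pos hB0.bot_lt hBt).ne'
  have hBat : μ B ^ a ≠ ∞ := ENNReal.rpow_ne_top_of_nonneg ha.le hBt
  have hEm : NullMeasurableSet E μ := measurableSet_ball.nullMeasurableSet.inter
    (nullMeasurableSet_le (h.left_meas.mul_const _) aemeasurable_const)
  have hEv : (∫⁻ y in E, v y ∂μ) * μ B ≤ β * V * μ E := by
    rw [← lintegral_mul_const'' _ h.left_meas.restrict, ← setLIntegral_const]
    refine lintegral_mono_ae ?_
    filter_upwards [ae_restrict_mem₀ hEm] with y hy using hy.2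
  have hσE : ∫⁻ y in E, σ y ∂μ ≤ ∫⁻ y in B, σ y ∂μ := lintegral_mono_set inter_subset_left
  have hmain : μ E ^ (a + b) * V ^ a * μ B ^ a ≤
      (β : ℝ≥0∞) ^ a * A * (V ^ a * μ E ^ a * μ B ^ (a + b)) := by
    calc μ E ^ (a + b) * V ^ a * μ B ^ a
        ≤ ((∫⁻ y in E, v y ∂μ) ^ a * (∫⁻ y in E, σ y ∂μ) ^ b) * V ^ a * μ B ^ a := by
          gcongr; exact h.measure_rpow_le E
      _ = ((∫⁻ y in E, v y ∂μ) * μ B) ^ a * (V ^ a * (∫⁻ y in E, σ y ∂μ) ^ b) := by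
          rw [ENNReal.mul_rpow_of_nonneg _ _ ha.le]; ring
      _ ≤ (β * V * μ E) ^ a * (V ^ a * (∫⁻ y in B, σ y ∂μ) ^ b) := by gcongr
      _ ≤ (β * V * μ E) ^ a * (A * μ B ^ (a + b)) := mul_le_mul_right (h.le x r hr) _
      _ = _ := by
          rw [ENNReal.mul_rpow_of_nonneg _ _ ha.le, ENNReal.mul_rpow_of_nonneg _ _ ha.le]; ring
  rcases eq_or_ne (μ E) 0 with hE0 | hE0
  · rw [hE0, mul_zero]; exact zero_le
  have hEt : μ E ≠ ∞ := ne_top_of_le_ne_top hBt (measure_mono inter_subset_left)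
  have hEa0 : μ E ^ a ≠ 0 := (ENNReal.rpow_pos hE0.bot_lt hEt).ne'
  have hEat : μ E ^ a ≠ ∞ := ENNReal.rpow_ne_top_of_nonneg ha.le hEt
  have h2 : μ E ^ b ≤ (β : ℝ≥0∞) ^ a * A * μ B ^ b := by
    rw [ENNReal.rpow_add_of_nonneg _ _ ha.le hb.le, ENNReal.rpow_add_of_nonneg _ _ ha.le hb.le]
      at hmain
    have h3 : (μ E ^ a * V ^ a * μ B ^ a) * μ E ^ b ≤
        (μ E ^ a * V ^ a * μ B ^ a) * ((β : ℝ≥0∞) ^ a * A * μ B ^ b) := by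
      calc _ = μ E ^ a * μ E ^ b * V ^ a * μ B ^ a := by ring
        _ ≤ _ := hmain
        _ = _ := by ring
    exact (ENNReal.mul_le_mul_iff_right (mul_ne_zero (mul_ne_zero hEa0 hVa0) hBa0)
      (ENNReal.mul_ne_top (ENNReal.mul_ne_top hEat hVat) hBat)).1 h3
  have h4 : (2 * μ E) ^ b ≤ μ B ^ b := by
    calc (2 * μ E) ^ b = 2 ^ b * μ E ^ b := ENNReal.mul_rpow_of_nonneg _ _ hb.le
      _ ≤ 2 ^ b * ((β : ℝ≥0∞) ^ a * A * μ B ^ b) := by gcongr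
      _ = ((β : ℝ≥0∞) ^ a * (2 ^ b * A)) * μ B ^ b := by ring
      _ ≤ 1 * μ B ^ b := by gcongr
      _ = _ := one_mul _
  exact (ENNReal.rpow_le_rpow_iff hb).1 h4

lemma reverse_holder [BorelSpace X] (h : IsDualPair μ a b A v σ) (hμ : IsDoubling μ C) :
    ∃ ε : ℝ, 0 < ε ∧ ∃ K : ℝ≥0∞, K ≠ ∞ ∧ ∀ x r, 0 < r →
      (∫⁻ y in ball x r, v y ^ (1 + ε) ∂μ) * μ (ball x r) ^ ε ≤
        K * (∫⁻ y in ball x r, v y ∂μ) ^ (1 + ε) := by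
  obtain ⟨D, hD⟩ := h.exists_left_doubling hμ
  obtain ⟨β, hβ0, hβ1, hβ⟩ := h.exists_half hμ
  exact hμ.reverse_holder h.left_meas h.left_fin hD hβ0 hβ1 hβ

end IsDualPair

/-! ### Exponential weights. -/

section ExpWeight

/-- The function `e^{sφ}` with values in `[0,∞]`. -/
noncomputable def expWeight {X : Type*} (s : ℝ) (φ : X → ℝ) (x : X) : ℝ≥0∞ :=
  ENNReal.ofReal (Real.exp (s * φ x))

variable {X : Type*} {s t : ℝ} {φ : X → ℝ} {x : X}

lemma expWeight_ne_zero : expWeight s φ x ≠ 0 :=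
  (ENNReal.ofReal_pos.2 (Real.exp_pos _)).ne'

lemma expWeight_ne_top : expWeight s φ x ≠ ∞ := ENNReal.ofReal_ne_top

lemma expWeight_rpow (r : ℝ) : expWeight s φ x ^ r = expWeight (s * r) φ x := by
  rw [expWeight, expWeight, ENNReal.ofReal_rpow_of_pos (Real.exp_pos _), ← Real.exp_mul]
  congr 2; ring

lemma expWeight_mul : expWeight s φ x * expWeight t φ x = expWeight (s + t) φ x := by
  rw [expWeight, expWeight, expWeight, ← ENNReal.ofReal_mul (Real.exp_pos _).le, ← Real.exp_add,
    add_mul]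

lemma expWeight_mul_neg : expWeight s φ x * expWeight (-s) φ x = 1 := by
  rw [expWeight_mul, add_neg_cancel, expWeight, zero_mul, Real.exp_zero, ENNReal.ofReal_one]

lemma aemeasurable_expWeight [MeasurableSpace X] {μ : Measure X} (hφ : AEMeasurable φ μ) :
    AEMeasurable (expWeight s φ) μ :=
  ENNReal.measurable_ofReal.comp_aemeasurable (Real.measurable_exp.comp_aemeasurable
    (hφ.const_mul s))

end ExpWeight

/-! ### Stability of dual pairs under exponentials of BMO functions. -/

section Perturbation

variable {X : Type*} [MetricSpace X] [MeasurableSpace X] [BorelSpace X]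
  {μ : Measure X} {C : ℝ≥0} {v σ : X → ℝ≥0∞} {φ : X → ℝ} {m : X → ℝ → ℝ} {K : ℝ≥0}
  {a b : ℝ} {A : ℝ≥0∞}

/-- Multiplying a weight satisfying a reverse Hölder inequality by a small power of the exponential
of a function of bounded mean oscillation multiplies its mass on balls by at most a constant times
the exponential of the mean. -/
lemma IsDoubling.lintegral_mul_expWeight_le (h : IsDoubling μ C) (hφ : AEMeasurable φ μ)
    (hm : ∀ x r, 0 < r → ∫⁻ y in ball x r, ‖φ y - m x r‖ₑ ∂μ ≤ K * μ (ball x r))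
    (hv : AEMeasurable v μ)
    (hRH : ∃ ε : ℝ, 0 < ε ∧ ∃ K : ℝ≥0∞, K ≠ ∞ ∧ ∀ x r, 0 < r →
      (∫⁻ y in ball x r, v y ^ (1 + ε) ∂μ) * μ (ball x r) ^ ε ≤
        K * (∫⁻ y in ball x r, v y ∂μ) ^ (1 + ε)) :
    ∃ s₀ : ℝ, 0 < s₀ ∧ ∃ K' : ℝ≥0∞, K' ≠ ∞ ∧ ∀ s : ℝ, |s| ≤ s₀ → ∀ x r, 0 < r →
      ∫⁻ y in ball x r, v y * expWeight s φ y ∂μ ≤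
        K' * ENNReal.ofReal (Real.exp (s * m x r)) * ∫⁻ y in ball x r, v y ∂μ := by
  obtain ⟨ε, hε, K₁, hK₁, hRH⟩ := hRH
  obtain ⟨η, hη, hJN⟩ := h.john_nirenberg hφ hm
  have hε1 : 0 < 1 + ε := by linarith
  set p : ℝ := 1 / (1 + ε) with hp
  set q : ℝ := ε / (1 + ε) with hq
  have hp0 : 0 < p := by positivity
  have hq0 : 0 < q := by positivity
  have hpq : p + q = 1 := by rw [hp, hq]; field_simp
  refine ⟨η * q, by positivity, K₁ ^ p * 4 ^ q, ENNReal.mul_ne_top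
    (ENNReal.rpow_ne_top_of_nonneg hp0.le hK₁) (ENNReal.rpow_ne_top_of_nonneg hq0.le (by simp)),
    fun s hs x r hr => ?_⟩
  set V := ∫⁻ y in ball x r, v y ∂μ
  set c := ENNReal.ofReal (Real.exp (s * m x r)) with hc
  set E : X → ℝ≥0∞ := fun y => ENNReal.ofReal (Real.exp (η * |φ y - m x r|)) with hE
  have hEm : AEMeasurable E μ := ENNReal.measurable_ofReal.comp_aemeasurable
    (Real.measurable_exp.comp_aemeasurable ((hφ.sub_const _).abs.const_mul η))
  have hpt : ∀ y, v y * expWeight s φ y ≤ c * ((v y ^ (1 + ε)) ^ p * E y ^ q) := by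
    intro y
    have h1 : (v y ^ (1 + ε)) ^ p = v y := by
      rw [← ENNReal.rpow_mul, hp, mul_one_div_cancel hε1.ne', ENNReal.rpow_one]
    have h2 : expWeight s φ y ≤ c * E y ^ q := by
      rw [hE, hc, expWeight, ENNReal.ofReal_rpow_of_pos (Real.exp_pos _), ← Real.exp_mul,
        ← ENNReal.ofReal_mul (Real.exp_pos _).le, ← Real.exp_add]
      refine ENNReal.ofReal_le_ofReal (Real.exp_le_exp.2 ?_)
      have h3 : s * (φ y - m x r) ≤ η * q * |φ y - m x r| :=
        (le_abs_self _).trans (by rw [abs_mul]; gcongr)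
      linarith
    rw [h1]
    calc _ ≤ v y * (c * E y ^ q) := by gcongr
      _ = _ := by ring
  have hμ0 := h.ne_zero (x := x) hr
  have hμt := h.ne_top (x := x) (r := r)
  have hRHp : (∫⁻ y in ball x r, v y ^ (1 + ε) ∂μ) ^ p * μ (ball x r) ^ q ≤ K₁ ^ p * V := by
    have := ENNReal.rpow_le_rpow (hRH x r hr) hp0.le
    rw [ENNReal.mul_rpow_of_nonneg _ _ hp0.le, ENNReal.mul_rpow_of_nonneg _ _ hp0.le,
      ← ENNReal.rpow_mul, ← ENNReal.rpow_mul, show (1 + ε) * p = 1 by rw [hp]; field_simp,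
      ENNReal.rpow_one, show ε * p = q by rw [hp, hq]; ring] at this
    exact this
  calc ∫⁻ y in ball x r, v y * expWeight s φ y ∂μ
      ≤ ∫⁻ y in ball x r, c * ((v y ^ (1 + ε)) ^ p * E y ^ q) ∂μ := lintegral_mono hpt
    _ = c * ∫⁻ y in ball x r, (v y ^ (1 + ε)) ^ p * E y ^ q ∂μ :=
        lintegral_const_mul' _ _ ENNReal.ofReal_ne_top
    _ ≤ c * ((∫⁻ y in ball x r, v y ^ (1 + ε) ∂μ) ^ p * (∫⁻ y in ball x r, E y ∂μ) ^ q) := by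
        gcongr
        exact ENNReal.lintegral_mul_norm_pow_le (hv.pow_const _).restrict hEm.restrict
          hp0.le hq0.le hpq
    _ ≤ c * ((∫⁻ y in ball x r, v y ^ (1 + ε) ∂μ) ^ p * (4 * μ (ball x r)) ^ q) := by
        gcongr
        exact hJN x r hr
    _ = c * (4 ^ q * ((∫⁻ y in ball x r, v y ^ (1 + ε) ∂μ) ^ p * μ (ball x r) ^ q)) := by
        rw [ENNReal.mul_rpow_of_nonneg _ _ hq0.le]; ring
    _ ≤ c * (4 ^ q * (K₁ ^ p * V)) := by gcongr
    _ = _ := by ring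

/-- Dual pairs are stable under multiplication by small powers of the exponential of a function of
bounded mean oscillation. -/
lemma IsDualPair.exists_perturbation (hd : IsDualPair μ a b A v σ) (h : IsDoubling μ C)
    (hφ : AEMeasurable φ μ)
    (hm : ∀ x r, 0 < r → ∫⁻ y in ball x r, ‖φ y - m x r‖ₑ ∂μ ≤ K * μ (ball x r)) :
    ∃ t₀ : ℝ, 0 < t₀ ∧ ∀ t : ℝ, |t| ≤ t₀ → ∃ A' : ℝ≥0∞, IsDualPair μ a b A'
      (fun x => v x * expWeight (t / a) φ x) (fun x => σ x * expWeight (-t / b) φ x) := by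
  have ha := hd.a_pos
  have hb := hd.b_pos
  obtain ⟨s₁, hs₁, K₁, hK₁, H₁⟩ :=
    h.lintegral_mul_expWeight_le hφ hm hd.left_meas (hd.reverse_holder h)
  obtain ⟨s₂, hs₂, K₂, hK₂, H₂⟩ :=
    h.lintegral_mul_expWeight_le hφ hm hd.right_meas (hd.symm.reverse_holder h)
  refine ⟨min (a * s₁) (b * s₂), by positivity, fun t ht => ⟨K₁ ^ a * K₂ ^ b * A, ?_⟩⟩
  have hta : |t / a| ≤ s₁ := by
    rw [abs_div, abs_of_pos ha, div_le_iff₀ ha, mul_comm]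
    exact ht.trans (min_le_left _ _)
  have htb : |-t / b| ≤ s₂ := by
    rw [abs_div, abs_of_pos hb, abs_neg, div_le_iff₀ hb, mul_comm]
    exact ht.trans (min_le_right _ _)
  have fin : ∀ {w : X → ℝ≥0∞} {s : ℝ} {K' : ℝ≥0∞}, K' ≠ ∞ →
      (∀ x r, ∫⁻ y in ball x r, w y ∂μ ≠ ∞) →
      (∀ x r, 0 < r → ∫⁻ y in ball x r, w y * expWeight s φ y ∂μ ≤
        K' * ENNReal.ofReal (Real.exp (s * m x r)) * ∫⁻ y in ball x r, w y ∂μ) →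
      ∀ x r, ∫⁻ y in ball x r, w y * expWeight s φ y ∂μ ≠ ∞ := by
    intro w s K' hK' hw hle x r
    rcases le_or_gt r 0 with hr | hr
    · simp [ball_eq_empty.2 hr]
    · exact ne_top_of_le_ne_top (ENNReal.mul_ne_top (ENNReal.mul_ne_top hK'
        ENNReal.ofReal_ne_top) (hw x r)) (hle x r hr)
  refine ⟨ha, hb, ?_, hd.left_meas.mul (aemeasurable_expWeight hφ),
    hd.right_meas.mul (aemeasurable_expWeight hφ), ?_, fin hK₁ hd.left_fin (H₁ _ hta),
    fin hK₂ hd.right_fin (H₂ _ htb), fun x r hr => ?_⟩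
  · exact ENNReal.mul_ne_top (ENNReal.mul_ne_top (ENNReal.rpow_ne_top_of_nonneg ha.le hK₁)
      (ENNReal.rpow_ne_top_of_nonneg hb.le hK₂)) hd.A_ne_top
  · filter_upwards [hd.dual] with x hx
    rw [ENNReal.mul_rpow_of_nonneg _ _ ha.le, ENNReal.mul_rpow_of_nonneg _ _ hb.le,
      expWeight_rpow, expWeight_rpow, div_mul_cancel₀ _ ha.ne', div_mul_cancel₀ _ hb.ne']
    calc _ = v x ^ a * σ x ^ b * (expWeight t φ x * expWeight (-t) φ x) := by ring
      _ = 1 := by rw [hx, expWeight_mul_neg, one_mul]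
  · set c₁ := ENNReal.ofReal (Real.exp (t / a * m x r)) with hc₁
    set c₂ := ENNReal.ofReal (Real.exp (-t / b * m x r)) with hc₂
    -- The two exponential factors of the mean, raised to a and b, are e^(tm) and e^(-tm). Their
    -- cancellation makes the new dual constant independent of the ball.
    have hc : c₁ ^ a * c₂ ^ b = 1 := by
      rw [hc₁, hc₂, ENNReal.ofReal_rpow_of_pos (Real.exp_pos _),
        ENNReal.ofReal_rpow_of_pos (Real.exp_pos _), ← ENNReal.ofReal_mul (by positivity),
        ← Real.exp_mul, ← Real.exp_mul, ← Real.exp_add]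
      have : t / a * m x r * a + -t / b * m x r * b = 0 := by field_simp; ring
      rw [this, Real.exp_zero, ENNReal.ofReal_one]
    set V := ∫⁻ y in ball x r, v y ∂μ
    set S := ∫⁻ y in ball x r, σ y ∂μ
    calc _ ≤ (K₁ * c₁ * V) ^ a * (K₂ * c₂ * S) ^ b := by
          gcongr
          · exact H₁ _ hta x r hr
          · exact H₂ _ htb x r hr
      _ = K₁ ^ a * K₂ ^ b * (c₁ ^ a * c₂ ^ b) * (V ^ a * S ^ b) := by
          simp only [ENNReal.mul_rpow_of_nonneg _ _ ha.le, ENNReal.mul_rpow_of_nonneg _ _ hb.le]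
          ring
      _ ≤ K₁ ^ a * K₂ ^ b * 1 * (A * μ (ball x r) ^ (a + b)) := by
          rw [hc]
          exact mul_le_mul_right (hd.le x r hr) _
      _ = _ := by ring

end Perturbation

/-! ### The weighted bound for the fractional maximal function. -/

section FractionalMaximal

lemma setLIntegral_withDensity {X : Type*} [MeasurableSpace X] {μ : Measure X} {f g : X → ℝ≥0∞}
    (hf : AEMeasurable f μ) (hg : AEMeasurable g μ) {S : Set X} (hS : MeasurableSet S) :
    ∫⁻ x in S, g x ∂(μ.withDensity f) = ∫⁻ x in S, f x * g x ∂μ := by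
  rw [restrict_withDensity hS,
    lintegral_withDensity_eq_lintegral_mul₀ hf.restrict hg.restrict]
  rfl

variable {X : Type*} [MetricSpace X] [MeasurableSpace X] [BorelSpace X]
  {μ : Measure X} {C : ℝ≥0} {v σ : X → ℝ≥0∞} {a b p q : ℝ} {A : ℝ≥0∞}

/-- The unweighted fractional maximal function on a doubling space maps `L^p` to `L^q`. -/
lemma IsDoubling.fractional_strong_type {ν : Measure X} (h : IsDoubling ν C) {e : ℝ} (hp : 1 < p)
    (hpq : p < q) (he : 1 - e = 1 / p - 1 / q) :
    ∃ K : ℝ≥0∞, K ≠ ∞ ∧ ∀ F : X → ℝ≥0∞, AEMeasurable F ν →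
      ∫⁻ x, ballMax ν e F x ^ q ∂ν ≤ K * (∫⁻ x, F x ^ p ∂ν) ^ (q / p) := by
  obtain ⟨K, hK, H⟩ := h.strong_type hp
  have hp0 : 0 < p := by linarith
  have hq0 : 0 < q := by linarith
  refine ⟨K, hK, fun F hF => ?_⟩
  set I := ∫⁻ x, F x ^ p ∂ν with hI
  have hγ : 0 < 1 / p - 1 / q := by
    rw [sub_pos]; exact one_div_lt_one_div_of_lt hp0 hpq
  have hpqle : 0 ≤ 1 - p / q := by
    rw [sub_nonneg, div_le_one hq0]; exact hpq.le
  -- Hedberg's device: write Y = Y^(p/q) Y^(1-p/q), keep the first power for the ordinary maximal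
  -- function and estimate the second by Hölder through the global L^p norm. The powers of the
  -- measure of the ball then match exactly.
  have hpt : ∀ x, ballMax ν e F x ≤ ballMax ν 1 F x ^ (p / q) * I ^ (1 / p - 1 / q) := by
    intro x
    refine ballMax_le _ _ _ fun c r hx => ?_
    have hr := pos_of_mem_ball hx
    set n := ν (ball c r) with hn
    have hn0 : n ≠ 0 := h.ne_zero hr
    have hnt : n ≠ ∞ := h.ne_top
    set Y := ∫⁻ y in ball c r, F y ∂ν with hY
    have hHolder : Y ≤ I ^ (1 / p) * n ^ (1 - 1 / p) := by
      have H := ENNReal.lintegral_mul_norm_pow_le (μ := ν.restrict (ball c r))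
        (hF.pow_const p).restrict (aemeasurable_const (b := (1 : ℝ≥0∞)))
        (p := 1 / p) (q := 1 - 1 / p) (by positivity)
        (by rw [sub_nonneg, div_le_one hp0]; exact hp.le) (by ring)
      simp only [ENNReal.one_rpow, mul_one, lintegral_one, Measure.restrict_apply_univ,
        ← ENNReal.rpow_mul, mul_one_div_cancel hp0.ne', ENNReal.rpow_one] at H
      refine H.trans ?_
      gcongr
      exact setLIntegral_le_lintegral _ _
    have hle : Y / n ^ (1 : ℝ) ≤ ballMax ν 1 F x := le_ballMax ν 1 F hx
    rw [ENNReal.rpow_one] at hle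
    have hYsplit : Y = Y ^ (p / q) * Y ^ (1 - p / q) := by
      rw [← ENNReal.rpow_add_of_nonneg _ _ (by positivity) hpqle, add_sub_cancel, ENNReal.rpow_one]
    refine ENNReal.div_le_of_le_mul ?_
    calc Y = Y ^ (p / q) * Y ^ (1 - p / q) := hYsplit
      _ ≤ Y ^ (p / q) * (I ^ (1 / p) * n ^ (1 - 1 / p)) ^ (1 - p / q) := by gcongr
      _ = Y ^ (p / q) * (I ^ (1 / p - 1 / q) * (n ^ (-(p / q)) * n ^ e)) := by
          rw [ENNReal.mul_rpow_of_nonneg _ _ hpqle, ← ENNReal.rpow_mul, ← ENNReal.rpow_mul,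
            ← ENNReal.rpow_add _ _ hn0 hnt]
          congr 3
          · field_simp
          · have : e = 1 - (1 / p - 1 / q) := by linarith
            rw [this]
            field_simp
            ring
      _ = (Y / n) ^ (p / q) * I ^ (1 / p - 1 / q) * n ^ e := by
          rw [div_eq_mul_inv Y n, ENNReal.mul_rpow_of_nonneg _ _ (by positivity : 0 ≤ p / q),
            ENNReal.inv_rpow, ENNReal.rpow_neg]
          ring
      _ ≤ _ := by gcongr
  calc ∫⁻ x, ballMax ν e F x ^ q ∂ν
      ≤ ∫⁻ x, ballMax ν 1 F x ^ p * I ^ ((1 / p - 1 / q) * q) ∂ν := by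
        refine lintegral_mono fun x => ?_
        calc _ ≤ (ballMax ν 1 F x ^ (p / q) * I ^ (1 / p - 1 / q)) ^ q := by
              gcongr; exact hpt x
          _ = _ := by
              rw [ENNReal.mul_rpow_of_nonneg _ _ hq0.le, ← ENNReal.rpow_mul, ← ENNReal.rpow_mul,
                div_mul_cancel₀ _ hq0.ne']
    _ = (∫⁻ x, ballMax ν 1 F x ^ p ∂ν) * I ^ ((1 / p - 1 / q) * q) :=
        lintegral_mul_const _ ((measurable_ballMax _ _ _).pow_const _)
    _ ≤ K * I * I ^ ((1 / p - 1 / q) * q) := by gcongr; exact H F hF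
    _ = K * (I ^ (1 : ℝ) * I ^ ((1 / p - 1 / q) * q)) := by rw [ENNReal.rpow_one, mul_assoc]
    _ = K * I ^ (q / p) := by
        rw [← ENNReal.rpow_add_of_nonneg _ _ zero_le_one (by positivity)]
        congr 2
        field_simp
        ring

/-- The two weight bound for the fractional maximal function associated with a dual pair. -/
lemma IsDualPair.lintegral_ballMax_le (hd : IsDualPair μ a b A v σ) (h : IsDoubling μ C)
    (hp : 1 < p) (hpq : p < q) (ha : a = 1 / q) (hb : b = 1 - 1 / p) :
    ∃ K : ℝ≥0∞, K ≠ ∞ ∧ ∀ F : X → ℝ≥0∞, AEMeasurable F μ →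
      ∫⁻ x, ballMax μ (a + b) (fun y => σ y * F y) x ^ q * v x ∂μ ≤
        K * (∫⁻ x, F x ^ p * σ x ∂μ) ^ (q / p) := by
  have ha0 := hd.a_pos
  have hb0 := hd.b_pos
  have hq0 : 0 < q := by linarith
  have hab0 : 0 < a + b := by linarith
  obtain ⟨D₁, hν⟩ := hd.exists_left_isDoubling h
  obtain ⟨D₂, hτ⟩ := hd.symm.exists_left_isDoubling h
  set ν := μ.withDensity v with hνdef
  set τ := μ.withDensity σ with hτdef
  have hνac : ν ≪ μ := withDensity_absolutelyContinuous _ _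
  have hτac : τ ≪ μ := withDensity_absolutelyContinuous _ _
  -- The exponent k satisfies (a+b)k = b/a, the power of σ(B) in v(B) σ(B)^(b/a) ≤ A^(1/a)
  -- μ(B)^(1+b/a). The exponent s = q/k satisfies 1 - s = -a/b, so that v^(1-s) = σ.
  set k : ℝ := b / (a * (a + b)) with hk
  set s : ℝ := (a + b) / b with hs
  have hk0 : 0 < k := by positivity
  have hs1 : 1 < s := by rw [hs, lt_div_iff₀ hb0]; linarith
  have hkq : q = k * s := by
    rw [hk, hs, show q = 1 / a by rw [ha, one_div_one_div]]
    field_simp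
  obtain ⟨K₁, hK₁, H₁⟩ := hν.strong_type hs1
  obtain ⟨K₂, hK₂, H₂⟩ := hτ.fractional_strong_type (e := a + b) hp hpq
    (by rw [ha, hb]; ring)
  refine ⟨(A ^ (1 / a)) ^ s * (K₁ * K₂), ENNReal.mul_ne_top (ENNReal.rpow_ne_top_of_nonneg
    (by linarith) (ENNReal.rpow_ne_top_of_nonneg (by positivity) hd.A_ne_top))
    (ENNReal.mul_ne_top hK₁ hK₂), fun F hF => ?_⟩
  set N : X → ℝ≥0∞ := ballMax τ (a + b) F with hN
  have hNm : Measurable N := measurable_ballMax _ _ _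
  set G : X → ℝ≥0∞ := fun x => (v x)⁻¹ * N x ^ k with hG
  have hGm : AEMeasurable G μ := hd.left_meas.inv.mul (hNm.pow_const k).aemeasurable
  -- The k-th power of a fractional mean over B is at most A^(1/a) v(B)⁻¹ μ(B) (Z/σ(B)^(a+b))^k, and
  -- Z/σ(B)^(a+b) ≤ N at every point of B. This is a mean of v⁻¹N^k for the measure v dμ. The
  -- operator is thus dominated by a maximal function for v dμ composed with one for σ dμ, both
  -- bounded because these measures are doubling.
  have hpt : ∀ x, ballMax μ (a + b) (fun y => σ y * F y) x ≤
      (A ^ (1 / a) * ballMax ν 1 G x) ^ (1 / k) := by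
    intro x
    refine ballMax_le _ _ _ fun c r hx => ?_
    rw [one_div k, ENNReal.le_rpow_inv_iff hk0]
    have hr := pos_of_mem_ball hx
    set Z := ∫⁻ y in ball c r, σ y * F y ∂μ with hZ
    set V := ∫⁻ y in ball c r, v y ∂μ with hV
    set n := ∫⁻ y in ball c r, σ y ∂μ with hn
    set M := μ (ball c r) with hM
    have hV0 : V ≠ 0 := hd.left_pos h hr
    have hVt : V ≠ ∞ := hd.left_fin _ _
    have hn0 : n ≠ 0 := hd.symm.left_pos h hr
    have hnt : n ≠ ∞ := hd.right_fin _ _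
    have hM0 : M ≠ 0 := h.ne_zero hr
    have hMt : M ≠ ∞ := h.ne_top
    have hνB : ν (ball c r) = V := withDensity_apply _ measurableSet_ball
    have hτB : τ (ball c r) = n := withDensity_apply _ measurableSet_ball
    have hGB : ∫⁻ y in ball c r, G y ∂ν = ∫⁻ y in ball c r, N y ^ k ∂μ := by
      rw [setLIntegral_withDensity hd.left_meas hGm measurableSet_ball]
      refine lintegral_congr_ae (ae_restrict_of_ae ?_)
      filter_upwards [hd.left_ne_zero, hd.left_ne_top] with y h0 ht
      rw [hG, ← mul_assoc, ENNReal.mul_inv_cancel h0 ht, one_mul]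
    have hZN : ∀ y ∈ ball c r, Z / n ^ (a + b) ≤ N y := by
      intro y hy
      have := le_ballMax τ (a + b) F hy
      rwa [hτB, setLIntegral_withDensity hd.right_meas hF measurableSet_ball] at this
    have hNk : M * (Z / n ^ (a + b)) ^ k ≤ ∫⁻ y in ball c r, N y ^ k ∂μ := by
      rw [mul_comm, ← setLIntegral_const]
      refine setLIntegral_mono' measurableSet_ball fun y hy => ?_
      gcongr
      exact hZN y hy
    have hVn : V * n ^ (b / a) ≤ A ^ (1 / a) * M ^ (1 + b / a) := by
      have h1 := ENNReal.rpow_le_rpow (hd.le c r hr) (show 0 ≤ 1 / a by positivity)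
      rw [ENNReal.mul_rpow_of_nonneg _ _ (by positivity : 0 ≤ 1 / a),
        ENNReal.mul_rpow_of_nonneg _ _ (by positivity : 0 ≤ 1 / a), ← ENNReal.rpow_mul,
        ← ENNReal.rpow_mul, ← ENNReal.rpow_mul, mul_one_div_cancel ha0.ne', ENNReal.rpow_one,
        mul_one_div, show (a + b) * (1 / a) = 1 + b / a by field_simp] at h1
      exact h1
    have habk : (a + b) * k = b / a := by rw [hk]; field_simp
    have hdivk : ∀ m : ℝ≥0∞, (Z / m ^ (a + b)) ^ k = Z ^ k * m ^ (-(b / a)) := fun m => by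
      rw [div_eq_mul_inv, ENNReal.mul_rpow_of_nonneg _ _ hk0.le, ENNReal.inv_rpow,
        ← ENNReal.rpow_mul, habk, ENNReal.rpow_neg]
    have hmain : (Z / M ^ (a + b)) ^ k * V ≤ A ^ (1 / a) * ∫⁻ y in ball c r, N y ^ k ∂μ := by
      calc (Z / M ^ (a + b)) ^ k * V
          = Z ^ k * M ^ (-(b / a)) * (V * n ^ (b / a)) * n ^ (-(b / a)) := by
            rw [hdivk, show V * n ^ (b / a) = n ^ (b / a) * V by ring]
            have : n ^ (b / a) * n ^ (-(b / a)) = 1 := by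
              rw [← ENNReal.rpow_add _ _ hn0 hnt, add_neg_cancel, ENNReal.rpow_zero]
            calc _ = Z ^ k * M ^ (-(b / a)) * V * (n ^ (b / a) * n ^ (-(b / a))) := by
                  rw [this, mul_one]
              _ = _ := by ring
        _ ≤ Z ^ k * M ^ (-(b / a)) * (A ^ (1 / a) * M ^ (1 + b / a)) * n ^ (-(b / a)) := by
            gcongr
        _ = A ^ (1 / a) * ((M ^ (-(b / a)) * M ^ (1 + b / a)) * (Z ^ k * n ^ (-(b / a)))) := by
            ring
        _ = A ^ (1 / a) * (M * (Z / n ^ (a + b)) ^ k) := by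
            rw [hdivk, ← ENNReal.rpow_add _ _ hM0 hMt, show -(b / a) + (1 + b / a) = 1 by ring,
              ENNReal.rpow_one]
        _ ≤ _ := by gcongr
    have hle : (∫⁻ y in ball c r, G y ∂ν) / ν (ball c r) ^ (1 : ℝ) ≤ ballMax ν 1 G x :=
      le_ballMax ν 1 G hx
    rw [hνB, hGB, ENNReal.rpow_one] at hle
    calc (Z / M ^ (a + b)) ^ k ≤ (A ^ (1 / a) * ∫⁻ y in ball c r, N y ^ k ∂μ) / V := by
          rwa [ENNReal.le_div_iff_mul_le (Or.inl hV0) (Or.inl hVt)]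
      _ = A ^ (1 / a) * ((∫⁻ y in ball c r, N y ^ k ∂μ) / V) := mul_div_assoc _ _ _
      _ ≤ _ := by gcongr
  have hMm : Measurable (ballMax ν 1 G) := measurable_ballMax _ _ _
  have hs0 : 0 ≤ s := by linarith
  calc ∫⁻ x, ballMax μ (a + b) (fun y => σ y * F y) x ^ q * v x ∂μ
      ≤ ∫⁻ x, v x * ((A ^ (1 / a)) ^ s * ballMax ν 1 G x ^ s) ∂μ := by
        refine lintegral_mono fun x => ?_
        rw [mul_comm]
        gcongr
        calc _ ≤ ((A ^ (1 / a) * ballMax ν 1 G x) ^ (1 / k)) ^ q := by gcongr; exact hpt x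
          _ = _ := by
            rw [← ENNReal.rpow_mul, show 1 / k * q = s by rw [hkq]; field_simp,
              ENNReal.mul_rpow_of_nonneg _ _ hs0]
    _ = ∫⁻ x, (A ^ (1 / a)) ^ s * ballMax ν 1 G x ^ s ∂ν := by
        rw [lintegral_withDensity_eq_lintegral_mul₀ hd.left_meas
          ((hMm.pow_const s).const_mul _).aemeasurable]
        rfl
    _ = (A ^ (1 / a)) ^ s * ∫⁻ x, ballMax ν 1 G x ^ s ∂ν :=
        lintegral_const_mul _ (hMm.pow_const s)
    _ ≤ (A ^ (1 / a)) ^ s * (K₁ * ∫⁻ x, G x ^ s ∂ν) := by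
        gcongr
        exact H₁ G (hGm.mono_ac hνac)
    _ = (A ^ (1 / a)) ^ s * (K₁ * ∫⁻ x, N x ^ q ∂τ) := by
        congr 2
        rw [lintegral_withDensity_eq_lintegral_mul₀ hd.left_meas (hGm.pow_const s),
          lintegral_withDensity_eq_lintegral_mul₀ hd.right_meas (hNm.pow_const q).aemeasurable]
        refine lintegral_congr_ae ?_
        filter_upwards [hd.left_ne_zero, hd.left_ne_top, hd.right_eq] with x h0 ht hx
        simp only [Pi.mul_apply, hG]
        rw [hx, ENNReal.mul_rpow_of_nonneg _ _ hs0, ← ENNReal.rpow_mul, ← hkq, ENNReal.inv_rpow,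
          ← mul_assoc, ← ENNReal.rpow_neg]
        congr 1
        nth_rewrite 1 [← ENNReal.rpow_one (v x)]
        rw [← ENNReal.rpow_add _ _ h0 ht]
        congr 1
        rw [hs]
        field_simp
        ring
    _ ≤ (A ^ (1 / a)) ^ s * (K₁ * (K₂ * (∫⁻ x, F x ^ p ∂τ) ^ (q / p))) := by
        gcongr
        exact H₂ F (hF.mono_ac hτac)
    _ = _ := by
        rw [lintegral_withDensity_eq_lintegral_mul₀ hd.right_meas (hF.pow_const p)]
        simp only [Pi.mul_apply, mul_comm (σ _)]
        ring

end FractionalMaximal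

/-! ### Morrey space bounds for the conjugated fractional maximal function. -/

section Morrey

variable {X : Type*} [MetricSpace X] [MeasurableSpace X]
  {μ : Measure X} {C : ℝ≥0} {v σ u : X → ℝ≥0∞} {φ : X → ℝ}
  {a b p q s l : ℝ} {A A' A'' : ℝ≥0∞}

lemma lintegral_expWeight_interpolation {X : Type*} [MeasurableSpace X] {μ : Measure X}
    {w : X → ℝ≥0∞} {φ : X → ℝ} {l s : ℝ} (hw : AEMeasurable w μ)
    (hφ : AEMeasurable φ μ) (hl0 : 0 ≤ l) (hl1 : l ≤ 1) (S : Set X) :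
    ∫⁻ y in S, w y * expWeight ((1 - l) * s) φ y ∂μ ≤
      (∫⁻ y in S, w y ∂μ) ^ l * (∫⁻ y in S, w y * expWeight s φ y ∂μ) ^ (1 - l) := by
  refine le_trans (le_of_eq ?_) (ENNReal.lintegral_mul_norm_pow_le (μ := μ.restrict S) hw.restrict
    (hw.mul (aemeasurable_expWeight hφ)).restrict hl0 (by linarith) (by ring))
  refine lintegral_congr fun y => ?_
  simp only [Pi.mul_apply]
  rw [ENNReal.mul_rpow_of_nonneg _ _ (by linarith : 0 ≤ 1 - l), expWeight_rpow, ← mul_assoc,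
    ← ENNReal.rpow_add_of_nonneg _ _ hl0 (by linarith), add_sub_cancel, ENNReal.rpow_one, mul_comm s]

/-- Comparison of the masses of concentric balls for a dual pair and its perturbations. -/
lemma IsDualPair.exists_ratio_le (h : IsDoubling μ C) (hφ : AEMeasurable φ μ)
    (hd : IsDualPair μ a b A v σ)
    (hs : IsDualPair μ a b A' (fun x => v x * expWeight (s / a) φ x)
      (fun x => σ x * expWeight (-s / b) φ x))
    (hl0 : 0 < l) (hl1 : l < 1)
    (ht : IsDualPair μ a b A'' (fun x => v x * expWeight ((1 - l) * s / a) φ x)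
      (fun x => σ x * expWeight (-((1 - l) * s) / b) φ x)) :
    ∃ K : ℝ≥0∞, K ≠ ∞ ∧ ∀ x r R, 0 < r → r ≤ R →
      (∫⁻ y in ball x r, v y * expWeight ((1 - l) * s / a) φ y ∂μ) *
        (∫⁻ y in ball x R, v y ∂μ) ^ l ≤
      K * ((∫⁻ y in ball x R, v y * expWeight ((1 - l) * s / a) φ y ∂μ) *
        (∫⁻ y in ball x r, v y ∂μ) ^ l) := by
  have ha := hd.a_pos
  have hb := hd.b_pos
  have hl2 : 0 < 1 - l := by linarith
  refine ⟨(A ^ l * A' ^ (1 - l)) ^ a⁻¹, ENNReal.rpow_ne_top_of_nonneg (by positivity)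
    (ENNReal.mul_ne_top (ENNReal.rpow_ne_top_of_nonneg hl0.le hd.A_ne_top)
      (ENNReal.rpow_ne_top_of_nonneg hl2.le hs.A_ne_top)), fun x r R hr hrR => ?_⟩
  have hR : 0 < R := hr.trans_le hrR
  have e1 : (1 - l) * s / a = (1 - l) * (s / a) := by ring
  have e2 : -((1 - l) * s) / b = (1 - l) * (-s / b) := by ring
  have i1 := lintegral_expWeight_interpolation (s := s / a) hd.left_meas hφ hl0.le hl1.le (ball x r)
  have i2 := lintegral_expWeight_interpolation (s := -s / b) hd.right_meas hφ hl0.le hl1.le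
    (ball x R)
  have m1 := ht.measure_rpow_le (ball x R)
  have d0 := hd.le x R hR
  have d1 := hs.le x R hR
  simp only [e2] at m1
  rw [e1] at m1 ⊢
  have mono : ∫⁻ y in ball x r, v y * expWeight (s / a) φ y ∂μ ≤
      ∫⁻ y in ball x R, v y * expWeight (s / a) φ y ∂μ := lintegral_mono_set (ball_subset_ball hrR)
  have p1 := hd.symm.left_pos h (x := x) hR
  have p2 := hs.symm.left_pos h (x := x) hR
  have f1 := hd.right_fin x R
  have f2 := hs.right_fin x R
  set V := ∫⁻ y in ball x R, v y ∂μ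
  set S := ∫⁻ y in ball x R, σ y ∂μ
  set Vs := ∫⁻ y in ball x R, v y * expWeight (s / a) φ y ∂μ
  set Ss := ∫⁻ y in ball x R, σ y * expWeight (-s / b) φ y ∂μ
  set Vt := ∫⁻ y in ball x R, v y * expWeight ((1 - l) * (s / a)) φ y ∂μ
  set St := ∫⁻ y in ball x R, σ y * expWeight ((1 - l) * (-s / b)) φ y ∂μ
  set M := μ (ball x R)
  set T := (S ^ l * Ss ^ (1 - l)) ^ b with hT
  have hT0 : T ≠ 0 := (ENNReal.rpow_pos (ENNReal.mul_pos (ENNReal.rpow_pos p1.bot_lt f1).ne'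
    (ENNReal.rpow_pos p2.bot_lt f2).ne') (ENNReal.mul_ne_top
      (ENNReal.rpow_ne_top_of_nonneg hl0.le f1) (ENNReal.rpow_ne_top_of_nonneg hl2.le f2))).ne'
  have hTt : T ≠ ∞ := ENNReal.rpow_ne_top_of_nonneg hb.le (ENNReal.mul_ne_top
      (ENNReal.rpow_ne_top_of_nonneg hl0.le f1) (ENNReal.rpow_ne_top_of_nonneg hl2.le f2))
  -- This reverses the Hölder interpolation on the large ball. After multiplication by T the left
  -- side is bounded through the two outer dual conditions, the resulting μ(B)^(a+b) through the
  -- lower condition for the intermediate pair, and its σ-mass again by interpolation, which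
  -- produces T.
  have hlow : (V ^ l * Vs ^ (1 - l)) ^ a ≤ (A ^ l * A' ^ (1 - l)) * Vt ^ a := by
    refine (ENNReal.mul_le_mul_iff_left hT0 hTt).1 ?_
    have comm : ∀ (x : ℝ≥0∞) (y z : ℝ), (x ^ y) ^ z = (x ^ z) ^ y := fun x y z => by
      rw [← ENNReal.rpow_mul, ← ENNReal.rpow_mul, mul_comm]
    calc (V ^ l * Vs ^ (1 - l)) ^ a * T = (V ^ a * S ^ b) ^ l * (Vs ^ a * Ss ^ b) ^ (1 - l) := by
          rw [hT]
          simp only [ENNReal.mul_rpow_of_nonneg _ _ ha.le, ENNReal.mul_rpow_of_nonneg _ _ hb.le,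
            ENNReal.mul_rpow_of_nonneg _ _ hl0.le, ENNReal.mul_rpow_of_nonneg _ _ hl2.le]
          rw [comm V, comm S, comm Vs, comm Ss]
          ring
      _ ≤ (A * M ^ (a + b)) ^ l * (A' * M ^ (a + b)) ^ (1 - l) := by gcongr
      _ = A ^ l * A' ^ (1 - l) * M ^ (a + b) := by
          rw [ENNReal.mul_rpow_of_nonneg _ _ hl0.le, ENNReal.mul_rpow_of_nonneg _ _ hl2.le]
          have : (M ^ (a + b)) ^ l * (M ^ (a + b)) ^ (1 - l) = M ^ (a + b) := by
            rw [← ENNReal.rpow_add_of_nonneg _ _ hl0.le hl2.le, add_sub_cancel, ENNReal.rpow_one]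
          calc _ = A ^ l * A' ^ (1 - l) * ((M ^ (a + b)) ^ l * (M ^ (a + b)) ^ (1 - l)) := by ring
            _ = _ := by rw [this]
      _ ≤ A ^ l * A' ^ (1 - l) * (Vt ^ a * St ^ b) := by gcongr
      _ ≤ A ^ l * A' ^ (1 - l) * (Vt ^ a * T) := by rw [hT]; gcongr
      _ = _ := by ring
  have hlow' : V ^ l * Vs ^ (1 - l) ≤ (A ^ l * A' ^ (1 - l)) ^ a⁻¹ * Vt := by
    have := ENNReal.rpow_le_rpow hlow (inv_pos.2 ha).le
    rwa [← ENNReal.rpow_mul, mul_inv_cancel₀ ha.ne', ENNReal.rpow_one,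
      ENNReal.mul_rpow_of_nonneg _ _ (inv_pos.2 ha).le, ← ENNReal.rpow_mul, mul_inv_cancel₀ ha.ne',
      ENNReal.rpow_one] at this
  set V0 := ∫⁻ y in ball x r, v y ∂μ
  -- Interpolation on the small ball gives V0^l times the (1-l)-th power of a mass that is enlarged
  -- to the big ball. Only the factor with exponent l keeps the small ball, hence the exponent l in
  -- the ratio.
  calc _ ≤ V0 ^ l * (∫⁻ y in ball x r, v y * expWeight (s / a) φ y ∂μ) ^ (1 - l) * V ^ l := by
        gcongr
    _ ≤ V0 ^ l * Vs ^ (1 - l) * V ^ l := by gcongr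
    _ = V0 ^ l * (V ^ l * Vs ^ (1 - l)) := by ring
    _ ≤ V0 ^ l * ((A ^ l * A' ^ (1 - l)) ^ a⁻¹ * Vt) := by gcongr
    _ = _ := by ring

/-- Localization of the fractional maximal function: outside the double of a ball only the averages
over larger concentric balls matter. -/
lemma IsDoubling.ballMax_le_max [BorelSpace X] (h : IsDoubling μ C) {e : ℝ} (he : 0 ≤ e) (g : X → ℝ≥0∞)
    {x₀ x : X} {r : ℝ} (hx : x ∈ ball x₀ r) {S : ℝ≥0∞}
    (hS : ∀ R, r ≤ R → (∫⁻ y in ball x₀ R, g y ∂μ) / μ (ball x₀ R) ^ e ≤ S) :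
    ballMax μ e g x ≤
      max (ballMax μ e ((ball x₀ (2 * r)).indicator g) x) (((C : ℝ≥0∞) ^ 3) ^ e * S) := by
  refine ballMax_le _ _ _ fun c s hxs => ?_
  have hs := pos_of_mem_ball hxs
  by_cases hsub : ball c s ⊆ ball x₀ (2 * r)
  · refine le_trans ?_ ((le_ballMax μ e _ hxs).trans (le_max_left _ _))
    gcongr 1
    refine le_of_eq (setLIntegral_congr_fun measurableSet_ball fun y hy => ?_)
    rw [indicator_of_mem (hsub hy)]
  · refine le_trans ?_ (le_max_right _ _)
    obtain ⟨z, hz, hz2⟩ := not_subset.1 hsub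
    rw [mem_ball] at hx hxs hz hz2
    push Not at hz2
    have h1 : dist z x₀ ≤ dist z c + dist c x + dist x x₀ := dist_triangle4 _ _ _ _
    rw [dist_comm c x] at h1
    -- A ball through x that leaves the double ball has radius above r/2, so it lies in the
    -- concentric ball of radius 4s ≥ r, whose measure is at most C³ times larger.
    have hrs : r < 2 * s := by linarith
    have hR : r ≤ 4 * s := by linarith
    have hsub2 : ball c s ⊆ ball x₀ (4 * s) := ball_subset_ball' (by
      have := dist_triangle c x x₀
      rw [dist_comm c x] at this
      linarith)
    have hμ : μ (ball x₀ (4 * s)) ≤ (C : ℝ≥0∞) ^ 3 * μ (ball c s) := h.ball_le hs 3 (by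
      have := dist_triangle x₀ x c
      rw [dist_comm x₀ x] at this
      linarith)
    have h0 := h.ne_zero (x := c) hs
    have ht := h.ne_top (x := c) (r := s)
    have h40 := h.ne_zero (x := x₀) (show 0 < 4 * s by linarith)
    have h4t := h.ne_top (x := x₀) (r := 4 * s)
    have hm0 : μ (ball x₀ (4 * s)) ^ e ≠ 0 := (ENNReal.rpow_pos h40.bot_lt h4t).ne'
    have hmt : μ (ball x₀ (4 * s)) ^ e ≠ ∞ := ENNReal.rpow_ne_top_of_nonneg he h4t
    refine ENNReal.div_le_of_le_mul ?_
    calc ∫⁻ y in ball c s, g y ∂μ ≤ ∫⁻ y in ball x₀ (4 * s), g y ∂μ := lintegral_mono_set hsub2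
      _ ≤ S * μ (ball x₀ (4 * s)) ^ e := (ENNReal.div_le_iff hm0 hmt).1 (hS _ hR)
      _ ≤ S * ((C : ℝ≥0∞) ^ 3 * μ (ball c s)) ^ e := by gcongr
      _ = _ := by rw [ENNReal.mul_rpow_of_nonneg _ _ he]; ring

/-- The Morrey space bound for the fractional maximal function conjugated by the exponential of a
function for which the perturbed weights are still dual pairs. -/
lemma IsDualPair.exists_morrey_bound [BorelSpace X] (h : IsDoubling μ C) (hφ : AEMeasurable φ μ)
    (hp : 1 < p) (hpq : p < q) (ha : a = 1 / q) (hb : b = 1 - 1 / p)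
    (hd : IsDualPair μ a b A v σ)
    (hs : IsDualPair μ a b A' (fun x => v x * expWeight (s / a) φ x)
      (fun x => σ x * expWeight (-s / b) φ x))
    (hl0 : 0 < l) (hl1 : l < 1)
    (ht : IsDualPair μ a b A'' (fun x => v x * expWeight ((1 - l) * s / a) φ x)
      (fun x => σ x * expWeight (-((1 - l) * s) / b) φ x))
    (hu : ∀ᵐ x ∂μ, u x = σ x ^ (1 - p)) :
    ∃ K : ℝ≥0∞, K ≠ ∞ ∧ ∀ (f : X → ℝ≥0∞) (N : ℝ≥0∞), AEMeasurable f μ →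
      (∀ x r, 0 < r → ∫⁻ y in ball x r, f y ^ p * u y ∂μ ≤
        (N * (∫⁻ y in ball x r, v y ∂μ) ^ (l / q)) ^ p) →
      ∀ x r, 0 < r → ∫⁻ y in ball x r, (expWeight ((1 - l) * s) φ y *
        ballMax μ (a + b) (fun z => expWeight (-((1 - l) * s)) φ z * f z) y) ^ q * v y ∂μ ≤
        K * (N ^ q * (∫⁻ y in ball x r, v y ∂μ) ^ l) := by
  have ha0 := hd.a_pos
  have hb0 := hd.b_pos
  have hp0 : 0 < p := by linarith
  have hq0 : 0 < q := by linarith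
  have hab0 : 0 < a + b := by linarith
  obtain ⟨D, hD⟩ := hd.exists_left_doubling h
  obtain ⟨K₁, hK₁, hratio⟩ := IsDualPair.exists_ratio_le h hφ hd hs hl0 hl1 ht
  obtain ⟨K₂, hK₂, hnear⟩ := ht.lintegral_ballMax_le h hp hpq ha hb
  set t : ℝ := (1 - l) * s with htdef
  refine ⟨K₂ * (D : ℝ≥0∞) ^ l + (((C : ℝ≥0∞) ^ 3) ^ (a + b)) ^ q * (A'' ^ q * K₁), ?_,
    fun f N hf hN x r hr => ?_⟩
  · refine ENNReal.add_ne_top.2 ⟨ENNReal.mul_ne_top hK₂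
      (ENNReal.rpow_ne_top_of_nonneg hl0.le ENNReal.coe_ne_top), ENNReal.mul_ne_top
      (ENNReal.rpow_ne_top_of_nonneg hq0.le (ENNReal.rpow_ne_top_of_nonneg hab0.le
        (ENNReal.pow_ne_top ENNReal.coe_ne_top))) (ENNReal.mul_ne_top
          (ENNReal.rpow_ne_top_of_nonneg hq0.le ht.A_ne_top) hK₁)⟩
  set vt : X → ℝ≥0∞ := fun x => v x * expWeight (t / a) φ x with hvt
  set σt : X → ℝ≥0∞ := fun x => σ x * expWeight (-t / b) φ x with hσt
  set g : X → ℝ≥0∞ := fun z => expWeight (-t) φ z * f z with hg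
  -- Since 1/a = q, conjugation by the exponential is absorbed into the perturbed weight. The
  -- companion identity below does the same for the p-th powers, using (1-p)(-1/b) = p.
  have hvtq : ∀ y m, (expWeight t φ y * m) ^ q * v y = m ^ q * vt y := by
    intro y m
    rw [ENNReal.mul_rpow_of_nonneg _ _ hq0.le, expWeight_rpow, hvt,
      show t / a = t * q by rw [ha]; field_simp]
    ring
  have hσu : ∀ᵐ y ∂μ, σt y ^ (1 - p) = u y * expWeight (-t) φ y ^ (-p) := by
    filter_upwards [hu, hd.symm.left_ne_zero, hd.symm.left_ne_top] with y hy h0 htop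
    rw [hσt, ENNReal.mul_rpow_of_ne_zero h0 expWeight_ne_zero, hy, expWeight_rpow, expWeight_rpow]
    congr 2
    have : 1 - 1 / p ≠ 0 := by rw [← hb]; exact hb0.ne'
    have h3 : p - 1 ≠ 0 := by linarith
    rw [hb]
    field_simp
    ring
  -- Hölder and the perturbed dual condition bound the mean over the ball of radius R by A''N
  -- v(B_R)^(l/q) / v_t(B_R)^a. After taking q-th powers and multiplying by v_t(B_r), the ratio
  -- estimate removes the dependence on R.
  have far : ∀ R, r ≤ R → (∫⁻ y in ball x R, g y ∂μ) / μ (ball x R) ^ (a + b) ≤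
      ((A'' * N) ^ q * K₁ * (∫⁻ y in ball x r, v y ∂μ) ^ l / ∫⁻ y in ball x r, vt y ∂μ) ^
        q⁻¹ := by
    intro R hrR
    have hR : 0 < R := hr.trans_le hrR
    have hrat := hratio x r R hr hrR
    have hA := ht.le x R hR
    have p1 := ht.left_pos h (x := x) hR
    have f1 := ht.left_fin x R
    have p2 := ht.left_pos h (x := x) hr
    have f2 := ht.left_fin x r
    have h0 := h.ne_zero (x := x) hR
    have htop := h.ne_top (x := x) (r := R)
    have hHolder : ∫⁻ y in ball x R, g y ∂μ ≤
        (∫⁻ y in ball x R, f y ^ p * u y ∂μ) ^ (1 / p) * (∫⁻ y in ball x R, σt y ∂μ) ^ b := by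
      have hum : AEMeasurable u μ := (hd.right_meas.pow_const (1 - p)).congr
        (by filter_upwards [hu] with y hy; rw [hy])
      refine le_trans (le_of_eq ?_) (ENNReal.lintegral_mul_norm_pow_le
        (μ := μ.restrict (ball x R)) ((hf.pow_const p).mul hum).restrict
        ht.right_meas.restrict (by positivity) hb0.le (by rw [hb]; ring))
      refine lintegral_congr_ae (ae_restrict_of_ae ?_)
      filter_upwards [hu, hd.symm.left_ne_zero, hd.symm.left_ne_top] with y hy h0 htop
      simp only [Pi.mul_apply]
      rw [ENNReal.mul_rpow_of_nonneg _ _ (by positivity : 0 ≤ 1 / p), ← ENNReal.rpow_mul,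
        mul_one_div_cancel hp0.ne', ENNReal.rpow_one, hy,
        ENNReal.mul_rpow_of_nonneg _ _ hb0.le, expWeight_rpow, div_mul_cancel₀ _ hb0.ne',
        ← ENNReal.rpow_mul]
      have : σ y ^ ((1 - p) * (1 / p)) * σ y ^ b = 1 := by
        rw [← ENNReal.rpow_add _ _ h0 htop, hb,
          show (1 - p) * (1 / p) + (1 - 1 / p) = 0 by field_simp; ring, ENNReal.rpow_zero]
      calc g y = f y * (σ y ^ ((1 - p) * (1 / p)) * σ y ^ b) * expWeight (-t) φ y := by
            rw [this, mul_one, hg, mul_comm]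
        _ = _ := by ring
    rw [ENNReal.le_rpow_inv_iff hq0, ENNReal.le_div_iff_mul_le (Or.inl p2) (Or.inl f2)]
    set V := ∫⁻ y in ball x R, v y ∂μ
    set Vt := ∫⁻ y in ball x R, vt y ∂μ
    set St := ∫⁻ y in ball x R, σt y ∂μ
    set M := μ (ball x R)
    set V0 := ∫⁻ y in ball x r, v y ∂μ
    set Vt0 := ∫⁻ y in ball x r, vt y ∂μ
    have hMp0 : M ^ (a + b) ≠ 0 := (ENNReal.rpow_pos h0.bot_lt htop).ne'
    have hMpt : M ^ (a + b) ≠ ∞ := ENNReal.rpow_ne_top_of_nonneg hab0.le htop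
    have hVa0 : Vt ^ a ≠ 0 := (ENNReal.rpow_pos p1.bot_lt f1).ne'
    have hVat : Vt ^ a ≠ ∞ := ENNReal.rpow_ne_top_of_nonneg ha0.le f1
    have h1 : (∫⁻ y in ball x R, g y ∂μ) / M ^ (a + b) ≤ A'' * N * V ^ (l / q) / Vt ^ a := by
      refine ENNReal.div_le_of_le_mul ?_
      have hle : ∫⁻ y in ball x R, g y ∂μ ≤ N * V ^ (l / q) * St ^ b := by
        refine hHolder.trans ?_
        gcongr
        have := ENNReal.rpow_le_rpow (hN x R hR) (show 0 ≤ 1 / p by positivity)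
        rwa [← ENNReal.rpow_mul, mul_one_div_cancel hp0.ne', ENNReal.rpow_one] at this
      rw [ENNReal.mul_comm_div, ENNReal.div_eq_inv_mul, ← ENNReal.mul_le_mul_iff_right hVa0 hVat]
      calc Vt ^ a * ∫⁻ y in ball x R, g y ∂μ ≤ Vt ^ a * (N * V ^ (l / q) * St ^ b) := by gcongr
        _ = N * V ^ (l / q) * (Vt ^ a * St ^ b) := by ring
        _ ≤ N * V ^ (l / q) * (A'' * M ^ (a + b)) := by gcongr
        _ = (Vt ^ a * (Vt ^ a)⁻¹) * (N * V ^ (l / q) * (A'' * M ^ (a + b))) := by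
            rw [ENNReal.mul_inv_cancel hVa0 hVat, one_mul]
        _ = _ := by ring
    calc ((∫⁻ y in ball x R, g y ∂μ) / M ^ (a + b)) ^ q * Vt0
        ≤ (A'' * N * V ^ (l / q) / Vt ^ a) ^ q * Vt0 := by gcongr
      _ = (A'' * N) ^ q * Vt⁻¹ * (Vt0 * V ^ l) := by
          rw [div_eq_mul_inv, ENNReal.mul_rpow_of_nonneg _ _ hq0.le,
            ENNReal.mul_rpow_of_nonneg _ _ hq0.le, ENNReal.inv_rpow, ← ENNReal.rpow_mul,
            ← ENNReal.rpow_mul, div_mul_cancel₀ _ hq0.ne', show a * q = 1 by rw [ha]; field_simp,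
            ENNReal.rpow_one]
          ring
      _ ≤ (A'' * N) ^ q * Vt⁻¹ * (K₁ * (Vt * V0 ^ l)) := by gcongr
      _ = (A'' * N) ^ q * K₁ * V0 ^ l * (Vt * Vt⁻¹) := by ring
      _ = _ := by rw [ENNReal.mul_inv_cancel p1 f1, mul_one]
  set S : ℝ≥0∞ := ((A'' * N) ^ q * K₁ * (∫⁻ y in ball x r, v y ∂μ) ^ l /
    ∫⁻ y in ball x r, vt y ∂μ) ^ q⁻¹ with hS
  set g₁ : X → ℝ≥0∞ := (ball x (2 * r)).indicator g with hg₁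
  have hgm : AEMeasurable g μ := (aemeasurable_expWeight hφ).mul hf
  have hg₁m : AEMeasurable g₁ μ := hgm.indicator measurableSet_ball
  -- The two-weight bound is stated for σ_t F, so it is applied to F = σ_t⁻¹ g₁; then F^p σ_t equals
  -- f^p u on the double ball and vanishes outside.
  have near : ∫⁻ y, ballMax μ (a + b) g₁ y ^ q * vt y ∂μ ≤
      K₂ * (N ^ q * (D * ∫⁻ y in ball x r, v y ∂μ) ^ l) := by
    have H := hnear (fun y => (σt y)⁻¹ * g₁ y) (ht.right_meas.inv.mul hg₁m)
    have e1 : (fun y => σt y * ((σt y)⁻¹ * g₁ y)) =ᵐ[μ] g₁ := by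
      filter_upwards [ht.symm.left_ne_zero, ht.symm.left_ne_top] with y h0 htop
      rw [← mul_assoc, ENNReal.mul_inv_cancel h0 htop, one_mul]
    rw [ballMax_congr _ _ e1] at H
    refine H.trans ?_
    gcongr
    have e2 : ∫⁻ y, ((σt y)⁻¹ * g₁ y) ^ p * σt y ∂μ =
        ∫⁻ y in ball x (2 * r), f y ^ p * u y ∂μ := by
      rw [← lintegral_indicator measurableSet_ball]
      refine lintegral_congr_ae ?_
      filter_upwards [hσu, ht.symm.left_ne_zero, ht.symm.left_ne_top] with y hy h0 htop
      by_cases hyB : y ∈ ball x (2 * r)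
      · rw [hg₁, indicator_of_mem hyB, indicator_of_mem hyB, hg,
          ENNReal.mul_rpow_of_nonneg _ _ hp0.le, ENNReal.mul_rpow_of_nonneg _ _ hp0.le,
          ENNReal.inv_rpow, ← ENNReal.rpow_neg]
        have e3 : σt y ^ (-p) * σt y = σt y ^ (1 - p) := by
          nth_rewrite 2 [← ENNReal.rpow_one (σt y)]
          rw [← ENNReal.rpow_add _ _ h0 htop]
          congr 1
          ring
        have e4 : expWeight (-t) φ y ^ (-p) * expWeight (-t) φ y ^ p = 1 := by
          rw [← ENNReal.rpow_add _ _ expWeight_ne_zero expWeight_ne_top, neg_add_cancel,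
            ENNReal.rpow_zero]
        calc _ = (σt y ^ (-p) * σt y) * (expWeight (-t) φ y ^ p * f y ^ p) := by ring
          _ = u y * f y ^ p * (expWeight (-t) φ y ^ (-p) * expWeight (-t) φ y ^ p) := by
              rw [e3, hy]; ring
          _ = _ := by rw [e4, mul_one, mul_comm]
      · rw [hg₁, indicator_of_notMem hyB, indicator_of_notMem hyB, mul_zero,
          ENNReal.zero_rpow_of_pos hp0, zero_mul]
    rw [e2]
    calc _ ≤ ((N * (∫⁻ y in ball x (2 * r), v y ∂μ) ^ (l / q)) ^ p) ^ (q / p) := by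
          gcongr; exact hN x _ (by linarith)
      _ = N ^ q * (∫⁻ y in ball x (2 * r), v y ∂μ) ^ l := by
          rw [← ENNReal.rpow_mul, mul_div_cancel₀ _ hp0.ne', ENNReal.mul_rpow_of_nonneg _ _ hq0.le,
            ← ENNReal.rpow_mul, div_mul_cancel₀ _ hq0.ne']
      _ ≤ _ := by gcongr; exact hD x r hr
  set V0 := ∫⁻ y in ball x r, v y ∂μ
  set Vt0 := ∫⁻ y in ball x r, vt y ∂μ with hVt0
  have p2 : Vt0 ≠ 0 := ht.left_pos h (x := x) hr
  have f2 : Vt0 ≠ ∞ := ht.left_fin x r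
  set c : ℝ≥0∞ := ((C : ℝ≥0∞) ^ 3) ^ (a + b) with hc
  have hSq : S ^ q = (A'' * N) ^ q * K₁ * V0 ^ l / Vt0 := by
    rw [hS, ← ENNReal.rpow_mul, inv_mul_cancel₀ hq0.ne', ENNReal.rpow_one]
  have hm : AEMeasurable (fun y => ballMax μ (a + b) g₁ y ^ q * vt y)
      (μ.restrict (ball x r)) :=
    (((measurable_ballMax _ _ _).pow_const q).aemeasurable.mul ht.left_meas).restrict
  calc ∫⁻ y in ball x r, (expWeight t φ y * ballMax μ (a + b) g y) ^ q * v y ∂μ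
      ≤ ∫⁻ y in ball x r, (ballMax μ (a + b) g₁ y ^ q * vt y + (c * S) ^ q * vt y) ∂μ := by
        refine setLIntegral_mono' measurableSet_ball fun y hy => ?_
        rw [hvtq, ← add_mul]
        gcongr
        calc _ ≤ (max (ballMax μ (a + b) g₁ y) (c * S)) ^ q := by
              gcongr; exact h.ballMax_le_max hab0.le g hy far
          _ ≤ _ := by
              rcases le_total (ballMax μ (a + b) g₁ y) (c * S) with hc | hc
              · rw [max_eq_right hc]; exact le_add_self
              · rw [max_eq_left hc]; exact le_self_add
    _ = ∫⁻ y in ball x r, ballMax μ (a + b) g₁ y ^ q * vt y ∂μ + (c * S) ^ q * Vt0 := by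
        rw [lintegral_add_left' hm, lintegral_const_mul'' _ ht.left_meas.restrict]
    _ ≤ K₂ * (N ^ q * (D * V0) ^ l) + (c * S) ^ q * Vt0 := by
        gcongr
        exact (setLIntegral_le_lintegral _ _).trans near
    _ = K₂ * (N ^ q * (D ^ l * V0 ^ l)) + c ^ q * ((A'' * N) ^ q * K₁ * V0 ^ l / Vt0 * Vt0) := by
        rw [ENNReal.mul_rpow_of_nonneg _ _ hl0.le, ENNReal.mul_rpow_of_nonneg c S hq0.le, hSq,
          mul_assoc (c ^ q)]
    _ = _ := by
        rw [ENNReal.div_mul_cancel p2 f2, ENNReal.mul_rpow_of_nonneg _ _ hq0.le]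
        ring

end Morrey

/-! ### From the quasi-metric to a metric. -/

section Metrization

variable {X : Type*} {d : X → X → ℝ}

/-- Metrization: a power of a quasi-metric is comparable with a metric. -/
lemma exists_metricSpace_of_isQuasiMetric (hd : IsQuasiMetric d) :
    ∃ (α : ℝ) (m : MetricSpace X), 0 < α ∧
      (∀ x y, m.dist x y ≤ d x y ^ α) ∧ ∀ x y, d x y ^ α ≤ 2 * m.dist x y := by
  obtain ⟨A, hA, htri⟩ := hd.quasi_triangle
  have hA3 : 1 < 3 * A ^ 2 := by nlinarith
  -- Two uses of the quasi-triangle inequality along x₁, x₂, x₃, x₄ cost 3A². The power α turns this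
  -- into 2, the constant that the chain construction of a metric tolerates.
  set α : ℝ := Real.logb (3 * A ^ 2) 2 with hα
  have hα0 : 0 < α := Real.logb_pos hA3 (by norm_num)
  have hAα : (3 * A ^ 2) ^ α = 2 := Real.rpow_logb (by linarith) hA3.ne' (by norm_num)
  let δ : X → X → ℝ≥0 := fun x y => ⟨d x y ^ α, Real.rpow_nonneg (hd.nonneg x y) α⟩
  have hδ : ∀ x y, (δ x y : ℝ) = d x y ^ α := fun x y => rfl
  have hself : ∀ x, δ x x = 0 := fun x => by
    rw [← NNReal.coe_inj, hδ, (hd.eq_zero_iff x x).2 rfl, Real.zero_rpow hα0.ne', NNReal.coe_zero]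
  have hcomm : ∀ x y, δ x y = δ y x := fun x y => by
    rw [← NNReal.coe_inj, hδ, hδ, hd.symm]
  have hmax : ∀ x₁ x₂ x₃ x₄, δ x₁ x₄ ≤ 2 * max (δ x₁ x₂) (max (δ x₂ x₃) (δ x₃ x₄)) := by
    intro x₁ x₂ x₃ x₄
    set M : ℝ := max (d x₁ x₂) (max (d x₂ x₃) (d x₃ x₄)) with hM
    have m1 : d x₁ x₂ ≤ M := le_max_left _ _
    have m2 : d x₂ x₃ ≤ M := (le_max_left _ _).trans (le_max_right _ _)
    have m3 : d x₃ x₄ ≤ M := (le_max_right _ _).trans (le_max_right _ _)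
    have hM0 : 0 ≤ M := (hd.nonneg _ _).trans m1
    have h1 : d x₁ x₄ ≤ 3 * A ^ 2 * M := by
      have t1 := htri x₁ x₄ x₂
      have t2 := htri x₂ x₄ x₃
      have t3 : A * d x₂ x₄ ≤ A * (A * (M + M)) := by
        refine mul_le_mul_of_nonneg_left (t2.trans ?_) (by linarith)
        exact mul_le_mul_of_nonneg_left (by linarith) (by linarith)
      have t4 : A * d x₁ x₂ ≤ A * M := mul_le_mul_of_nonneg_left m1 (by linarith)
      have t5 : A * M ≤ A ^ 2 * M := mul_le_mul_of_nonneg_right (by nlinarith) hM0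
      nlinarith
    have h2 : d x₁ x₄ ^ α ≤ 2 * M ^ α := by
      rw [← hAα, ← Real.mul_rpow (by positivity) hM0]
      exact Real.rpow_le_rpow (hd.nonneg _ _) h1 hα0.le
    rw [← NNReal.coe_le_coe, NNReal.coe_mul, NNReal.coe_ofNat, hδ]
    refine h2.trans (mul_le_mul_of_nonneg_left ?_ zero_le_two)
    rw [NNReal.coe_max, NNReal.coe_max, hδ, hδ, hδ, hM]
    rcases max_choice (d x₁ x₂) (max (d x₂ x₃) (d x₃ x₄)) with h | h
    · rw [h]; exact le_max_left _ _
    · rw [h]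
      refine le_trans ?_ (le_max_right _ _)
      rcases max_choice (d x₂ x₃) (d x₃ x₄) with h' | h'
      · rw [h']; exact le_max_left _ _
      · rw [h']; exact le_max_right _ _
  let P : PseudoMetricSpace X := PseudoMetricSpace.ofPreNNDist δ hself hcomm
  have hle : ∀ x y, P.dist x y ≤ d x y ^ α := fun x y =>
    PseudoMetricSpace.dist_ofPreNNDist_le δ hself hcomm x y
  have hge : ∀ x y, d x y ^ α ≤ 2 * P.dist x y := fun x y =>
    PseudoMetricSpace.le_two_mul_dist_ofPreNNDist δ hself hcomm hmax x y
  refine ⟨α, { P with eq_of_dist_eq_zero := fun {x y} h => ?_ }, hα0, hle, hge⟩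
  have h0 : P.dist x y = 0 := h
  have h1 := hge x y
  rw [h0, mul_zero] at h1
  refine (hd.eq_zero_iff x y).1 ?_
  by_contra hne
  exact absurd h1 (not_le.2 (Real.rpow_pos_of_pos ((hd.nonneg x y).lt_of_ne' hne) α))

/-- The quasi-metric balls of `d` are comparable with the balls of the metric of `X`. -/
structure HasComparableBalls [MetricSpace X] (d : X → X → ℝ) : Prop where
  inner : ∀ B ∈ balls d, ∃ x s, 0 < s ∧ ball x s ⊆ B ∧ B ⊆ ball x (2 * s)
  outer : ∀ x s, 0 < s → ∃ B ∈ balls d, ball x s ⊆ B ∧ B ⊆ ball x (2 * s)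

variable [MetricSpace X] {α : ℝ}

lemma ball_subset_qBall (hd : ∀ x y, 0 ≤ d x y) (hα : 0 < α)
    (hge : ∀ x y, d x y ^ α ≤ 2 * dist x y) (x : X) {r : ℝ} (hr : 0 < r) :
    ball x (r ^ α / 2) ⊆ qBall d x r := by
  intro y hy
  rw [mem_ball'] at hy
  refine (Real.rpow_lt_rpow_iff (hd x y) hr.le hα).1 ?_
  linarith [hge x y]

lemma qBall_subset_ball (hd : ∀ x y, 0 ≤ d x y) (hα : 0 < α)
    (hle : ∀ x y, dist x y ≤ d x y ^ α) (x : X) (r : ℝ) : qBall d x r ⊆ ball x (r ^ α) := by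
  intro y hy
  rw [mem_ball']
  exact (hle x y).trans_lt (Real.rpow_lt_rpow (hd x y) hy hα)

lemma hasComparableBalls (hd : ∀ x y, 0 ≤ d x y) (hα : 0 < α)
    (hle : ∀ x y, dist x y ≤ d x y ^ α) (hge : ∀ x y, d x y ^ α ≤ 2 * dist x y) :
    HasComparableBalls d where
  inner := by
    rintro B ⟨x, r, hr, rfl⟩
    refine ⟨x, r ^ α / 2, by positivity, ball_subset_qBall hd hα hge x hr, ?_⟩
    rw [mul_div_cancel₀ _ (two_ne_zero)]
    exact qBall_subset_ball hd hα hle x r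
  outer := by
    intro x s hs
    have h1 : ((2 * s) ^ α⁻¹) ^ α = 2 * s := by
      rw [← Real.rpow_mul (by positivity), inv_mul_cancel₀ hα.ne', Real.rpow_one]
    have h2 := ball_subset_qBall hd hα hge x (r := (2 * s) ^ α⁻¹) (by positivity)
    have h3 := qBall_subset_ball hd hα hle x ((2 * s) ^ α⁻¹)
    rw [h1] at h2 h3
    rw [mul_div_cancel_left₀ _ (two_ne_zero)] at h2
    exact ⟨_, ⟨x, _, by positivity, rfl⟩, h2, h3⟩

lemma quasiTopology_eq (hd : ∀ x y, 0 ≤ d x y) (hα : 0 < α)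
    (hle : ∀ x y, dist x y ≤ d x y ^ α) (hge : ∀ x y, d x y ^ α ≤ 2 * dist x y) :
    quasiTopology d = (inferInstance : TopologicalSpace X) := by
  refine TopologicalSpace.ext_iff.2 fun s => ?_
  rw [Metric.isOpen_iff]
  refine forall₂_congr fun x _ => ⟨?_, ?_⟩
  · rintro ⟨r, hr, hs⟩
    exact ⟨r ^ α / 2, by positivity, (ball_subset_qBall hd hα hge x hr).trans hs⟩
  · rintro ⟨r, hr, hs⟩
    refine ⟨r ^ α⁻¹, by positivity, (qBall_subset_ball hd hα hle x _).trans ?_⟩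
    rwa [← Real.rpow_mul hr.le, inv_mul_cancel₀ hα.ne', Real.rpow_one]

/-- Balls have positive mass because a null ball would, by iterated doubling, make the whole space
null. Metric doubling is a fixed number n of quasi-metric doublings, because the balls are
comparable after taking powers. -/
lemma exists_isDoubling [MeasurableSpace X] {μ : Measure X} (hX : IsHomogeneousType d μ)
    (hα : 0 < α) (hle : ∀ x y, dist x y ≤ d x y ^ α) (hge : ∀ x y, d x y ^ α ≤ 2 * dist x y) :
    ∃ C : ℝ≥0, IsDoubling μ C := by
  obtain ⟨C, hC⟩ := hX.doubling
  have hd := hX.quasiMetric.nonneg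
  have hpow : ∀ x r, 0 < r → ∀ n : ℕ,
      μ (qBall d x (2 ^ n * r)) ≤ (C : ℝ≥0∞) ^ n * μ (qBall d x r) := by
    intro x r hr n
    induction n with
    | zero => simp
    | succ n ih =>
      calc μ (qBall d x (2 ^ (n + 1) * r)) = μ (qBall d x (2 * (2 ^ n * r))) := by
            congr 2; ring
        _ ≤ C * μ (qBall d x (2 ^ n * r)) := (hC _ _ (by positivity)).1
        _ ≤ C * ((C : ℝ≥0∞) ^ n * μ (qBall d x r)) := by gcongr
        _ = _ := by rw [pow_succ]; ring
  have hpos : ∀ x r, 0 < r → μ (qBall d x r) ≠ 0 := by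
    intro x r hr h0
    refine hX.ne_zero (Measure.measure_univ_eq_zero.1 (measure_mono_null (t := ⋃ n : ℕ,
      qBall d x (2 ^ n * r)) (fun y _ => ?_) (measure_iUnion_null fun n => ?_)))
    · obtain ⟨n, hn⟩ := pow_unbounded_of_one_lt (d x y / r) one_lt_two
      exact mem_iUnion.2 ⟨n, (div_lt_iff₀ hr).1 hn⟩
    · have := hpow x r hr n
      rwa [h0, mul_zero, nonpos_iff_eq_zero] at this
  -- The 4 is the product of the dilation factor 2 and the comparison factor 2; its power 1/α
  -- converts to quasi-metric radii.
  obtain ⟨n, hn⟩ := pow_unbounded_of_one_lt ((4 : ℝ) ^ α⁻¹) one_lt_two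
  have hsub : ∀ x r, 0 < r → ball x (2 * r) ⊆ qBall d x (2 ^ n * r ^ α⁻¹) := by
    intro x r hr
    refine (ball_subset_ball ?_).trans (ball_subset_qBall hd hα hge x (by positivity))
    rw [Real.mul_rpow (by positivity) (by positivity), ← Real.rpow_mul hr.le,
      inv_mul_cancel₀ hα.ne', Real.rpow_one]
    have h4 : (4 : ℝ) ≤ (2 ^ n) ^ α := by
      have := Real.rpow_le_rpow (by positivity) hn.le hα.le
      rwa [← Real.rpow_mul (by norm_num), inv_mul_cancel₀ hα.ne', Real.rpow_one] at this
    nlinarith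
  have hsub2 : ∀ x r, 0 < r → qBall d x (r ^ α⁻¹) ⊆ ball x r := by
    intro x r hr
    have := qBall_subset_ball hd hα hle x (r ^ α⁻¹)
    rwa [← Real.rpow_mul hr.le, inv_mul_cancel₀ hα.ne', Real.rpow_one] at this
  have hfin : ∀ x r, 0 < r → μ (qBall d x r) < ∞ := by
    intro x r hr
    have h2 := (hC x (r / 2) (by positivity))
    rw [mul_div_cancel₀ _ two_ne_zero] at h2
    exact h2.1.trans_lt h2.2
  have hdoub : ∀ x r, 0 < r → μ (ball x (2 * r)) ≤ (C : ℝ≥0∞) ^ n * μ (ball x r) := by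
    intro x r hr
    calc μ (ball x (2 * r)) ≤ μ (qBall d x (2 ^ n * r ^ α⁻¹)) := measure_mono (hsub x r hr)
      _ ≤ (C : ℝ≥0∞) ^ n * μ (qBall d x (r ^ α⁻¹)) := hpow x _ (by positivity) n
      _ ≤ _ := by gcongr; exact hsub2 x r hr
  refine ⟨C ^ n, fun x r hr => ?_, fun x r => ?_, fun x r hr => ?_⟩
  · exact (pos_iff_ne_zero.2 (hpos x _ (by positivity))).trans_le (measure_mono (hsub2 x r hr))
  · have hr : 0 < |r| + 1 := by positivity
    refine (measure_mono ?_).trans_lt (hfin x (2 ^ n * (|r| + 1) ^ α⁻¹) (by positivity))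
    exact (ball_subset_ball (by linarith [le_abs_self r])).trans (hsub x _ hr)
  · rw [ENNReal.coe_pow]
    exact hdoub x r hr

end Metrization

/-! ### Transfer between the two families of balls; Muckenhoupt weights as dual pairs. -/

section Comparable

variable {X : Type*} [MetricSpace X] [MeasurableSpace X] {μ : Measure X} {C : ℝ≥0}
  {d : X → X → ℝ}

lemma HasComparableBalls.measure_ne_top (hc : HasComparableBalls d) (h : IsDoubling μ C)
    {B : Set X} (hB : B ∈ balls d) : μ B ≠ ∞ := by
  obtain ⟨x, s, hs, h1, h2⟩ := hc.inner B hB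
  exact ((measure_mono h2).trans_lt (h.lt_top _ _)).ne

lemma HasComparableBalls.measure_ne_zero (hc : HasComparableBalls d) (h : IsDoubling μ C)
    {B : Set X} (hB : B ∈ balls d) : μ B ≠ 0 := by
  obtain ⟨x, s, hs, h1, h2⟩ := hc.inner B hB
  exact ((h.pos x s hs).trans_le (measure_mono h1)).ne'

lemma HasComparableBalls.aemeasurable (hc : HasComparableBalls d) {β : Type*} [MeasurableSpace β]
    {f : X → β} (hf : ∀ B ∈ balls d, AEMeasurable f (μ.restrict B)) : AEMeasurable f μ := by
  rcases isEmpty_or_nonempty X with hX | ⟨⟨x⟩⟩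
  · exact (measurable_of_empty f).aemeasurable
  have h1 : ∀ n : ℕ, AEMeasurable f (μ.restrict (ball x n)) := by
    intro n
    obtain ⟨B, hB, h1, -⟩ := hc.outer x (n + 1) (by positivity)
    exact (hf B hB).mono_set ((ball_subset_ball (by linarith)).trans h1)
  have := aemeasurable_iUnion_iff.2 h1
  rwa [iUnion_ball_nat, Measure.restrict_univ] at this

lemma HasComparableBalls.aemeasurable_of_locIntegrable (hc : HasComparableBalls d) {f : X → ℝ}
    (hf : LocIntegrable d μ f) : AEMeasurable f μ :=
  hc.aemeasurable fun B hB => (hf B hB).aestronglyMeasurable.aemeasurable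

/-- An `A_{p,q}` weight `ω` gives rise to the dual pair `ω ^ q`, `ω ^ (-p')`. -/
lemma exists_isDualPair_of_memApq {p q : ℝ} {ω : X → ℝ} (hc : HasComparableBalls d)
    (h : IsDoubling μ C) (hp : 1 < p) (hq : 0 < q) (hω : MemApq d μ p q ω) :
    ∃ A, IsDualPair μ (1 / q) (1 - 1 / p) A (wpow ω q) (wpow ω (-(p / (p - 1)))) := by
  set a : ℝ := 1 / q with ha
  set b : ℝ := 1 - 1 / p with hb
  have ha0 : 0 < a := by positivity
  have hb0 : 0 < b := by
    rw [hb, sub_pos, div_lt_one (by linarith)]; exact hp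
  have hp1 : p - 1 ≠ 0 := by linarith
  have hpb : 1 / (p / (p - 1)) = b := by rw [hb]; field_simp
  have hbp : -(p / (p - 1)) * b = -1 := by rw [← hpb]; field_simp
  have hωm : AEMeasurable ω μ := hc.aemeasurable_of_locIntegrable hω.1.locIntegrable
  set v := wpow ω q with hv
  set σ := wpow ω (-(p / (p - 1))) with hσ
  have hvm : AEMeasurable v μ := hωm.ennreal_ofReal.pow_const _
  have hσm : AEMeasurable σ μ := hωm.ennreal_ofReal.pow_const _
  set A := apqConst d μ p q ω with hA
  have hAt : A ≠ ∞ := hω.2.ne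
  have hle : ∀ B ∈ balls d, eAverage μ B v ^ a * eAverage μ B σ ^ b ≤ A := by
    intro B hB
    rw [hA, apqConst, hpb]
    exact le_iSup₂ (f := fun B (_ : B ∈ balls d) => eAverage μ B v ^ a * eAverage μ B σ ^ b) B hB
  have hneg : -(p / (p - 1)) < 0 := by
    have : 0 < p / (p - 1) := div_pos (by linarith) (by linarith)
    linarith
  have hv0 : ∀ x, v x = 0 → ω x = 0 := by
    intro x hx
    rw [hv, wpow, ENNReal.rpow_eq_zero_iff_of_pos hq, ENNReal.ofReal_eq_zero] at hx
    exact le_antisymm hx (hω.1.nonneg x)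
  have hσt : ∀ x, σ x ≠ ∞ → ω x ≠ 0 := by
    intro x hx h0
    rw [hσ, wpow, h0, ENNReal.ofReal_zero, ENNReal.zero_rpow_of_neg hneg] at hx
    exact hx rfl
  have hσ0 : ∀ x, σ x ≠ 0 := by
    intro x h0
    rw [hσ, wpow, ENNReal.rpow_eq_zero_iff] at h0
    rcases h0 with h0 | h0
    · linarith [h0.2]
    · exact ENNReal.ofReal_ne_top h0.1
  -- if `σ` is not integrable over some ball, then `ω` vanishes almost everywhere
  have hσfin : ∀ B ∈ balls d, ∫⁻ y in B, σ y ∂μ ≠ ∞ := by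
    intro B₀ hB₀ htop
    refine hω.1.ne_zero ?_
    obtain ⟨x, s, hs, -, h2⟩ := hc.inner B₀ hB₀
    have key : ∀ n : ℕ, ∀ᵐ y ∂(μ.restrict (ball x n)), ω y = 0 := by
      intro n
      obtain ⟨B, hB, h3, -⟩ := hc.outer x (max (2 * s) (n + 1)) (lt_max_of_lt_left (by linarith))
      have hsub : B₀ ⊆ B := h2.trans ((ball_subset_ball (le_max_left _ _)).trans h3)
      have hsub' : ball x n ⊆ B :=
        (ball_subset_ball ((by linarith : (n : ℝ) ≤ n + 1).trans (le_max_right _ _))).trans h3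
      have htop' : ∫⁻ y in B, σ y ∂μ = ∞ := top_le_iff.1 (htop ▸ lintegral_mono_set hsub)
      have hBt := hc.measure_ne_top h hB
      have h4 := hle B hB
      have h5 : eAverage μ B σ ^ b = ∞ := by
        rw [eAverage, htop', ENNReal.top_div_of_ne_top hBt, ENNReal.top_rpow_of_pos hb0]
      have h6 : eAverage μ B v ^ a = 0 := by
        by_contra hne
        rw [h5, ENNReal.mul_top hne] at h4
        exact hAt (top_le_iff.1 h4)
      rw [ENNReal.rpow_eq_zero_iff_of_pos ha0, eAverage, ENNReal.div_eq_zero_iff] at h6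
      have h7 := (lintegral_eq_zero_iff' hvm.restrict).1 (h6.resolve_right hBt)
      filter_upwards [ae_restrict_of_ae_restrict_of_subset hsub' h7] with y hy
      exact hv0 y hy
    have := ae_restrict_iUnion_iff (μ := μ) (fun n : ℕ => ball x n) (fun y => ω y = 0) |>.2 key
    rwa [iUnion_ball_nat, Measure.restrict_univ] at this
  have hσne : ∀ B ∈ balls d, ∫⁻ y in B, σ y ∂μ ≠ 0 := by
    intro B hB h0
    have h1 := (lintegral_eq_zero_iff' hσm.restrict).1 h0
    refine hc.measure_ne_zero h hB ?_
    have h2 : ∀ᵐ y ∂(μ.restrict B), False := by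
      filter_upwards [h1] with y hy using hσ0 y hy
    rw [ae_iff] at h2
    simpa using h2
  -- An infinite v-mass would force the product of means to be infinite, because the σ-mass is
  -- positive: σ vanishes nowhere, ω being finite.
  have hvfin : ∀ B ∈ balls d, ∫⁻ y in B, v y ∂μ ≠ ∞ := by
    intro B hB htop
    have hBt := hc.measure_ne_top h hB
    have h4 := hle B hB
    rw [eAverage, htop, ENNReal.top_div_of_ne_top hBt, ENNReal.top_rpow_of_pos ha0,
      ENNReal.top_mul] at h4
    · exact hAt (top_le_iff.1 h4)
    · rw [Ne, ENNReal.rpow_eq_zero_iff_of_pos hb0, eAverage, ENNReal.div_eq_zero_iff]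
      exact not_or.2 ⟨hσne B hB, hBt⟩
  have hballfin : ∀ g : X → ℝ≥0∞, (∀ B ∈ balls d, ∫⁻ y in B, g y ∂μ ≠ ∞) →
      ∀ x r, ∫⁻ y in ball x r, g y ∂μ ≠ ∞ := by
    intro g hg x r
    obtain ⟨B, hB, h1, -⟩ := hc.outer x (|r| + 1) (by positivity)
    refine ne_top_of_le_ne_top (hg B hB) (lintegral_mono_set ((ball_subset_ball ?_).trans h1))
    linarith [le_abs_self r]
  have hωne : ∀ᵐ x ∂μ, ω x ≠ 0 := by
    rcases isEmpty_or_nonempty X with hX | ⟨⟨x⟩⟩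
    · exact ae_of_all _ fun x => hX.elim x
    have key : ∀ n : ℕ, ∀ᵐ y ∂(μ.restrict (ball x n)), ω y ≠ 0 := fun n => by
      filter_upwards [ae_lt_top' hσm.restrict (hballfin σ hσfin x n)] with y hy
      exact hσt y hy.ne
    have := ae_restrict_iUnion_iff (μ := μ) (fun n : ℕ => ball x n) (fun y => ω y ≠ 0) |>.2 key
    rwa [iUnion_ball_nat, Measure.restrict_univ] at this
  -- The factor C^(a+b) pays for replacing a metric ball by a quasi-metric ball between it and its
  -- double.
  refine ⟨A * (C : ℝ≥0∞) ^ (a + b), ha0, hb0, ENNReal.mul_ne_top hAt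
    (ENNReal.rpow_ne_top_of_nonneg (by linarith) ENNReal.coe_ne_top), hvm, hσm, ?_,
    hballfin v hvfin, hballfin σ hσfin, fun x r hr => ?_⟩
  · filter_upwards [hωne] with x hx
    have h0 : ENNReal.ofReal (ω x) ≠ 0 := by
      rw [Ne, ENNReal.ofReal_eq_zero, not_le]
      exact (hω.1.nonneg x).lt_of_ne' hx
    rw [hv, hσ, wpow, wpow, ← ENNReal.rpow_mul, ← ENNReal.rpow_mul, hbp, ha,
      mul_one_div_cancel hq.ne', ← ENNReal.rpow_add _ _ h0 ENNReal.ofReal_ne_top]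
    norm_num
  · obtain ⟨B, hB, h1, h2⟩ := hc.outer x r hr
    have hB0 := hc.measure_ne_zero h hB
    have hBt := hc.measure_ne_top h hB
    have hab : 0 ≤ a + b := by linarith
    calc (∫⁻ y in ball x r, v y ∂μ) ^ a * (∫⁻ y in ball x r, σ y ∂μ) ^ b
        ≤ (∫⁻ y in B, v y ∂μ) ^ a * (∫⁻ y in B, σ y ∂μ) ^ b := by
          gcongr
      _ = (eAverage μ B v * μ B) ^ a * (eAverage μ B σ * μ B) ^ b := by
          rw [eAverage, eAverage, ENNReal.div_mul_cancel hB0 hBt, ENNReal.div_mul_cancel hB0 hBt]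
      _ = (eAverage μ B v ^ a * eAverage μ B σ ^ b) * μ B ^ (a + b) := by
          rw [ENNReal.mul_rpow_of_nonneg _ _ ha0.le, ENNReal.mul_rpow_of_nonneg _ _ hb0.le,
            ENNReal.rpow_add _ _ hB0 hBt]
          ring
      _ ≤ A * (C * μ (ball x r)) ^ (a + b) := by
          gcongr
          · exact hle B hB
          · exact (measure_mono h2).trans (h.doubling x r hr)
      _ = _ := by rw [ENNReal.mul_rpow_of_nonneg _ _ hab]; ring

end Comparable

/-! ### Morrey norms and maximal functions over quasi-metric balls. -/

section Norm

variable {X : Type*} [MeasurableSpace X] {μ : Measure X} {d : X → X → ℝ} {p κ : ℝ}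
  {u v : X → ℝ≥0∞} {g g' : X → ℝ≥0∞} {N c : ℝ≥0∞} {B : Set X}

lemma lintegral_le_morreyNorm (hp : 0 < p) (hκ : 0 ≤ κ) (hB : B ∈ balls d)
    (h0 : ∫⁻ y in B, v y ∂μ ≠ 0) (ht : ∫⁻ y in B, v y ∂μ ≠ ∞) :
    ∫⁻ y in B, g y ^ p * u y ∂μ ≤
      (morreyNorm d μ p κ u v g * (∫⁻ y in B, v y ∂μ) ^ (κ / p)) ^ p := by
  have h1 : ((∫⁻ y in B, g y ^ p * u y ∂μ) / (∫⁻ y in B, v y ∂μ) ^ κ) ^ (1 / p) ≤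
      morreyNorm d μ p κ u v g :=
    le_iSup₂ (f := fun B (_ : B ∈ balls d) =>
      ((∫⁻ y in B, g y ^ p * u y ∂μ) / (∫⁻ y in B, v y ∂μ) ^ κ) ^ (1 / p)) B hB
  rw [one_div, ENNReal.rpow_inv_le_iff hp, ENNReal.div_le_iff
    (ENNReal.rpow_pos h0.bot_lt ht).ne' (ENNReal.rpow_ne_top_of_nonneg hκ ht)] at h1
  rwa [ENNReal.mul_rpow_of_nonneg _ _ hp.le, ← ENNReal.rpow_mul, div_mul_cancel₀ _ hp.ne']

lemma morreyNorm_le (hp : 0 < p)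
    (h : ∀ B ∈ balls d, ∫⁻ y in B, g y ^ p * u y ∂μ ≤
      (N * (∫⁻ y in B, v y ∂μ) ^ (κ / p)) ^ p) : morreyNorm d μ p κ u v g ≤ N := by
  refine iSup₂_le fun B hB => ?_
  rw [one_div, ENNReal.rpow_inv_le_iff hp]
  refine ENNReal.div_le_of_le_mul ((h B hB).trans_eq ?_)
  rw [ENNReal.mul_rpow_of_nonneg _ _ hp.le, ← ENNReal.rpow_mul, div_mul_cancel₀ _ hp.ne']

lemma morreyNorm_le_const_mul (hp : 0 < p) (hκ : 0 ≤ κ)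
    (hv0 : ∀ B ∈ balls d, ∫⁻ y in B, v y ∂μ ≠ 0) (hvt : ∀ B ∈ balls d, ∫⁻ y in B, v y ∂μ ≠ ∞)
    (hc : c ≠ ∞) (hg : ∀ᵐ x ∂μ, g x ≤ c * g' x) :
    morreyNorm d μ p κ u v g ≤ c * morreyNorm d μ p κ u v g' := by
  refine morreyNorm_le hp fun B hB => ?_
  calc ∫⁻ y in B, g y ^ p * u y ∂μ ≤ ∫⁻ y in B, c ^ p * (g' y ^ p * u y) ∂μ := by
        refine lintegral_mono_ae (ae_restrict_of_ae ?_)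
        filter_upwards [hg] with y hy
        rw [← mul_assoc, ← ENNReal.mul_rpow_of_nonneg _ _ hp.le]
        gcongr
    _ = c ^ p * ∫⁻ y in B, g' y ^ p * u y ∂μ :=
        lintegral_const_mul' _ _ (ENNReal.rpow_ne_top_of_nonneg hp.le hc)
    _ ≤ c ^ p * (morreyNorm d μ p κ u v g' * (∫⁻ y in B, v y ∂μ) ^ (κ / p)) ^ p := by
        gcongr
        exact lintegral_le_morreyNorm hp hκ hB (hv0 B hB) (hvt B hB)
    _ = _ := by rw [← ENNReal.mul_rpow_of_nonneg _ _ hp.le, mul_assoc]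

/-- The maximal function `sup_{B ∋ x} μ(B)^{-e} ∫_B F dμ` over quasi-metric balls. -/
noncomputable def averageSup (d : X → X → ℝ) (μ : Measure X) (e : ℝ) (F : X → ℝ≥0∞) (x : X) :
    ℝ≥0∞ :=
  ⨆ B ∈ {B ∈ balls d | x ∈ B}, (∫⁻ y in B, F y ∂μ) / μ B ^ e

lemma le_averageSup (e : ℝ) (F : X → ℝ≥0∞) {x : X} (hB : B ∈ balls d) (hx : x ∈ B) :
    (∫⁻ y in B, F y ∂μ) / μ B ^ e ≤ averageSup d μ e F x :=
  le_iSup₂ (f := fun B (_ : B ∈ {B ∈ balls d | x ∈ B}) => (∫⁻ y in B, F y ∂μ) / μ B ^ e) B ⟨hB, hx⟩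

lemma averageSup_le {e : ℝ} {F : X → ℝ≥0∞} {x : X}
    (h : ∀ B ∈ balls d, x ∈ B → (∫⁻ y in B, F y ∂μ) / μ B ^ e ≤ N) : averageSup d μ e F x ≤ N :=
  iSup₂_le fun B hB => h B hB.1 hB.2

end Norm

/-- With t = ε(φ(x)-φ(y)), both |t| and 1 are at most e^t + e^(-t). The extra 1 lets the same bound
serve the maximal function of f itself, and the product form separates x from y. -/
lemma enorm_sub_add_one_le {X : Type*} {φ : X → ℝ} {ε : ℝ} (hε : 0 < ε) (x y : X) :
    ‖φ y - φ x‖ₑ + 1 ≤ ENNReal.ofReal (1 / ε + 1) *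
      (expWeight ε φ x * expWeight (-ε) φ y + expWeight (-ε) φ x * expWeight ε φ y) := by
  have key : |φ y - φ x| + 1 ≤ (1 / ε + 1) *
      (Real.exp (ε * φ x) * Real.exp (-ε * φ y) + Real.exp (-ε * φ x) * Real.exp (ε * φ y)) := by
    rw [← Real.exp_add, ← Real.exp_add]
    set t : ℝ := ε * φ x + -ε * φ y with ht
    rw [show -ε * φ x + ε * φ y = -t by rw [ht]; ring]
    have h1 : |φ y - φ x| = 1 / ε * |t| := by
      rw [ht, show ε * φ x + -ε * φ y = ε * -(φ y - φ x) by ring, abs_mul, abs_neg, abs_of_pos hε]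
      field_simp
    have h2 : |t| ≤ Real.exp t + Real.exp (-t) := by
      rcases abs_cases t with h | h <;> rw [h.1]
      · linarith [Real.add_one_le_exp t, Real.exp_pos (-t)]
      · linarith [Real.add_one_le_exp (-t), Real.exp_pos t]
    have h3 : 1 ≤ Real.exp t + Real.exp (-t) := by
      rcases le_total 0 t with h | h
      · linarith [Real.one_le_exp h, Real.exp_pos (-t)]
      · linarith [Real.one_le_exp (neg_nonneg.2 h), Real.exp_pos t]
    have h4 : 1 / ε * |t| ≤ 1 / ε * (Real.exp t + Real.exp (-t)) :=
      mul_le_mul_of_nonneg_left h2 (by positivity)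
    rw [h1]
    linarith
  have := ENNReal.ofReal_le_ofReal key
  rw [ENNReal.ofReal_add (abs_nonneg _) zero_le_one,
    ENNReal.ofReal_mul (p := 1 / ε + 1) (by positivity),
    ENNReal.ofReal_add (p := Real.exp _ * _) (by positivity) (by positivity),
    ENNReal.ofReal_mul (p := Real.exp _) (by positivity),
    ENNReal.ofReal_mul (p := Real.exp _) (by positivity), ENNReal.ofReal_one, ← Real.enorm_eq_ofReal_abs] at this
  exact this

/-! ### The maximal commutator on weighted Morrey spaces. -/

section Bound

variable {X : Type*} [MetricSpace X] [MeasurableSpace X]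
  {μ : Measure X} {C K : ℝ≥0} {v σ u : X → ℝ≥0∞} {φ : X → ℝ} {m : X → ℝ → ℝ} {d : X → X → ℝ}
  {a b p q κ : ℝ} {A : ℝ≥0∞}

lemma HasComparableBalls.averageSup_le_ballMax (hc : HasComparableBalls d) (h : IsDoubling μ C)
    {e : ℝ} (he : 0 ≤ e) (F : X → ℝ≥0∞) (x : X) :
    averageSup d μ e F x ≤ (C : ℝ≥0∞) ^ e * ballMax μ e F x := by
  refine averageSup_le fun B hB hx => ?_
  obtain ⟨z, s, hs, h1, h2⟩ := hc.inner B hB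
  have hB0 := hc.measure_ne_zero h hB
  have hBt := hc.measure_ne_top h hB
  have hb0 := h.ne_zero (x := z) (r := 2 * s) (by linarith)
  have hbt := h.ne_top (x := z) (r := 2 * s)
  refine ENNReal.div_le_of_le_mul ?_
  have h3 := le_ballMax μ e F (h2 hx)
  rw [ENNReal.div_le_iff (ENNReal.rpow_pos hb0.bot_lt hbt).ne'
    (ENNReal.rpow_ne_top_of_nonneg he hbt)] at h3
  calc ∫⁻ y in B, F y ∂μ ≤ ∫⁻ y in ball z (2 * s), F y ∂μ := lintegral_mono_set h2
    _ ≤ ballMax μ e F x * μ (ball z (2 * s)) ^ e := h3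
    _ ≤ ballMax μ e F x * (C * μ B) ^ e := by
        gcongr
        exact (h.doubling z s hs).trans (by gcongr)
    _ = _ := by rw [ENNReal.mul_rpow_of_nonneg _ _ he]; ring

lemma HasComparableBalls.left_ne_zero (hc : HasComparableBalls d) (h : IsDoubling μ C)
    (hd : IsDualPair μ a b A v σ) {B : Set X} (hB : B ∈ balls d) : ∫⁻ y in B, v y ∂μ ≠ 0 := by
  obtain ⟨z, s, hs, h1, -⟩ := hc.inner B hB
  exact ((hd.left_pos h (x := z) hs).bot_lt.trans_le (lintegral_mono_set h1)).ne'

lemma HasComparableBalls.left_ne_top (hc : HasComparableBalls d)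
    (hd : IsDualPair μ a b A v σ) {B : Set X} (hB : B ∈ balls d) : ∫⁻ y in B, v y ∂μ ≠ ∞ := by
  obtain ⟨z, s, hs, -, h2⟩ := hc.inner B hB
  exact ne_top_of_le_ne_top (hd.left_fin z (2 * s)) (lintegral_mono_set h2)

/-- The exponential bound for |φ(y)-φ(x)| + 1 factors into functions of x and of y. The factors in x
leave the integral, and conjugated fractional maximal functions remain. -/
lemma averageSup_add_averageSup_le (hc : HasComparableBalls d) (h : IsDoubling μ C) {e ε : ℝ}
    (he : 0 ≤ e) (hε : 0 < ε) (hφ : AEMeasurable φ μ) {f : X → ℝ≥0∞} (hf : AEMeasurable f μ)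
    (x : X) :
    averageSup d μ e (fun y => ‖φ y - φ x‖ₑ * f y) x + averageSup d μ e f x ≤
      2 * ((C : ℝ≥0∞) ^ e * ENNReal.ofReal (1 / ε + 1)) *
        (expWeight ε φ x * ballMax μ e (fun z => expWeight (-ε) φ z * f z) x +
          expWeight (-ε) φ x * ballMax μ e (fun z => expWeight ε φ z * f z) x) := by
  have key : ∀ F : X → ℝ≥0∞, (∀ y, F y ≤ (‖φ y - φ x‖ₑ + 1) * f y) →
      averageSup d μ e F x ≤ ((C : ℝ≥0∞) ^ e * ENNReal.ofReal (1 / ε + 1)) *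
        (expWeight ε φ x * ballMax μ e (fun z => expWeight (-ε) φ z * f z) x +
          expWeight (-ε) φ x * ballMax μ e (fun z => expWeight ε φ z * f z) x) := by
    intro F hF
    refine (hc.averageSup_le_ballMax h he F x).trans ?_
    rw [mul_assoc]
    gcongr
    refine ballMax_le _ _ _ fun c r hx => ?_
    set c₀ := ENNReal.ofReal (1 / ε + 1)
    have m1 : AEMeasurable (fun y => expWeight ε φ x * (expWeight (-ε) φ y * f y))
        (μ.restrict (ball c r)) :=
      (((aemeasurable_expWeight hφ).mul hf).const_mul _).restrict
    have h1 : ∫⁻ y in ball c r, F y ∂μ ≤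
        c₀ * (expWeight ε φ x * (∫⁻ y in ball c r, expWeight (-ε) φ y * f y ∂μ) +
          expWeight (-ε) φ x * ∫⁻ y in ball c r, expWeight ε φ y * f y ∂μ) := by
      rw [← lintegral_const_mul' _ _ expWeight_ne_top, ← lintegral_const_mul' _ _ expWeight_ne_top,
        ← lintegral_add_left' m1, ← lintegral_const_mul' _ _ ENNReal.ofReal_ne_top]
      refine lintegral_mono fun y => (hF y).trans ?_
      calc _ ≤ (c₀ * (expWeight ε φ x * expWeight (-ε) φ y +
            expWeight (-ε) φ x * expWeight ε φ y)) * f y := by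
              gcongr; exact enorm_sub_add_one_le hε x y
        _ = _ := by ring
    calc (∫⁻ y in ball c r, F y ∂μ) / μ (ball c r) ^ e
        ≤ c₀ * (expWeight ε φ x * (∫⁻ y in ball c r, expWeight (-ε) φ y * f y ∂μ) +
          expWeight (-ε) φ x * ∫⁻ y in ball c r, expWeight ε φ y * f y ∂μ) / μ (ball c r) ^ e := by
            gcongr
      _ = c₀ * (expWeight ε φ x * ((∫⁻ y in ball c r, expWeight (-ε) φ y * f y ∂μ) /
            μ (ball c r) ^ e) + expWeight (-ε) φ x *
              ((∫⁻ y in ball c r, expWeight ε φ y * f y ∂μ) / μ (ball c r) ^ e)) := by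
            simp only [div_eq_mul_inv]; ring
      _ ≤ _ := by
            gcongr
            · exact le_ballMax μ e (fun y => expWeight (-ε) φ y * f y) hx
            · exact le_ballMax μ e (fun y => expWeight ε φ y * f y) hx
  rw [mul_assoc, two_mul]
  gcongr
  · exact key _ fun y => by gcongr; exact le_self_add
  · exact key _ fun y => le_mul_of_one_le_left' le_add_self

/-- The maximal commutator of a function of bounded mean oscillation and the fractional maximal
function are bounded between weighted Morrey spaces. -/
lemma exists_morreyNorm_averageSup_le [BorelSpace X] (hc : HasComparableBalls d)
    (h : IsDoubling μ C) (hφ : AEMeasurable φ μ)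
    (hm : ∀ x r, 0 < r → ∫⁻ y in ball x r, ‖φ y - m x r‖ₑ ∂μ ≤ K * μ (ball x r))
    (hp : 1 < p) (hpq : p < q) (ha : a = 1 / q) (hb : b = 1 - 1 / p)
    (hd : IsDualPair μ a b A v σ) (hκ : 0 < κ) (hκq : κ * q / p < 1)
    (hu : ∀ᵐ x ∂μ, u x = σ x ^ (1 - p)) :
    ∃ K' : ℝ≥0∞, K' ≠ ∞ ∧ ∀ f : X → ℝ≥0∞, AEMeasurable f μ →
      morreyNorm d μ q (κ * q / p) v v (fun x =>
        averageSup d μ (a + b) (fun y => ‖φ y - φ x‖ₑ * f y) x + averageSup d μ (a + b) f x) ≤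
      K' * morreyNorm d μ p κ u v f := by
  have hp0 : 0 < p := by linarith
  have hq0 : 0 < q := by linarith
  have hab : 0 ≤ a + b := by linarith [hd.a_pos, hd.b_pos]
  set l : ℝ := κ * q / p with hl
  have hl0 : 0 < l := by positivity
  have hlq : l / q = κ / p := by rw [hl]; field_simp
  -- Both signs of the exponent occur, and each Morrey bound needs perturbations at ±t and at the
  -- intermediate ±(1-l)t. The latter are no larger, since 0 < l < 1.
  obtain ⟨t, ht0, ht⟩ := hd.exists_perturbation h hφ hm
  obtain ⟨D, hD⟩ := hd.exists_left_doubling h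
  have hle1 : |(1 - l) * t| ≤ t := by
    rw [abs_mul, abs_of_pos ht0, abs_of_pos (by linarith)]; nlinarith
  have hle2 : |(1 - l) * -t| ≤ t := by rwa [mul_neg, abs_neg]
  obtain ⟨A₁, hA₁⟩ := ht t (abs_of_pos ht0).le
  obtain ⟨A₂, hA₂⟩ := ht (-t) (by rw [abs_neg, abs_of_pos ht0])
  obtain ⟨A₃, hA₃⟩ := ht _ hle1
  obtain ⟨A₄, hA₄⟩ := ht _ hle2
  obtain ⟨K₁, hK₁, H₁⟩ := IsDualPair.exists_morrey_bound h hφ hp hpq ha hb hd hA₁ hl0 hκq hA₃ hu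
  obtain ⟨K₂, hK₂, H₂⟩ := IsDualPair.exists_morrey_bound h hφ hp hpq ha hb hd hA₂ hl0 hκq hA₄ hu
  set ε : ℝ := (1 - l) * t with hε
  have hε0 : 0 < ε := mul_pos (by linarith) ht0
  rw [show (1 - l) * -t = -ε by rw [hε]; ring, neg_neg] at H₂
  set c : ℝ≥0∞ := 2 * ((C : ℝ≥0∞) ^ (a + b) * ENNReal.ofReal (1 / ε + 1)) with hcdef
  have hct : c ≠ ∞ := ENNReal.mul_ne_top ENNReal.ofNat_ne_top (ENNReal.mul_ne_top
    (ENNReal.rpow_ne_top_of_nonneg hab ENNReal.coe_ne_top) ENNReal.ofReal_ne_top)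
  have hctq : c ^ q ≠ ∞ := ENNReal.rpow_ne_top_of_nonneg hq0.le hct
  set c₂ : ℝ≥0∞ := 2 ^ (q - 1) with hc₂
  have hc₂t : c₂ ≠ ∞ := ENNReal.rpow_ne_top_of_nonneg (by linarith) ENNReal.ofNat_ne_top
  set K₃ : ℝ≥0∞ := c ^ q * (c₂ * (K₁ + K₂)) with hK₃
  have hK₃t : K₃ ≠ ∞ := ENNReal.mul_ne_top hctq
    (ENNReal.mul_ne_top hc₂t (ENNReal.add_ne_top.2 ⟨hK₁, hK₂⟩))
  refine ⟨K₃ ^ (1 / q) * D ^ (κ / p) * D ^ (κ / p), ENNReal.mul_ne_top (ENNReal.mul_ne_top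
    (ENNReal.rpow_ne_top_of_nonneg (by positivity) hK₃t)
    (ENNReal.rpow_ne_top_of_nonneg (by positivity) ENNReal.coe_ne_top))
    (ENNReal.rpow_ne_top_of_nonneg (by positivity) ENNReal.coe_ne_top), fun f hf => ?_⟩
  set N₀ := morreyNorm d μ p κ u v f with hN₀
  set N : ℝ≥0∞ := N₀ * D ^ (κ / p) with hN
  have hball : ∀ x r, 0 < r → ∫⁻ y in ball x r, f y ^ p * u y ∂μ ≤
      (N * (∫⁻ y in ball x r, v y ∂μ) ^ (l / q)) ^ p := by
    intro x r hr
    obtain ⟨B, hB, h1, h2⟩ := hc.outer x r hr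
    calc ∫⁻ y in ball x r, f y ^ p * u y ∂μ ≤ ∫⁻ y in B, f y ^ p * u y ∂μ := lintegral_mono_set h1
      _ ≤ (N₀ * (∫⁻ y in B, v y ∂μ) ^ (κ / p)) ^ p :=
          lintegral_le_morreyNorm hp0 hκ.le hB (hc.left_ne_zero h hd hB) (hc.left_ne_top hd hB)
      _ ≤ (N₀ * (D * ∫⁻ y in ball x r, v y ∂μ) ^ (κ / p)) ^ p := by
          gcongr
          exact (lintegral_mono_set h2).trans (hD x r hr)
      _ = _ := by
          rw [ENNReal.mul_rpow_of_nonneg (D : ℝ≥0∞) _ (by positivity : 0 ≤ κ / p), hN, hlq,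
            mul_assoc]
  set T₁ : X → ℝ≥0∞ := fun y =>
    expWeight ε φ y * ballMax μ (a + b) (fun z => expWeight (-ε) φ z * f z) y with hT₁
  set T₂ : X → ℝ≥0∞ := fun y =>
    expWeight (-ε) φ y * ballMax μ (a + b) (fun z => expWeight ε φ z * f z) y with hT₂
  have hT₁m : AEMeasurable T₁ μ :=
    (aemeasurable_expWeight hφ).mul (measurable_ballMax _ _ _).aemeasurable
  refine morreyNorm_le hq0 fun B hB => ?_
  obtain ⟨x, s, hs, h1, h2⟩ := hc.inner B hB
  set V := ∫⁻ y in B, v y ∂μ with hV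
  set V₂ := ∫⁻ y in ball x (2 * s), v y ∂μ with hV₂
  have hVV : V₂ ≤ D * V := (hD x s hs).trans (by gcongr; exact lintegral_mono_set h1)
  have m1 : AEMeasurable (fun y => T₁ y ^ q * v y) (μ.restrict (ball x (2 * s))) :=
    ((hT₁m.pow_const q).mul hd.left_meas).restrict
  calc _ ≤ ∫⁻ y in ball x (2 * s), c ^ q * (c₂ * (T₁ y ^ q * v y + T₂ y ^ q * v y)) ∂μ := by
        refine (lintegral_mono fun y => ?_).trans (lintegral_mono_set h2)
        calc _ ≤ (c * (T₁ y + T₂ y)) ^ q * v y := by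
              gcongr
              exact averageSup_add_averageSup_le hc h hab hε0 hφ hf y
          _ = c ^ q * (T₁ y + T₂ y) ^ q * v y := by rw [ENNReal.mul_rpow_of_nonneg _ _ hq0.le]
          _ ≤ c ^ q * (c₂ * (T₁ y ^ q + T₂ y ^ q)) * v y := by
              gcongr
              exact ENNReal.rpow_add_le_mul_rpow_add_rpow _ _ (by linarith)
          _ = _ := by ring
    _ = c ^ q * (c₂ * (∫⁻ y in ball x (2 * s), T₁ y ^ q * v y ∂μ +
          ∫⁻ y in ball x (2 * s), T₂ y ^ q * v y ∂μ)) := by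
        rw [lintegral_const_mul' _ _ hctq, lintegral_const_mul' _ _ hc₂t, lintegral_add_left' m1]
    _ ≤ c ^ q * (c₂ * (K₁ * (N ^ q * V₂ ^ l) + K₂ * (N ^ q * V₂ ^ l))) := by
        gcongr
        · exact H₁ f N hf hball x _ (by linarith)
        · exact H₂ f N hf hball x _ (by linarith)
    _ = K₃ * (N ^ q * V₂ ^ l) := by rw [hK₃]; ring
    _ ≤ K₃ * (N ^ q * (D * V) ^ l) := by gcongr
    _ = _ := by
        have hlκ : l = κ / p * q := by rw [hl]; ring
        rw [hN, hlκ, mul_div_cancel_right₀ _ hq0.ne',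
          ENNReal.mul_rpow_of_nonneg _ _ (by positivity : 0 ≤ κ / p * q)]
        simp only [ENNReal.mul_rpow_of_nonneg _ _ hq0.le, ENNReal.rpow_mul]
        rw [← ENNReal.rpow_mul K₃, one_div_mul_cancel hq0.ne', ENNReal.rpow_one]
        ring

end Bound

/-! ### Differences in the extended reals. -/

section Commutator

/-- An upper bound for a difference in the extended reals. -/
lemma abs_mul_sub_le {a β : ℝ} {M M' D : ℝ≥0∞} (hβ : 0 ≤ β) (ha : -β ≤ a) (hM : M ≠ ∞)
    (h1 : M' ≤ ‖a‖ₑ * M + D) (h2 : ‖a‖ₑ * M ≤ M' + D) :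
    ((a : EReal) * (M : EReal) - (M' : EReal)).abs ≤ D + ENNReal.ofReal (2 * β) * M := by
  rcases eq_or_ne D ∞ with rfl | hD
  · simp
  have hM' : M' ≠ ∞ := ne_top_of_le_ne_top
    (ENNReal.add_ne_top.2 ⟨ENNReal.mul_ne_top enorm_ne_top hM, hD⟩) h1
  lift M to ℝ≥0 using hM
  lift M' to ℝ≥0 using hM'
  lift D to ℝ≥0 using hD
  rw [EReal.coe_nnreal_eq_coe_real, EReal.coe_nnreal_eq_coe_real, ← EReal.coe_mul,
    ← EReal.coe_sub, EReal.abs_def]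
  have hn : ‖a‖ₑ = ((‖a‖₊ : ℝ≥0) : ℝ≥0∞) := rfl
  rw [hn] at h1 h2
  norm_cast at h1 h2
  rw [← NNReal.coe_le_coe] at h1 h2
  push_cast at h1 h2
  rw [Real.norm_eq_abs] at h1 h2
  have e1 : (D : ℝ≥0∞) = ENNReal.ofReal D := (ENNReal.ofReal_coe_nnreal).symm
  have e2 : (M : ℝ≥0∞) = ENNReal.ofReal M := (ENNReal.ofReal_coe_nnreal).symm
  rw [e1, e2, ← ENNReal.ofReal_mul (by positivity), ← ENNReal.ofReal_add D.coe_nonneg (by positivity)]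
  refine ENNReal.ofReal_le_ofReal ?_
  have hM0 : (0 : ℝ) ≤ M := M.coe_nonneg
  -- Passing from |a| to a costs twice the negative part, which is at most 2β. This is where the
  -- lower bound for the symbol enters.
  have h3 : |a| * M ≤ a * M + 2 * β * M := by
    rw [← add_mul]
    refine mul_le_mul_of_nonneg_right ?_ hM0
    rcases abs_cases a with h | h <;> linarith
  have h4 : a * M ≤ |a| * M := mul_le_mul_of_nonneg_right (le_abs_self a) hM0

  rw [abs_le]
  constructor <;> nlinarith

/-- A lower bound for a difference in the extended reals. -/
lemma le_abs_mul_sub {a c : ℝ} {M M' : ℝ≥0∞} (hc : 0 ≤ c) (hM : M ≠ ∞)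
    (h : ENNReal.ofReal c * M ≤ M') :
    ENNReal.ofReal (c - a) * M ≤ ((a : EReal) * (M : EReal) - (M' : EReal)).abs := by
  lift M to ℝ≥0 using hM
  rcases eq_or_ne M' ∞ with rfl | hM'
  · rw [EReal.coe_nnreal_eq_coe_real, ← EReal.coe_mul, EReal.coe_ennreal_top,
      EReal.sub_top, EReal.abs_bot]
    exact le_top
  lift M' to ℝ≥0 using hM'
  rw [EReal.coe_nnreal_eq_coe_real, EReal.coe_nnreal_eq_coe_real, ← EReal.coe_mul,
    ← EReal.coe_sub, EReal.abs_def]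
  have e2 : (M : ℝ≥0∞) = ENNReal.ofReal M := (ENNReal.ofReal_coe_nnreal).symm
  have e3 : (M' : ℝ≥0∞) = ENNReal.ofReal M' := (ENNReal.ofReal_coe_nnreal).symm
  rw [e2, e3, ← ENNReal.ofReal_mul hc, ENNReal.ofReal_le_ofReal_iff M'.coe_nonneg] at h
  rw [e2, ← ENNReal.ofReal_mul' M.coe_nonneg]
  refine ENNReal.ofReal_le_ofReal ?_

  rw [abs_sub_comm]
  refine le_trans ?_ (le_abs_self _)
  linarith

end Commutator

section AverageSup

variable {X : Type*} [MeasurableSpace X] {μ : Measure X} {d : X → X → ℝ} {e : ℝ}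
  {F G H : X → ℝ≥0∞} {x : X} {B : Set X}

lemma averageSup_le_add (hG : AEMeasurable G μ) (hF : ∀ y, F y ≤ G y + H y) :
    averageSup d μ e F x ≤ averageSup d μ e G x + averageSup d μ e H x := by
  refine averageSup_le fun B hB hx => ?_
  calc (∫⁻ y in B, F y ∂μ) / μ B ^ e ≤ (∫⁻ y in B, (G y + H y) ∂μ) / μ B ^ e := by
        gcongr with y; exact hF y
    _ = (∫⁻ y in B, G y ∂μ) / μ B ^ e + (∫⁻ y in B, H y ∂μ) / μ B ^ e := by
        rw [lintegral_add_left' hG.restrict, ENNReal.add_div]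
    _ ≤ _ := add_le_add (le_averageSup e G hB hx) (le_averageSup e H hB hx)

lemma averageSup_const_mul {c : ℝ≥0∞} (hc : c ≠ ∞) :
    averageSup d μ e (fun y => c * F y) x = c * averageSup d μ e F x := by
  simp only [averageSup, ENNReal.mul_iSup, lintegral_const_mul' _ _ hc, mul_div_assoc]

end AverageSup

/-! ### Pointwise domination by the maximal commutator. -/

section Pointwise

variable {X : Type*} [MeasurableSpace X] {μ : Measure X} {d : X → X → ℝ} {γ β : ℝ} {φ : X → ℝ}
  {B : Set X} {x : X}

lemma enorm_rclike_ofReal {𝕜 : Type*} [RCLike 𝕜] (r : ℝ) : ‖(r : 𝕜)‖ₑ = ‖r‖ₑ := by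
  rw [← ofReal_norm, RCLike.norm_ofReal, ← Real.norm_eq_abs, ofReal_norm]

lemma enorm_le_enorm_add (s t : ℝ) : ‖s‖ₑ ≤ ‖t‖ₑ + ‖s - t‖ₑ := by
  simpa using enorm_add_le t (s - t)

/-- The commutator of the fractional maximal function is dominated by the maximal commutator at the
points where the symbol is bounded below. -/
lemma abs_fracMaxCommutator_le {𝕜 : Type*} [RCLike 𝕜] {f : X → 𝕜} (hφ : AEMeasurable φ μ)
    (hf : AEMeasurable (fun y => ‖f y‖ₑ) μ) (hβ : 0 ≤ β) (hx : -β ≤ φ x) :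
    (fracMaxCommutator d μ γ φ f x).abs ≤ (ENNReal.ofReal (2 * β) + 1) *
      (averageSup d μ (1 - γ) (fun y => ‖φ y - φ x‖ₑ * ‖f y‖ₑ) x +
        averageSup d μ (1 - γ) (fun y => ‖f y‖ₑ) x) := by
  set D := averageSup d μ (1 - γ) (fun y => ‖φ y - φ x‖ₑ * ‖f y‖ₑ) x with hD
  set M := averageSup d μ (1 - γ) (fun y => ‖f y‖ₑ) x with hM
  -- When M is infinite the right side is infinite too, since its coefficient is at least 1; this
  -- covers any difference of the form ∞ - ∞.
  rcases eq_or_ne M ∞ with hMt | hMt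
  · rw [hMt, add_top, ENNReal.mul_top (by simp)]
    exact le_top
  have h1 : fracMax d μ γ (fun y => (φ y : 𝕜) * f y) x ≤ ‖φ x‖ₑ * M + D := by
    rw [hM, ← averageSup_const_mul enorm_ne_top]
    refine averageSup_le_add (hf.const_mul _) fun y => ?_
    rw [enorm_mul, enorm_rclike_ofReal, ← add_mul]
    gcongr
    exact enorm_le_enorm_add _ _
  have h2 : ‖φ x‖ₑ * M ≤ fracMax d μ γ (fun y => (φ y : 𝕜) * f y) x + D := by
    rw [hM, ← averageSup_const_mul enorm_ne_top]
    have hm : AEMeasurable (fun y => ‖(φ y : 𝕜) * f y‖ₑ) μ := by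
      simp only [enorm_mul, enorm_rclike_ofReal]
      exact hφ.enorm.mul hf
    refine averageSup_le_add hm fun y => ?_
    rw [enorm_mul, enorm_rclike_ofReal, ← add_mul]
    gcongr
    rw [← enorm_neg (φ y - φ x), neg_sub]
    exact enorm_le_enorm_add _ _
  refine (abs_mul_sub_le hβ hx hMt h1 h2).trans ?_
  rw [add_mul, one_mul, mul_add, add_comm]
  gcongr
  · exact le_add_self
  · exact le_self_add

lemma measure_div_rpow (h0 : μ B ≠ 0) (ht : μ B ≠ ∞) : μ B / μ B ^ (1 - γ) = μ B ^ γ := by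
  rw [ENNReal.div_eq_inv_mul, ← ENNReal.rpow_neg]
  nth_rewrite 2 [← ENNReal.rpow_one (μ B)]
  rw [← ENNReal.rpow_add _ _ h0 ht]
  congr 1
  ring

lemma measure_rpow_neg_mul (h0 : μ B ≠ 0) (ht : μ B ≠ ∞) : μ B ^ (-γ) * μ B ^ γ = 1 := by
  rw [← ENNReal.rpow_add _ _ h0 ht, neg_add_cancel, ENNReal.rpow_zero]

lemma setLIntegral_mono_of_nullMeasurableSet {F G : X → ℝ≥0∞} (hn : NullMeasurableSet B μ)
    (h : ∀ y ∈ B, F y ≤ G y) : ∫⁻ y in B, F y ∂μ ≤ ∫⁻ y in B, G y ∂μ :=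
  lintegral_mono_ae ((ae_restrict_mem₀ hn).mono h)

/-- For subballs of B containing x, replacing |φ(y)| by |φ(x)| changes fractional means by at most
the maximal commutator of χ_B. The fractional means of the constant are largest for B itself, so
μ(B)^(-γ) M_{γ,B}(φ)(x) differs from |φ(x)| by a controlled amount. The lower bound of φ handles
|φ(x)| - φ(x). -/
lemma localOscillation_le (hφ : AEMeasurable φ μ) (h0 : ∀ B ∈ balls d, μ B ≠ 0)
    (ht : ∀ B ∈ balls d, μ B ≠ ∞) (hn : ∀ B ∈ balls d, NullMeasurableSet B μ)
    (hγ : 0 ≤ γ) (hB : B ∈ balls d) (hβ : 0 ≤ β) (hx : -β ≤ φ x) :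
    localOscillation d μ γ φ B x ≤ (μ B ^ (-γ) * (ENNReal.ofReal (2 * β) + 1)) *
      (averageSup d μ (1 - γ) (fun y => ‖φ y - φ x‖ₑ * B.indicator 1 y) x +
        averageSup d μ (1 - γ) (B.indicator 1) x) := by
  by_cases hxB : x ∉ B
  · rw [localOscillation, indicator_of_notMem hxB]; exact zero_le
  rw [not_not] at hxB
  rw [localOscillation, indicator_of_mem hxB]
  set D := averageSup d μ (1 - γ) (fun y => ‖φ y - φ x‖ₑ * B.indicator 1 y) x with hD
  set R := fracMaxRel d μ γ B φ x with hR
  have hcancel := measure_rpow_neg_mul (γ := γ) (h0 B hB) (ht B hB)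
  have hsub : ∀ B' ∈ balls d, x ∈ B' → B' ⊆ B →
      (∫⁻ y in B', ‖φ y - φ x‖ₑ ∂μ) / μ B' ^ (1 - γ) ≤ D := by
    intro B' hB' hxB' hBB'
    refine le_trans ?_ (le_averageSup (1 - γ) (fun y => ‖φ y - φ x‖ₑ * B.indicator 1 y) hB' hxB')
    gcongr 1
    refine setLIntegral_mono_of_nullMeasurableSet (hn B' hB') fun y hy => ?_
    rw [indicator_of_mem (hBB' hy), Pi.one_apply, mul_one]
  have h1 : R ≤ ‖φ x‖ₑ * μ B ^ γ + D := by
    refine iSup₂_le fun B' hB' => ?_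
    obtain ⟨hB', hxB', hBB'⟩ := hB'
    calc (∫⁻ y in B', ‖φ y‖ₑ ∂μ) / μ B' ^ (1 - γ)
        ≤ (∫⁻ y in B', (‖φ x‖ₑ + ‖φ y - φ x‖ₑ) ∂μ) / μ B' ^ (1 - γ) := by
          gcongr with y; exact enorm_le_enorm_add _ _
      _ = ‖φ x‖ₑ * (μ B' / μ B' ^ (1 - γ)) +
          (∫⁻ y in B', ‖φ y - φ x‖ₑ ∂μ) / μ B' ^ (1 - γ) := by
          rw [lintegral_add_left measurable_const, setLIntegral_const, ENNReal.add_div,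
            mul_div_assoc]
      _ ≤ _ := by
          rw [measure_div_rpow (h0 B' hB') (ht B' hB')]
          gcongr
          exact hsub B' hB' hxB' hBB'
  have h2 : ‖φ x‖ₑ * μ B ^ γ ≤ R + D := by
    calc ‖φ x‖ₑ * μ B ^ γ = (∫⁻ y in B, ‖φ x‖ₑ ∂μ) / μ B ^ (1 - γ) := by
          rw [setLIntegral_const, mul_div_assoc, measure_div_rpow (h0 B hB) (ht B hB)]
      _ ≤ (∫⁻ y in B, (‖φ y‖ₑ + ‖φ y - φ x‖ₑ) ∂μ) / μ B ^ (1 - γ) := by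
          gcongr with y
          rw [← enorm_neg (φ y - φ x), neg_sub]
          exact enorm_le_enorm_add _ _
      _ = (∫⁻ y in B, ‖φ y‖ₑ ∂μ) / μ B ^ (1 - γ) +
          (∫⁻ y in B, ‖φ y - φ x‖ₑ ∂μ) / μ B ^ (1 - γ) := by
          rw [lintegral_add_left' hφ.enorm.restrict, ENNReal.add_div]
      _ ≤ _ := by
          gcongr
          · exact le_iSup₂ (f := fun B' (_ : B' ∈ {B' ∈ balls d | x ∈ B' ∧ B' ⊆ B}) =>
              (∫⁻ y in B', ‖φ y‖ₑ ∂μ) / μ B' ^ (1 - γ)) B ⟨hB, hxB, subset_rfl⟩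
          · exact hsub B hB hxB subset_rfl
  have h3 : μ B ^ γ ≤ averageSup d μ (1 - γ) (B.indicator 1) x := by
    rw [← measure_div_rpow (h0 B hB) (ht B hB)]
    refine le_trans ?_ (le_averageSup (1 - γ) (B.indicator 1) hB hxB)
    gcongr
    rw [← setLIntegral_one]
    refine setLIntegral_mono_of_nullMeasurableSet (hn B hB) fun y hy => ?_
    rw [indicator_of_mem hy, Pi.one_apply]
  have h4 : μ B ^ (-γ) * R ≤ ‖φ x‖ₑ * 1 + μ B ^ (-γ) * D := by
    calc μ B ^ (-γ) * R ≤ μ B ^ (-γ) * (‖φ x‖ₑ * μ B ^ γ + D) := by gcongr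
      _ = ‖φ x‖ₑ * (μ B ^ (-γ) * μ B ^ γ) + μ B ^ (-γ) * D := by ring
      _ = _ := by rw [hcancel]
  have h5 : ‖φ x‖ₑ * 1 ≤ μ B ^ (-γ) * R + μ B ^ (-γ) * D := by
    calc ‖φ x‖ₑ * 1 = μ B ^ (-γ) * (‖φ x‖ₑ * μ B ^ γ) := by rw [← hcancel]; ring
      _ ≤ μ B ^ (-γ) * (R + D) := by gcongr
      _ = _ := by ring
  have h6 := abs_mul_sub_le hβ hx ENNReal.one_ne_top h4 h5
  rw [EReal.coe_ennreal_one, mul_one] at h6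
  refine h6.trans ?_
  calc μ B ^ (-γ) * D + ENNReal.ofReal (2 * β) * 1
      = μ B ^ (-γ) * (1 * D + ENNReal.ofReal (2 * β) * μ B ^ γ) := by
        rw [mul_add, one_mul, mul_left_comm, hcancel]
    _ ≤ μ B ^ (-γ) * ((ENNReal.ofReal (2 * β) + 1) * D +
        (ENNReal.ofReal (2 * β) + 1) * averageSup d μ (1 - γ) (B.indicator 1) x) := by
        gcongr
        · exact le_add_self
        · exact le_self_add
    _ = _ := by ring

end Pointwise

/-! ### Morrey norms of indicators of balls. -/

section Indicator

variable {X : Type*} [MeasurableSpace X] {μ : Measure X} {d : X → X → ℝ} {p q κ l γ : ℝ}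
  {u v : X → ℝ≥0∞} {B B' : Set X}

lemma setLIntegral_indicator_rpow_mul_le (hq : 0 < q) :
    ∫⁻ y in B', B.indicator (1 : X → ℝ≥0∞) y ^ q * v y ∂μ ≤ ∫⁻ y in B', v y ∂μ := by
  refine lintegral_mono fun y => mul_le_of_le_one_left' (ENNReal.rpow_le_one ?_ hq.le)
  exact indicator_le_self B 1 y

lemma setLIntegral_indicator_rpow_mul_le' (hq : 0 < q) :
    ∫⁻ y in B', B.indicator (1 : X → ℝ≥0∞) y ^ q * v y ∂μ ≤ ∫⁻ y in B, v y ∂μ := by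
  refine (setLIntegral_le_lintegral _ _).trans (le_trans (le_of_eq ?_) (lintegral_indicator_le _ _))
  refine lintegral_congr fun y => ?_
  by_cases hy : y ∈ B
  · simp [hy]
  · simp [hy, ENNReal.zero_rpow_of_pos hq]

/-- The v-integral of χ_B over B' is at most both v(B) and v(B'), hence at most their geometric mean
with exponents 1-l and l. -/
lemma morreyNorm_indicator_le (hq : 0 < q) (hl0 : 0 < l) (hl1 : l < 1) :
    morreyNorm d μ q l v v (B.indicator 1) ≤ (∫⁻ y in B, v y ∂μ) ^ ((1 - l) / q) := by
  refine morreyNorm_le hq fun B' hB' => ?_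
  have h1 := setLIntegral_indicator_rpow_mul_le (μ := μ) (B := B) (B' := B') (v := v) hq
  have h2 := setLIntegral_indicator_rpow_mul_le' (μ := μ) (B := B) (B' := B') (v := v) hq
  set I := ∫⁻ y in B', B.indicator (1 : X → ℝ≥0∞) y ^ q * v y ∂μ
  calc I = I ^ (1 - l) * I ^ l := by
        rw [← ENNReal.rpow_add_of_nonneg _ _ (by linarith) hl0.le, sub_add_cancel, ENNReal.rpow_one]
    _ ≤ (∫⁻ y in B, v y ∂μ) ^ (1 - l) * (∫⁻ y in B', v y ∂μ) ^ l := by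
        gcongr
    _ = _ := by
        rw [ENNReal.mul_rpow_of_nonneg _ _ hq.le, ← ENNReal.rpow_mul, ← ENNReal.rpow_mul,
          div_mul_cancel₀ _ hq.ne', div_mul_cancel₀ _ hq.ne']

lemma morreyNorm_indicator_ne_zero (hq : 0 < q) (hl0 : 0 < l)
    (hv0 : ∀ B ∈ balls d, ∫⁻ y in B, v y ∂μ ≠ 0) (hvt : ∀ B ∈ balls d, ∫⁻ y in B, v y ∂μ ≠ ∞)
    (hB : B ∈ balls d) (hn : NullMeasurableSet B μ) :
    morreyNorm d μ q l v v (B.indicator 1) ≠ 0 := by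
  intro h0
  have h1 := lintegral_le_morreyNorm (u := v) (g := B.indicator 1) hq hl0.le hB (hv0 B hB) (hvt B hB)
  rw [h0, zero_mul, ENNReal.zero_rpow_of_pos hq, nonpos_iff_eq_zero] at h1
  refine hv0 B hB (nonpos_iff_eq_zero.1 (h1 ▸ ?_))
  refine setLIntegral_mono_of_nullMeasurableSet hn fun y hy => ?_
  rw [indicator_of_mem hy, Pi.one_apply, ENNReal.one_rpow, one_mul]

/-- Since u = v^(p/q) and p/q + pγ = 1, Hölder's inequality on B ∩ B' gives v to the power p/q and μ
to the power pγ. The two Morrey exponents agree, as (κq/p)/q = κ/p. -/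
lemma morreyNorm_indicator_le_mul (hp : 0 < p) (hq : 0 < q) (hκ : 0 < κ) (hγ : 0 < γ)
    (hpq : 1 / q = 1 / p - γ) (hv : AEMeasurable v μ) (hu : ∀ x, u x = v x ^ (p / q))
    (hv0 : ∀ B ∈ balls d, ∫⁻ y in B, v y ∂μ ≠ 0) (hvt : ∀ B ∈ balls d, ∫⁻ y in B, v y ∂μ ≠ ∞)
    (hn : NullMeasurableSet B μ) :
    morreyNorm d μ p κ u v (B.indicator 1) ≤
      μ B ^ γ * morreyNorm d μ q (κ * q / p) v v (B.indicator 1) := by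
  refine morreyNorm_le hp fun B' hB' => ?_
  have hsum : p / q + p * γ = 1 := by
    have : p * (1 / q) = 1 - p * γ := by rw [hpq]; field_simp
    rw [div_eq_mul_one_div, this]; ring
  have hχ : AEMeasurable (B.indicator (1 : X → ℝ≥0∞)) μ := aemeasurable_one.indicator₀ hn
  have h1 := lintegral_le_morreyNorm (u := v) (g := B.indicator 1) hq
    (by positivity : 0 ≤ κ * q / p) hB' (hv0 B' hB') (hvt B' hB')
  set N := morreyNorm d μ q (κ * q / p) v v (B.indicator 1)
  set V := ∫⁻ y in B', v y ∂μ
  rw [show κ * q / p / q = κ / p by field_simp] at h1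
  have h2 : ∫⁻ y in B', B.indicator (1 : X → ℝ≥0∞) y ∂μ ≤ μ B := by
    rw [← lintegral_indicator_one₀ hn]
    exact setLIntegral_le_lintegral _ _
  calc ∫⁻ y in B', B.indicator (1 : X → ℝ≥0∞) y ^ p * u y ∂μ
      ≤ ∫⁻ y in B', (B.indicator (1 : X → ℝ≥0∞) y ^ q * v y) ^ (p / q) *
          B.indicator (1 : X → ℝ≥0∞) y ^ (p * γ) ∂μ := by
        refine lintegral_mono fun y => le_of_eq ?_
        rw [hu]
        by_cases hy : y ∈ B
        · simp [hy]
        · simp [hy, ENNReal.zero_rpow_of_pos hp, ENNReal.zero_rpow_of_pos (mul_pos hp hγ)]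
    _ ≤ (∫⁻ y in B', B.indicator (1 : X → ℝ≥0∞) y ^ q * v y ∂μ) ^ (p / q) *
          (∫⁻ y in B', B.indicator (1 : X → ℝ≥0∞) y ∂μ) ^ (p * γ) :=
        ENNReal.lintegral_mul_norm_pow_le (μ := μ.restrict B') ((hχ.pow_const q).mul hv).restrict
          hχ.restrict (by positivity) (by positivity) hsum
    _ ≤ ((N * V ^ (κ / p)) ^ q) ^ (p / q) * μ B ^ (p * γ) := by gcongr
    _ = _ := by
        rw [← ENNReal.rpow_mul, mul_div_cancel₀ _ hq.ne', mul_comm p γ, ENNReal.rpow_mul,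
          ← ENNReal.mul_rpow_of_nonneg _ _ hp.le]
        congr 1
        ring

end Indicator

/-! ### Necessity: oscillation and negative part from one mean. -/

section Necessity

variable {X : Type*} [MeasurableSpace X] {μ : Measure X} {d : X → X → ℝ} {B : Set X} {φ : X → ℝ}

/-- Control of the mean oscillation and of the negative part of a function by the positive part of
its deviation from the average of its modulus. -/
lemma oscillation_le_of_average_abs_sub (hi : IntegrableOn φ B μ) (h0 : μ B ≠ 0) (ht : μ B ≠ ∞)
    {K : ℝ≥0} (hK : ∫⁻ x in B, ENNReal.ofReal ((⨍ y in B, |φ y| ∂μ) - φ x) ∂μ ≤ K * μ B) :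
    ∫⁻ x in B, ‖φ x - ⨍ y in B, φ y ∂μ‖ₑ ∂μ ≤ 2 * (K * μ B) ∧
      2 * ∫⁻ x in B, ENNReal.ofReal (-φ x) ∂μ ≤ K * μ B := by
  have : IsFiniteMeasure (μ.restrict B) := ⟨by rw [Measure.restrict_apply_univ]; exact ht.lt_top⟩
  have hm0 : 0 < μ.real B := ENNReal.toReal_pos h0 ht
  set c := ⨍ y in B, |φ y| ∂μ with hc
  set m := ⨍ y in B, φ y ∂μ with hm
  have hcI : μ.real B * c = ∫ y in B, |φ y| ∂μ := by
    rw [hc, setAverage_eq, smul_eq_mul, mul_inv_cancel_left₀ hm0.ne']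
  have hmI : μ.real B * m = ∫ y in B, φ y ∂μ := by
    rw [hm, setAverage_eq, smul_eq_mul, mul_inv_cancel_left₀ hm0.ne']
  have hmc : m ≤ c := by
    refine le_of_mul_le_mul_left ?_ hm0
    rw [hcI, hmI]
    exact integral_mono hi hi.abs fun y => le_abs_self _
  have hconst : ∀ t : ℝ, ∫ y in B, t ∂μ = μ.real B * t := fun t => by simp
  have hi' : Integrable φ (μ.restrict B) := hi
  have ih : Integrable (fun x => max (c - φ x) 0) (μ.restrict B) :=
    ((integrable_const c).sub hi').pos_part
  have hKr : ∫ x in B, max (c - φ x) 0 ∂μ ≤ K * μ.real B := by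
    rw [← ENNReal.ofReal_le_ofReal_iff (by positivity),
      ofReal_integral_eq_lintegral_ofReal ih (ae_of_all _ fun x => le_max_right _ _),
      ENNReal.ofReal_mul K.coe_nonneg, ENNReal.ofReal_coe_nnreal, ofReal_measureReal ht]
    refine le_trans (lintegral_mono fun x => ?_) hK
    rw [ENNReal.ofReal_max, ENNReal.ofReal_zero, max_eq_left zero_le]
  have hKe : ENNReal.ofReal (K * μ.real B) = K * μ B := by
    rw [ENNReal.ofReal_mul K.coe_nonneg, ENNReal.ofReal_coe_nnreal, ofReal_measureReal ht]
  have im : Integrable (fun x => φ x - m) (μ.restrict B) := hi'.sub (integrable_const m)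
  have ineg : Integrable (fun x => max (-φ x) 0) (μ.restrict B) := hi'.neg.pos_part
  constructor
  · have h1 : ∫ x in B, |φ x - m| ∂μ ≤ 2 * (K * μ.real B) := by
      -- Pointwise, |φ - m| = 2(m-φ)⁺ + (φ-m), and m ≤ c. The second summand has zero integral over
      -- B.
      calc ∫ x in B, |φ x - m| ∂μ ≤ ∫ x in B, (2 * max (c - φ x) 0 + (φ x - m)) ∂μ := by
            refine integral_mono im.abs ((ih.const_mul 2).add im) fun x => ?_
            have e1 := le_max_left (c - φ x) 0
            have e2 := le_max_right (c - φ x) 0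
            show |φ x - m| ≤ 2 * max (c - φ x) 0 + (φ x - m)
            rcases abs_cases (φ x - m) with h | h <;> linarith
        _ = 2 * ∫ x in B, max (c - φ x) 0 ∂μ := by
            rw [integral_add (ih.const_mul 2) im, integral_const_mul,
              integral_sub hi' (integrable_const m), hconst, hmI, sub_self, add_zero]
        _ ≤ _ := by linarith
    have h2 := ENNReal.ofReal_le_ofReal h1
    rw [ENNReal.ofReal_mul zero_le_two, hKe, ENNReal.ofReal_ofNat,
      ofReal_integral_eq_lintegral_ofReal im.abs (ae_of_all _ fun x => abs_nonneg _)] at h2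
    simpa only [Real.enorm_eq_ofReal_abs] using h2
  · have h1 : 2 * ∫ x in B, max (-φ x) 0 ∂μ ≤ K * μ.real B := by
      -- 2φ⁻ = |φ| - φ has the same integral over B as c - φ, because c is the mean of |φ|.
      calc 2 * ∫ x in B, max (-φ x) 0 ∂μ = ∫ x in B, (|φ x| - φ x) ∂μ := by
            rw [← integral_const_mul]
            refine integral_congr_ae (ae_of_all _ fun x => ?_)
            show 2 * max (-φ x) 0 = |φ x| - φ x
            rcases abs_cases (φ x) with h | h
            · rw [h.1, max_eq_right (by linarith)]; ring
            · rw [h.1, max_eq_left (by linarith)]; ring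
        _ = ∫ x in B, (c - φ x) ∂μ := by
            rw [integral_sub hi'.abs hi', integral_sub (integrable_const c) hi', hconst, hcI]
        _ ≤ ∫ x in B, max (c - φ x) 0 ∂μ :=
            integral_mono ((integrable_const c).sub hi') ih fun x => le_max_left _ _
        _ ≤ _ := hKr
    have h2 := ENNReal.ofReal_le_ofReal h1
    rw [ENNReal.ofReal_mul zero_le_two, hKe, ENNReal.ofReal_ofNat,
      ofReal_integral_eq_lintegral_ofReal ineg (ae_of_all _ fun x => le_max_right _ _)] at h2
    refine le_trans ?_ h2
    gcongr
    exact le_max_left _ _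

/-- A three factor Hölder inequality for weights with `v ^ a * σ ^ b = 1`. -/
lemma setLIntegral_le_of_dual {a b γ q : ℝ} {v σ h : X → ℝ≥0∞} (ha : 0 < a) (hb : 0 < b)
    (hγ : 0 < γ) (hsum : a + b + γ = 1) (haq : a * q = 1) (hv : AEMeasurable v μ)
    (hσ : AEMeasurable σ μ) (hd : ∀ᵐ x ∂μ, v x ^ a * σ x ^ b = 1) (hh : AEMeasurable h μ) :
    ∫⁻ y in B, h y ∂μ ≤
      (∫⁻ y in B, h y ^ q * v y ∂μ) ^ a * (∫⁻ y in B, σ y ∂μ) ^ b * μ B ^ γ := by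
  have hab : 0 < a + b := by linarith
  have m1 : AEMeasurable (fun y => h y ^ q * v y) (μ.restrict B) :=
    ((hh.pow_const q).mul hv).restrict
  have e1 : a / (a + b) * (a + b) = a := div_mul_cancel₀ _ hab.ne'
  have e2 : b / (a + b) * (a + b) = b := div_mul_cancel₀ _ hab.ne'
  -- Two nested Hölder inequalities: outer exponents a + b and γ, the latter for the constant 1, and
  -- inner exponents a/(a+b) and b/(a+b).
  calc ∫⁻ y in B, h y ∂μ
      = ∫⁻ y in B, ((h y ^ q * v y) ^ (a / (a + b)) * σ y ^ (b / (a + b))) ^ (a + b) *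
          (1 : ℝ≥0∞) ^ γ ∂μ := by
        refine lintegral_congr_ae (ae_restrict_of_ae ?_)
        filter_upwards [hd] with y hy
        rw [ENNReal.one_rpow, mul_one, ENNReal.mul_rpow_of_nonneg _ _ hab.le, ← ENNReal.rpow_mul,
          ← ENNReal.rpow_mul, e1, e2, ENNReal.mul_rpow_of_nonneg _ _ ha.le, mul_assoc, hy, mul_one,
          ← ENNReal.rpow_mul, mul_comm q, haq, ENNReal.rpow_one]
    _ ≤ (∫⁻ y in B, (h y ^ q * v y) ^ (a / (a + b)) * σ y ^ (b / (a + b)) ∂μ) ^ (a + b) *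
          (∫⁻ y in B, 1 ∂μ) ^ γ :=
        ENNReal.lintegral_mul_norm_pow_le ((m1.pow_const _).mul (hσ.restrict.pow_const _))
          aemeasurable_const hab.le hγ.le hsum
    _ ≤ ((∫⁻ y in B, h y ^ q * v y ∂μ) ^ (a / (a + b)) *
          (∫⁻ y in B, σ y ∂μ) ^ (b / (a + b))) ^ (a + b) * (∫⁻ y in B, 1 ∂μ) ^ γ := by
        gcongr
        exact ENNReal.lintegral_mul_norm_pow_le m1 hσ.restrict (by positivity) (by positivity)
          (by field_simp)
    _ = _ := by
        rw [ENNReal.mul_rpow_of_nonneg _ _ hab.le, ← ENNReal.rpow_mul, ← ENNReal.rpow_mul, e1, e2,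
          setLIntegral_one]

end Necessity

section NecessityBalls

variable {X : Type*} [MetricSpace X] [MeasurableSpace X]
  {μ : Measure X} {C : ℝ≥0} {v σ : X → ℝ≥0∞} {φ : X → ℝ} {d : X → X → ℝ}
  {a b γ q l : ℝ} {A : ℝ≥0∞}

/-- If the positive part of the deviation from the average of the modulus is bounded on every ball
in the Morrey norm, then the function has bounded mean oscillation and its negative part is
bounded. -/
lemma memBMO_and_memLp_of_morreyNorm_le [BorelSpace X] (hc : HasComparableBalls d)
    (h : IsDoubling μ C) (hn : ∀ B ∈ balls d, NullMeasurableSet B μ)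
    (hd : IsDualPair μ a b A v σ) (hγ : 0 < γ) (hsum : a + b + γ = 1) (haq : a = 1 / q)
    (hq : 0 < q) (hl0 : 0 < l) (hl1 : l < 1) (hφ : LocIntegrable d μ φ) (K : ℝ≥0)
    (hF : ∀ B ∈ balls d, ∃ F : X → ℝ≥0∞,
      (∀ x ∈ B, ENNReal.ofReal ((⨍ y in B, |φ y| ∂μ) - φ x) ≤ F x) ∧
      morreyNorm d μ q l v v F ≤ K * morreyNorm d μ q l v v (B.indicator 1)) :
    MemBMO d μ φ ∧ MemLp (fun x => max (-φ x) 0) ∞ μ := by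
  have ha0 := hd.a_pos
  have hb0 := hd.b_pos
  have hab : 0 ≤ a + b := by linarith
  have hv0 : ∀ B ∈ balls d, ∫⁻ y in B, v y ∂μ ≠ 0 := fun B hB => hc.left_ne_zero h hd hB
  have hvt : ∀ B ∈ balls d, ∫⁻ y in B, v y ∂μ ≠ ∞ := fun B hB => hc.left_ne_top hd hB
  have hm : AEMeasurable φ μ := hc.aemeasurable_of_locIntegrable hφ
  obtain ⟨K₁, hK₁⟩ : ∃ K₁ : ℝ≥0, (K₁ : ℝ≥0∞) = K * (A * (C : ℝ≥0∞) ^ (a + b)) :=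
    ⟨_, ENNReal.coe_toNNReal (ENNReal.mul_ne_top ENNReal.coe_ne_top (ENNReal.mul_ne_top
      hd.A_ne_top (ENNReal.rpow_ne_top_of_nonneg hab ENNReal.coe_ne_top)))⟩
  have key : ∀ B ∈ balls d,
      ∫⁻ x in B, ENNReal.ofReal ((⨍ y in B, |φ y| ∂μ) - φ x) ∂μ ≤ K₁ * μ B := by
    intro B hB
    obtain ⟨F, hF1, hF2⟩ := hF B hB
    have h1 := lintegral_le_morreyNorm (u := v) (g := F) hq hl0.le hB (hv0 B hB) (hvt B hB)
    have h2 := morreyNorm_indicator_le (μ := μ) (d := d) (v := v) (B := B) hq hl0 hl1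
    -- Testing the Morrey norm on B itself gives v(B)^(l/q); the norm of χ_B supplies the
    -- complementary v(B)^((1-l)/q). What remains is an ordinary weighted L^q mean bound on B.
    have h3 : ∫⁻ x in B, ENNReal.ofReal ((⨍ y in B, |φ y| ∂μ) - φ x) ^ q * v x ∂μ ≤
        K ^ q * ∫⁻ y in B, v y ∂μ := by
      calc _ ≤ ∫⁻ x in B, F x ^ q * v x ∂μ := by
            refine setLIntegral_mono_of_nullMeasurableSet (hn B hB) fun y hy => ?_
            gcongr
            exact hF1 y hy
        _ ≤ (K * (∫⁻ y in B, v y ∂μ) ^ ((1 - l) / q) * (∫⁻ y in B, v y ∂μ) ^ (l / q)) ^ q := by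
            refine h1.trans ?_
            gcongr
            exact hF2.trans (by gcongr)
        _ = _ := by
            rw [mul_assoc, ← ENNReal.rpow_add _ _ (hv0 B hB) (hvt B hB), ← add_div,
              sub_add_cancel, ENNReal.mul_rpow_of_nonneg _ _ hq.le, ← ENNReal.rpow_mul,
              one_div_mul_cancel hq.ne', ENNReal.rpow_one]
    have hA : (∫⁻ y in B, v y ∂μ) ^ a * (∫⁻ y in B, σ y ∂μ) ^ b ≤
        A * (C : ℝ≥0∞) ^ (a + b) * μ B ^ (a + b) := by
      obtain ⟨x, s, hs, i1, i2⟩ := hc.inner B hB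
      calc _ ≤ (∫⁻ y in ball x (2 * s), v y ∂μ) ^ a * (∫⁻ y in ball x (2 * s), σ y ∂μ) ^ b := by
            gcongr
        _ ≤ A * μ (ball x (2 * s)) ^ (a + b) := hd.le x _ (by linarith)
        _ ≤ A * (C * μ B) ^ (a + b) := by
            gcongr
            exact (h.doubling x s hs).trans (by gcongr)
        _ = _ := by rw [ENNReal.mul_rpow_of_nonneg _ _ hab, mul_assoc]
    calc _ ≤ _ := setLIntegral_le_of_dual ha0 hb0 hγ hsum (by rw [haq, one_div_mul_cancel hq.ne'])
            hd.left_meas hd.right_meas hd.dual ((aemeasurable_const.sub hm).ennreal_ofReal)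
      _ ≤ (K ^ q * ∫⁻ y in B, v y ∂μ) ^ a * (∫⁻ y in B, σ y ∂μ) ^ b * μ B ^ γ := by
            gcongr
            exact h3
      _ = K * ((∫⁻ y in B, v y ∂μ) ^ a * (∫⁻ y in B, σ y ∂μ) ^ b) * μ B ^ γ := by
            rw [ENNReal.mul_rpow_of_nonneg _ _ ha0.le, ← ENNReal.rpow_mul, haq,
              mul_one_div_cancel hq.ne', ENNReal.rpow_one, mul_assoc (K : ℝ≥0∞)]
      _ ≤ K * (A * (C : ℝ≥0∞) ^ (a + b) * μ B ^ (a + b)) * μ B ^ γ := by gcongr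
      _ = K₁ * (μ B ^ (a + b) * μ B ^ γ) := by rw [hK₁]; ring
      _ = _ := by
            rw [← ENNReal.rpow_add_of_nonneg _ _ hab hγ.le, hsum, ENNReal.rpow_one]
  have osc := fun B (hB : B ∈ balls d) => oscillation_le_of_average_abs_sub (hφ B hB)
    (hc.measure_ne_zero h hB) (hc.measure_ne_top h hB) (key B hB)
  refine ⟨⟨hφ, ?_⟩, ?_⟩
  · refine lt_of_le_of_lt (iSup₂_le fun B hB => ?_)
      (ENNReal.mul_lt_top ENNReal.ofNat_lt_top (ENNReal.coe_lt_top (r := K₁)) : 2 * (K₁ : ℝ≥0∞) < ∞)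
    refine ENNReal.div_le_of_le_mul ?_
    rw [mul_assoc]
    exact (osc B hB).1
  · have hball : ∀ x r, 0 < r →
        ∫⁻ y in ball x r, ENNReal.ofReal (-φ y) ∂μ ≤ K₁ * C * μ (ball x r) := by
      intro x r hr
      obtain ⟨B, hB, i1, i2⟩ := hc.outer x r hr
      calc _ ≤ ∫⁻ y in B, ENNReal.ofReal (-φ y) ∂μ := lintegral_mono_set i1
        _ ≤ 2 * ∫⁻ y in B, ENNReal.ofReal (-φ y) ∂μ := by
            rw [two_mul]; exact le_self_add
        _ ≤ K₁ * μ B := (osc B hB).2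
        _ ≤ K₁ * (C * μ (ball x r)) := by
            gcongr
            exact (measure_mono i2).trans (h.doubling x r hr)
        _ = _ := by ring
    have hfin : ∀ x r, ∫⁻ y in ball x r, ENNReal.ofReal (-φ y) ∂μ ≠ ∞ := by
      intro x r
      have hr : 0 < |r| + 1 := by positivity
      refine ne_top_of_le_ne_top (ENNReal.mul_ne_top (ENNReal.mul_ne_top ENNReal.coe_ne_top
        ENNReal.coe_ne_top) h.ne_top) ((lintegral_mono_set (ball_subset_ball ?_)).trans
          (hball x _ hr))
      linarith [le_abs_self r]
    have hae := h.ae_exists_ball hm.neg.ennreal_ofReal hfin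
    have hmax : AEStronglyMeasurable (fun x => max (-φ x) 0) μ :=
      (hm.neg.max aemeasurable_const).aestronglyMeasurable
    refine memLp_top_of_bound hmax (C * (K₁ * C) : ℝ≥0) ?_
    filter_upwards [hae] with x hx
    -- Otherwise differentiation would yield a small ball on which the mean of φ⁻ exceeds the
    -- uniform bound K₁C.
    have h1 : ENNReal.ofReal (-φ x) ≤ C * (K₁ * C) := by
      by_contra hlt
      obtain ⟨δ, hδ, -, h2⟩ := hx _ (not_le.1 hlt) 1 one_pos
      exact absurd (hball x δ hδ) (not_le.2 h2)
    rw [Real.norm_of_nonneg (le_max_right _ _)]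
    refine max_le ?_ (NNReal.coe_nonneg _)
    rw [← ENNReal.ofReal_le_ofReal_iff (NNReal.coe_nonneg _), ENNReal.ofReal_coe_nnreal]
    exact_mod_cast h1

end NecessityBalls

lemma enorm_indicator_one {X 𝕜 : Type*} [RCLike 𝕜] (B : Set X) :
    (fun y => ‖B.indicator (1 : X → 𝕜) y‖ₑ) = B.indicator (1 : X → ℝ≥0∞) := by
  funext y
  by_cases hy : y ∈ B <;> simp [hy]

/-! ### Testing the commutator on indicators of balls; consequences of the conditions on the symbol.
-/

section Symbol

variable {X : Type*} [MeasurableSpace X] {μ : Measure X} {d : X → X → ℝ} {γ : ℝ}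
  {φ : X → ℝ} {B : Set X} {x : X}

/-- The fractional maximal function of the indicator of a ball is constant on the ball. -/
lemma averageSup_indicator_one (h0 : ∀ B ∈ balls d, μ B ≠ 0) (ht : ∀ B ∈ balls d, μ B ≠ ∞)
    (hn : ∀ B ∈ balls d, NullMeasurableSet B μ) (hγ0 : 0 ≤ γ) (hγ1 : γ ≤ 1) (hB : B ∈ balls d)
    (hx : x ∈ B) : averageSup d μ (1 - γ) (B.indicator 1) x = μ B ^ γ := by
  refine le_antisymm (averageSup_le fun B' hB' hx' => ?_) ?_
  · have h1 : ∫⁻ y in B', B.indicator (1 : X → ℝ≥0∞) y ∂μ ≤ μ B := by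
      rw [← lintegral_indicator_one₀ (hn B hB)]
      exact setLIntegral_le_lintegral _ _
    have h2 : ∫⁻ y in B', B.indicator (1 : X → ℝ≥0∞) y ∂μ ≤ μ B' := by
      rw [← setLIntegral_one]
      exact lintegral_mono fun y => indicator_le_self B 1 y
    refine ENNReal.div_le_of_le_mul ?_
    set I := ∫⁻ y in B', B.indicator (1 : X → ℝ≥0∞) y ∂μ
    -- I is at most both μ(B) and μ(B'); using the first bound with exponent γ and the second with
    -- 1-γ shows that no ball does better than B.
    calc I = I ^ γ * I ^ (1 - γ) := by
          rw [← ENNReal.rpow_add_of_nonneg _ _ hγ0 (by linarith), add_sub_cancel,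
            ENNReal.rpow_one]
      _ ≤ μ B ^ γ * μ B' ^ (1 - γ) := by
          have : 0 ≤ 1 - γ := by linarith
          gcongr
  · rw [← measure_div_rpow (h0 B hB) (ht B hB)]
    refine le_trans ?_ (le_averageSup (1 - γ) (B.indicator 1) hB hx)
    gcongr
    rw [← setLIntegral_one]
    refine setLIntegral_mono_of_nullMeasurableSet (hn B hB) fun y hy => ?_
    rw [indicator_of_mem hy, Pi.one_apply]

lemma ofReal_average_abs_mul_rpow (hφ : IntegrableOn φ B μ) (h0 : μ B ≠ 0) (ht : μ B ≠ ∞) :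
    ENNReal.ofReal (⨍ y in B, |φ y| ∂μ) * μ B ^ γ = (∫⁻ y in B, ‖φ y‖ₑ ∂μ) / μ B ^ (1 - γ) := by
  rw [ofReal_setAverage hφ.abs (ae_of_all _ fun _ => abs_nonneg _), ← measure_div_rpow h0 ht]
  simp only [← Real.enorm_eq_ofReal_abs]
  rw [← mul_div_assoc, ENNReal.div_mul_cancel h0 ht]

lemma average_abs_nonneg (φ : X → ℝ) (B : Set X) : 0 ≤ ⨍ y in B, |φ y| ∂μ :=
  integral_nonneg fun _ => abs_nonneg _

/-- B is admissible in the supremum defining M_{γ,B}, so μ(B)^(-γ) M_{γ,B}(φ) is at least the mean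
of |φ| over B. -/
lemma le_localOscillation (h0 : ∀ B ∈ balls d, μ B ≠ 0) (ht : ∀ B ∈ balls d, μ B ≠ ∞)
    (hφ : LocIntegrable d μ φ) (hB : B ∈ balls d) (hx : x ∈ B) :
    ENNReal.ofReal ((⨍ y in B, |φ y| ∂μ) - φ x) ≤ localOscillation d μ γ φ B x := by
  rw [localOscillation, indicator_of_mem hx]
  have h1 : ENNReal.ofReal (⨍ y in B, |φ y| ∂μ) * 1 ≤ μ B ^ (-γ) * fracMaxRel d μ γ B φ x := by
    rw [← measure_rpow_neg_mul (γ := γ) (h0 B hB) (ht B hB), mul_left_comm,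
      ofReal_average_abs_mul_rpow (hφ B hB) (h0 B hB) (ht B hB)]
    gcongr
    exact le_iSup₂ (f := fun B' (_ : B' ∈ {B' ∈ balls d | x ∈ B' ∧ B' ⊆ B}) =>
      (∫⁻ y in B', ‖φ y‖ₑ ∂μ) / μ B' ^ (1 - γ)) B ⟨hB, hx, subset_rfl⟩
  have h2 := le_abs_mul_sub (a := φ x) (average_abs_nonneg φ B) ENNReal.one_ne_top h1
  rwa [mul_one, EReal.coe_ennreal_one, mul_one] at h2

/-- On B the fractional maximal function of χ_B equals μ(B)^γ, and that of φχ_B is at least μ(B)^γ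
times the mean of |φ|. After normalization the commutator is at least that mean minus φ. -/
lemma le_abs_fracMaxCommutator_indicator (𝕜 : Type*) [RCLike 𝕜] (h0 : ∀ B ∈ balls d, μ B ≠ 0)
    (ht : ∀ B ∈ balls d, μ B ≠ ∞) (hn : ∀ B ∈ balls d, NullMeasurableSet B μ) (hγ0 : 0 ≤ γ)
    (hγ1 : γ ≤ 1) (hφ : LocIntegrable d μ φ) (hB : B ∈ balls d) (hx : x ∈ B) :
    ENNReal.ofReal ((⨍ y in B, |φ y| ∂μ) - φ x) ≤
      μ B ^ (-γ) * (fracMaxCommutator d μ γ φ (B.indicator (1 : X → 𝕜)) x).abs := by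
  have hM : fracMax d μ γ (B.indicator (1 : X → 𝕜)) x = μ B ^ γ := by
    rw [← averageSup_indicator_one h0 ht hn hγ0 hγ1 hB hx, ← enorm_indicator_one (𝕜 := 𝕜)]
    rfl
  have h1 : ENNReal.ofReal (⨍ y in B, |φ y| ∂μ) * μ B ^ γ ≤
      fracMax d μ γ (fun y => (φ y : 𝕜) * B.indicator (1 : X → 𝕜) y) x := by
    rw [ofReal_average_abs_mul_rpow (hφ B hB) (h0 B hB) (ht B hB)]
    refine le_trans ?_ (le_averageSup (1 - γ)
      (fun y => ‖(φ y : 𝕜) * B.indicator (1 : X → 𝕜) y‖ₑ) hB hx)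
    gcongr 1
    refine setLIntegral_mono_of_nullMeasurableSet (hn B hB) fun y hy => ?_
    rw [indicator_of_mem hy, Pi.one_apply, mul_one, enorm_rclike_ofReal]
  have h2 := le_abs_mul_sub (a := φ x) (average_abs_nonneg φ B)
    (ENNReal.rpow_ne_top_of_nonneg hγ0 (ht B hB)) h1
  rw [fracMaxCommutator, hM]
  calc _ = μ B ^ (-γ) * (ENNReal.ofReal ((⨍ y in B, |φ y| ∂μ) - φ x) * μ B ^ γ) := by
        rw [mul_left_comm, measure_rpow_neg_mul (h0 B hB) (ht B hB), mul_one]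
    _ ≤ _ := by gcongr

/-- A function of bounded mean oscillation has bounded mean oscillation over metric balls. -/
lemma exists_oscillation_le {X : Type*} [MetricSpace X] [MeasurableSpace X] {μ : Measure X}
    {d : X → X → ℝ} {C : ℝ≥0} {φ : X → ℝ} (hc : HasComparableBalls d) (h : IsDoubling μ C)
    (hφ : MemBMO d μ φ) : ∃ (K : ℝ≥0) (m : X → ℝ → ℝ), ∀ x r, 0 < r →
      ∫⁻ y in ball x r, ‖φ y - m x r‖ₑ ∂μ ≤ K * μ (ball x r) := by
  obtain ⟨-, hS⟩ := hφ
  set S := ⨆ B ∈ balls d, eAverage μ B (fun x => ‖φ x - ⨍ y in B, φ y ∂μ‖ₑ) with hSdef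
  choose! B hB h1 h2 using hc.outer
  -- The centre value is the mean over a comparable quasi-metric ball, not over the metric ball
  -- itself. John–Nirenberg was stated for arbitrary centre values for this reason.
  refine ⟨S.toNNReal * C, fun x r => ⨍ y in B x r, φ y ∂μ, fun x r hr => ?_⟩
  have hBr := hB x r hr
  have h3 : eAverage μ (B x r) (fun y => ‖φ y - ⨍ z in B x r, φ z ∂μ‖ₑ) ≤ S :=
    le_iSup₂ (f := fun B (_ : B ∈ balls d) =>
      eAverage μ B (fun x => ‖φ x - ⨍ y in B, φ y ∂μ‖ₑ)) (B x r) hBr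
  rw [eAverage, ENNReal.div_le_iff (hc.measure_ne_zero h hBr) (hc.measure_ne_top h hBr)] at h3
  calc _ ≤ ∫⁻ y in B x r, ‖φ y - ⨍ z in B x r, φ z ∂μ‖ₑ ∂μ := lintegral_mono_set (h1 x r hr)
    _ ≤ S * (C * μ (ball x r)) := h3.trans (by
        gcongr
        exact (measure_mono (h2 x r hr)).trans (h.doubling x r hr))
    _ = _ := by rw [ENNReal.coe_mul, ENNReal.coe_toNNReal hS.ne, mul_assoc]

lemma exists_ae_neg_le (h : MemLp (fun x => max (-φ x) 0) ∞ μ) :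
    ∃ β : ℝ, 0 ≤ β ∧ ∀ᵐ x ∂μ, -β ≤ φ x := by
  refine ⟨(eLpNorm (fun x => max (-φ x) 0) ∞ μ).toReal, ENNReal.toReal_nonneg, ?_⟩
  have h1 := h.2
  rw [eLpNorm_exponent_top] at h1 ⊢
  filter_upwards [enorm_ae_le_eLpNormEssSup (fun x => max (-φ x) 0) μ] with x hx
  rw [Real.enorm_of_nonneg (le_max_right _ _), ENNReal.ofReal_le_iff_le_toReal h1.ne] at hx
  linarith [le_max_left (-φ x) 0]

end Symbol

/-! ### The equivalence on a doubling metric space. -/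

section Main

variable {X : Type*} [MetricSpace X] [MeasurableSpace X] [BorelSpace X] (𝕜 : Type*) [RCLike 𝕜]
  {d : X → X → ℝ} {μ : Measure X} {C : ℝ≥0} {γ κ p q : ℝ} {ω : X → ℝ} {φ : X → ℝ}

/-- The characterization of the boundedness of the commutator on a doubling metric measure space
whose balls are comparable with those of a quasi-metric. -/
lemma tfae_of_hasComparableBalls (hc : HasComparableBalls d) (h : IsDoubling μ C)
    (hn : ∀ B ∈ balls d, NullMeasurableSet B μ) (hγ0 : 0 < γ) (hγ1 : γ < 1) (hκ0 : 0 < κ)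
    (hp1 : 1 < p) (hq0 : 0 < q) (hq : 1 / q = 1 / p - γ) (hκq : κ * q / p < 1)
    (hω : MemApq d μ p q ω) (hφ : LocIntegrable d μ φ) :
    List.TFAE [
      MemBMO d μ φ ∧ MemLp (fun x => max (-φ x) 0) ∞ μ,
      ∃ C : ℝ≥0, ∀ f : X → 𝕜, MemMorrey d μ p κ (wpow ω p) (wpow ω q) f →
        morreyNorm d μ q (κ * q / p) (wpow ω q) (wpow ω q)
            (fun x => (fracMaxCommutator d μ γ φ f x).abs)
          ≤ C * morreyNorm d μ p κ (wpow ω p) (wpow ω q) (fun x => ‖f x‖ₑ),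
      ∃ C : ℝ≥0,
        (⨆ B ∈ balls d,
          morreyNorm d μ q (κ * q / p) (wpow ω q) (wpow ω q) (localOscillation d μ γ φ B) /
            morreyNorm d μ q (κ * q / p) (wpow ω q) (wpow ω q)
              (B.indicator fun _ => 1)) < C] := by
  have hp0 : 0 < p := by linarith
  have hpq : p < q := by
    by_contra hle
    have := one_div_le_one_div_of_le hq0 (not_lt.1 hle)
    linarith
  obtain ⟨A, hd⟩ := exists_isDualPair_of_memApq hc h hp1 hq0 hω
  have hab : 1 / q + (1 - 1 / p) = 1 - γ := by rw [hq]; ring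
  have hsum : 1 / q + (1 - 1 / p) + γ = 1 := by rw [hab]; ring
  have hl0 : 0 < κ * q / p := by positivity
  have hφm : AEMeasurable φ μ := hc.aemeasurable_of_locIntegrable hφ
  have h0 : ∀ B ∈ balls d, μ B ≠ 0 := fun B hB => hc.measure_ne_zero h hB
  have ht : ∀ B ∈ balls d, μ B ≠ ∞ := fun B hB => hc.measure_ne_top h hB
  have hv0 : ∀ B ∈ balls d, ∫⁻ y in B, wpow ω q y ∂μ ≠ 0 := fun B hB => hc.left_ne_zero h hd hB
  have hvt : ∀ B ∈ balls d, ∫⁻ y in B, wpow ω q y ∂μ ≠ ∞ := fun B hB => hc.left_ne_top hd hB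
  have hu : ∀ x, wpow ω p x = wpow ω q x ^ (p / q) := fun x => by
    rw [wpow, wpow, ← ENNReal.rpow_mul, mul_div_cancel₀ _ hq0.ne']
  have huσ : ∀ᵐ x ∂μ, wpow ω p x = wpow ω (-(p / (p - 1))) x ^ (1 - p) := ae_of_all _ fun x => by
    have hp2 : p - 1 ≠ 0 := by linarith
    rw [wpow, wpow, ← ENNReal.rpow_mul]
    congr 1
    field_simp
    ring
  set v := wpow ω q with hv
  set u := wpow ω p with hudef
  set l := κ * q / p with hl
  have hnormle : ∀ B ∈ balls d, morreyNorm d μ p κ u v (B.indicator 1) ≤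
      μ B ^ γ * morreyNorm d μ q l v v (B.indicator 1) := fun B hB =>
    morreyNorm_indicator_le_mul hp0 hq0 hκ0 hγ0 hq hd.left_meas hu hv0 hvt (hn B hB)
  have hnormt : ∀ B ∈ balls d, morreyNorm d μ q l v v (B.indicator 1) ≠ ∞ := fun B hB =>
    ne_top_of_le_ne_top (ENNReal.rpow_ne_top_of_nonneg (div_nonneg (by linarith) hq0.le)
      (hvt B hB)) (morreyNorm_indicator_le hq0 hl0 hκq)
  have hnorm0 : ∀ B ∈ balls d, morreyNorm d μ q l v v (B.indicator 1) ≠ 0 := fun B hB =>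
    morreyNorm_indicator_ne_zero hq0 hl0 hv0 hvt hB (hn B hB)
  have hcancel : ∀ B ∈ balls d, ∀ c : ℝ≥0∞,
      μ B ^ (-γ) * (c * (μ B ^ γ * morreyNorm d μ q l v v (B.indicator 1))) =
        c * morreyNorm d μ q l v v (B.indicator 1) := fun B hB c => by
    calc _ = μ B ^ (-γ) * μ B ^ γ * (c * morreyNorm d μ q l v v (B.indicator 1)) := by ring
      _ = _ := by rw [measure_rpow_neg_mul (h0 B hB) (ht B hB), one_mul]
  have hnegt : ∀ B ∈ balls d, μ B ^ (-γ) ≠ ∞ := fun B hB => by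
    rw [ENNReal.rpow_neg]
    exact ENNReal.inv_ne_top.2 (ENNReal.rpow_pos (h0 B hB).bot_lt (ht B hB)).ne'
  -- the maximal commutator estimate
  have bound : MemBMO d μ φ → ∃ K' : ℝ≥0∞, K' ≠ ∞ ∧ ∀ f : X → ℝ≥0∞, AEMeasurable f μ →
      morreyNorm d μ q l v v (fun x =>
        averageSup d μ (1 - γ) (fun y => ‖φ y - φ x‖ₑ * f y) x + averageSup d μ (1 - γ) f x) ≤
      K' * morreyNorm d μ p κ u v f := by
    intro hbmo
    obtain ⟨K, m, hm⟩ := exists_oscillation_le hc h hbmo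
    have := exists_morreyNorm_averageSup_le hc h hφm hm hp1 hpq rfl rfl hd hκ0 hκq huσ
    rwa [hab] at this
  tfae_have 1 → 2 := by
    rintro ⟨hbmo, hneg⟩
    obtain ⟨K', hK', hbd⟩ := bound hbmo
    obtain ⟨β, hβ, hae⟩ := exists_ae_neg_le hneg
    have hct : ENNReal.ofReal (2 * β) + 1 ≠ ∞ :=
      ENNReal.add_ne_top.2 ⟨ENNReal.ofReal_ne_top, ENNReal.one_ne_top⟩
    refine ⟨((ENNReal.ofReal (2 * β) + 1) * K').toNNReal, fun f hf => ?_⟩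
    have hfm : AEMeasurable (fun y => ‖f y‖ₑ) μ := hf.1.enorm
    rw [ENNReal.coe_toNNReal (ENNReal.mul_ne_top hct hK'), mul_assoc]
    refine (morreyNorm_le_const_mul hq0 hl0.le hv0 hvt hct ?_).trans
      (mul_le_mul_right (hbd _ hfm) _)
    filter_upwards [hae] with x hx
    exact abs_fracMaxCommutator_le hφm hfm hβ hx
  tfae_have 1 → 3 := by
    rintro ⟨hbmo, hneg⟩
    obtain ⟨K', hK', hbd⟩ := bound hbmo
    obtain ⟨β, hβ, hae⟩ := exists_ae_neg_le hneg
    have hct : ENNReal.ofReal (2 * β) + 1 ≠ ∞ :=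
      ENNReal.add_ne_top.2 ⟨ENNReal.ofReal_ne_top, ENNReal.one_ne_top⟩
    set c := ENNReal.ofReal (2 * β) + 1
    have hcK : c * K' ≠ ∞ := ENNReal.mul_ne_top hct hK'
    -- The added 1 makes the inequality strict.
    refine ⟨(c * K').toNNReal + 1, lt_of_le_of_lt (b := c * K') (iSup₂_le fun B hB => ?_) ?_⟩
    · refine ENNReal.div_le_of_le_mul ?_
      have h1 : morreyNorm d μ q l v v (localOscillation d μ γ φ B) ≤ _ :=
        morreyNorm_le_const_mul (c := μ B ^ (-γ) * c) hq0 hl0.le hv0 hvt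
          (ENNReal.mul_ne_top (hnegt B hB) hct) (by
            filter_upwards [hae] with x hx
            exact localOscillation_le hφm h0 ht hn hγ0.le hB hβ hx)
      refine h1.trans ?_
      calc _ ≤ μ B ^ (-γ) * c * (K' * (μ B ^ γ * morreyNorm d μ q l v v (B.indicator 1))) := by
            gcongr
            exact (hbd _ (aemeasurable_one.indicator₀ (hn B hB))).trans
              (by gcongr; exact hnormle B hB)
        _ = μ B ^ (-γ) * (c * K' * (μ B ^ γ * morreyNorm d μ q l v v (B.indicator 1))) := by ring
        _ = _ := hcancel B hB _
    · rw [ENNReal.coe_add, ENNReal.coe_toNNReal hcK, ENNReal.coe_one]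
      exact ENNReal.lt_add_right hcK one_ne_zero
  tfae_have 2 → 1 := by
    rintro ⟨K, hK⟩
    refine memBMO_and_memLp_of_morreyNorm_le hc h hn hd hγ0 hsum rfl hq0 hl0 hκq hφ K
      fun B hB => ⟨_, fun x hx => le_abs_fracMaxCommutator_indicator 𝕜 h0 ht hn hγ0.le hγ1.le hφ hB
        hx, ?_⟩
    -- Indicators of balls are admissible test functions. Their norm in the source space is at most
    -- μ(B)^γ times that in the target, and this factor cancels the normalization μ(B)^(-γ).
    have hmem : MemMorrey d μ p κ u v (B.indicator (1 : X → 𝕜)) := by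
      refine ⟨aestronglyMeasurable_one.indicator₀ (hn B hB), fun B' hB' => ?_, ?_⟩
      · have := setLIntegral_indicator_rpow_mul_le (μ := μ) (B := B) (B' := B') (v := v) hp0
        rw [← enorm_indicator_one (𝕜 := 𝕜)] at this
        exact this.trans_lt (hvt B' hB').lt_top
      · rw [enorm_indicator_one]
        exact (hnormle B hB).trans_lt (ENNReal.mul_lt_top
          (ENNReal.rpow_ne_top_of_nonneg hγ0.le (ht B hB)).lt_top (hnormt B hB).lt_top)
    have h1 := hK _ hmem
    rw [enorm_indicator_one] at h1
    refine (morreyNorm_le_const_mul hq0 hl0.le hv0 hvt (hnegt B hB)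
      (ae_of_all _ fun x => le_rfl)).trans ?_
    rw [← hcancel B hB]
    gcongr
    exact h1.trans (by gcongr; exact hnormle B hB)
  tfae_have 3 → 1 := by
    rintro ⟨K, hK⟩
    refine memBMO_and_memLp_of_morreyNorm_le hc h hn hd hγ0 hsum rfl hq0 hl0 hκq hφ K
      fun B hB => ⟨_, fun x hx => le_localOscillation (γ := γ) h0 ht hφ hB hx, ?_⟩
    rw [← ENNReal.div_le_iff (hnorm0 B hB) (hnormt B hB)]
    exact (le_iSup₂ (f := fun B (_ : B ∈ balls d) =>
      morreyNorm d μ q l v v (localOscillation d μ γ φ B) /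
        morreyNorm d μ q l v v (B.indicator fun _ => 1)) B hB).trans hK.le
  tfae_finish

end Main

end DoublingSpace

theorem theorem1p4 {X : Type*} [MeasurableSpace X] (𝕜 : Type*) [RCLike 𝕜]
    (d : X → X → ℝ) (μ : Measure X) (hX : IsHomogeneousType d μ)
    (hμ_univ : μ Set.univ = ∞) (hμ_point : ∀ x : X, μ {x} = 0)
    (γ κ p q : ℝ) (hγ0 : 0 < γ) (hγ1 : γ < 1) (hκ0 : 0 < κ) (hκ1 : κ < 1)
    (hp1 : 1 < p) (hpγ : p < 1 / γ) (hq : 1 / q = 1 / p - γ) (hκq : κ * q / p < 1)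
    (ω : X → ℝ) (hω : MemApq d μ p q ω)
    (b : X → ℝ) (hb : LocIntegrable d μ b) :
    List.TFAE [
      MemBMO d μ b ∧ MemLp (fun x => max (-b x) 0) ∞ μ,
      ∃ C : ℝ≥0, ∀ f : X → 𝕜, MemMorrey d μ p κ (wpow ω p) (wpow ω q) f →
        morreyNorm d μ q (κ * q / p) (wpow ω q) (wpow ω q)
            (fun x => (fracMaxCommutator d μ γ b f x).abs)
          ≤ C * morreyNorm d μ p κ (wpow ω p) (wpow ω q) (fun x => ‖f x‖ₑ),
      ∃ C : ℝ≥0,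
        (⨆ B ∈ balls d,
          morreyNorm d μ q (κ * q / p) (wpow ω q) (wpow ω q) (localOscillation d μ γ b B) /
            morreyNorm d μ q (κ * q / p) (wpow ω q) (wpow ω q)
              (B.indicator fun _ => 1)) < C] := by
  obtain ⟨α, m, hα, hle, hge⟩ := DoublingSpace.exists_metricSpace_of_isQuasiMetric hX.quasiMetric
  have hd := hX.quasiMetric.nonneg
  let _ : MetricSpace X := m
  -- The comparison of balls makes the topology of `d` the metric topology, so the given σ-algebra
  -- is the Borel σ-algebra of the metric.
  have hborel : BorelSpace X :=
    ⟨by rw [hX.borel, DoublingSpace.quasiTopology_eq hd hα hle hge]⟩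
  obtain ⟨C, hC⟩ := DoublingSpace.exists_isDoubling hX hα hle hge
  -- Positivity of q comes from p < 1/γ, which makes 1/p - γ positive.
  have hq0 : 0 < q := by
    have h1 : γ < 1 / p := by rwa [lt_one_div hγ0 (by linarith)]
    exact one_div_pos.1 (by rw [hq]; linarith)
  exact DoublingSpace.tfae_of_hasComparableBalls 𝕜 (DoublingSpace.hasComparableBalls hd hα hle hge)
    hC hX.ball_measurable hγ0 hγ1 hκ0 hp1 hq0 hq hκq hω hb
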